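/- **Lemma (laminate of isotropic materials with vanishing Poisson ratio).** Write points of $(-\frac12,\frac12)\times\mathbb R^2$ as $(x_3,y)$, $y=(y_1,y_2)$, and let $\Box=(-\frac12,\frac12)\times[-\frac12,\frac12)^2$. Let $0<\alpha\le\beta$. Let $Q:(-\frac12,\frac12)\times\mathbb R^2\times\mathbb R^{3\times3}\to\mathbb R$ be Borel, $\mathbb Z^2$-periodic in $y$, and such that for a.e. $(x_3,y)$ the map $Q(x_3,y,\cdot)$ is a quadratic form with $\alpha|\mathrm{sym}\,G|^2\le Q(x_3,y,G)\le\beta|\mathrm{sym}\,G|^2$ for all $G$. Let $B:(-\frac12,\frac12)\times\mathbb R^2\to\mathbb R^{3\times3}_{\rm sym}$ be Borel, $\mathbb Z^2$-periodic in $y$ and square integrable on $\Box$. Let $H^1_\gamma(\Box)$ be the set of functions in $H^1_{\rm loc}((-\frac12,\frac12)\times\mathbb R^2)$ that are $\mathbb Z^2$-periodic in $y$ and, together with their weak gradient, square integrable on $\Box$; put $\nabla_\gamma=(\partial_{y_1},\partial_{y_2},\frac1\gamma\partial_3)$. For $G\in\mathbb R^{2\times2}$ let $\iota(G)\in\mathbb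 R^{3\times 3}$ have upper-left block $G$ and vanishing third row and column. For $\gamma\in(0,\infty)$ and $G\in\mathbb R^{2\times2}_{\rm sym}$ define $$Q^\gamma_{\hom}(G)=\inf_{M\in\mathbb R^{2\times2}_{\rm sym},\ \varphi\in H^1_\gamma(\Box;\mathbb R^3)}\int_\Box Q\big(x_3,y,\iota(x_3G+M)+\mathrm{sym}\nabla_\gamma\varphi\big)\,d(x_3,y).$$ On square integrable, $y$-periodic symmetric matrix fields use the scalar product $(F,F')=\int_\Box\frac12\big(Q(x_3,y,F+F')-Q(x_3,y,F)-Q(x_3,y,F')\big)\,d(x_3,y)$. Let $\mathbf H_{\rm rel}=\{\iota(M)+\mathrm{sym}\nabla_\gamma\varphi: M\in\mathbb R^{2\times2}_{\rm sym},\ \varphi\in H^1_\gamma(\Box;\mathbb R^3)\}$, $\mathbf H=\{\iota(x_3G)+\chi: G\in\mathbb R^{2\times2}_{\rm sym},\ \chi\in\mathbf H_{\rm rel}\}$, and let $P$ be the orthogonal projection onto the orthogonal complement of $\mathbf H_{\rm rel}$ in $\mathbf H$. The effective prestrain $B^\gamma_{\rm eff}$ is the symmetric $2\times2$ matrix $A$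 with $P(\iota(x_3A))=P(\mathrm{sym}\,B)$. The coefficients $\widehat G_1,\widehat G_2,\widehat G_3$ of $G\in\mathbb R^{2\times2}_{\rm sym}$ are those in the orthonormal basis $e_1\otimes e_1$, $e_2\otimes e_2$, $\frac1{\sqrt2}(e_1\otimes e_2+e_2\otimes e_1)$. Suppose that $Q(x_3,y,G)=2\mu(y_1)|\mathrm{sym}\,G|^2$ for a.e. $(x_3,y)$ and all $G$, with $\mu(-y_1)=\mu(y_1)$ for a.e. $y_1\in(-\frac12,\frac12)$. Put $$\langle\mu\rangle_h=\Big(\int_{-1/2}^{1/2}\frac1\mu\,dy_1\Big)^{-1},\qquad \bar\mu=\int_{-1/2}^{1/2}\mu\,dy_1,$$ $$\mu_\gamma=\min_{w\in\mathcal H}\int_\Box\mu\Big(\big(\sqrt{12}\,x_3+\partial_{y_1}w\big)^2+\big(\tfrac1\gamma\partial_3w\big)^2\Big)\,d(x_3,y),$$ where $\mathcal H=\{w\in H^1_\gamma(\Box;\mathbb R):\int_\Box w=0,\ \partial_{y_2}w=0\text{ a.e.}\}$. Then, for every $\gamma\in(0,\infty)$, the minimum that defines $\mu_\gamma$ is attained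 and $B^\gamma_{\rm eff}$ exists and is unique, and the following hold. (a) $\langle\mu\rangle_h\le\mu_\gamma\le\bar\mu$ for all $\gamma\in(0,\infty)$. The map $(0,\infty)\ni\gamma\mapsto\mu_\gamma$ is continuous and monotonically decreasing, with $\lim_{\gamma\to0}\mu_\gamma=\bar\mu$ and $\lim_{\gamma\to\infty}\mu_\gamma=\langle\mu\rangle_h$. If $\mu$ is not a.e. equal to a constant on $(-\frac12,\frac12)$, the map is strictly decreasing. (b) For all $\gamma\in(0,\infty)$ the form $Q^\gamma_{\hom}$ is orthotropic: for all $G\in\mathbb R^{2\times2}_{\rm sym}$, $$Q^\gamma_{\hom}(G)=\widehat G_1^2q_1+\widehat G_1\widehat G_2q_{12}+\widehat G_2^2q_2+\widehat G_3^2q_3,\qquad q_1=\tfrac16\langle\mu\rangle_h,\quad q_2=\tfrac16\bar\mu,\quad q_3=\tfrac16\mu_\gamma,\quad q_{12}=0.$$ (c) If $B(x_3,y)=\rho(x_3,y_1)I_{3\times3}$ for a.e. $(x_3,y)$ with a scalar function $\rho$, then for all $\gamma\in(0,\infty)$ the coefficients of $B^\gamma_{\rm eff}$ are $$\widehat B^\gamma_{{\rm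 eff},1}=12\int_\Box\rho\,x_3\,d(x_3,y),\qquad \widehat B^\gamma_{{\rm eff},2}=\frac{12}{\bar\mu}\int_\Box\mu\,\rho\,x_3\,d(x_3,y),\qquad \widehat B^\gamma_{{\rm eff},3}=0.$$ -/

import Mathlib

open Set Filter Topology MeasureTheory
open scoped ContDiff

noncomputable section

namespace PlateLaminate

/-- Points `(x₃, y₁, y₂)` of `ℝ × ℝ²`. -/
abbrev Pt : Type := ℝ × ℝ × ℝ

abbrev Mat2 : Type := Matrix (Fin 2) (Fin 2) ℝ

abbrev Mat3 : Type := Matrix (Fin 3) (Fin 3) ℝ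

/-- The slab `(-1/2, 1/2) × ℝ²`. -/
def Slab : Set Pt := Ioo (-1 / 2 : ℝ) (1 / 2) ×ˢ (univ : Set (ℝ × ℝ))

/-- The representative volume element `□ = (-1/2, 1/2) × [-1/2, 1/2)²`. It has volume one, so
that the mean value over `□` is the integral over `□`. -/
def Box : Set Pt :=
  Ioo (-1 / 2 : ℝ) (1 / 2) ×ˢ (Ico (-1 / 2 : ℝ) (1 / 2) ×ˢ Ico (-1 / 2 : ℝ) (1 / 2))

/-! ### Matrices -/

/-- The symmetric part of a matrix. -/
def symPart {n : ℕ} (A : Matrix (Fin n) (Fin n) ℝ) : Matrix (Fin n) (Fin n) ℝ :=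
  (1 / 2 : ℝ) • (A + A.transpose)

/-- The standard scalar product `A : B` of matrices. -/
def frob {n : ℕ} (A B : Matrix (Fin n) (Fin n) ℝ) : ℝ := ∑ i, ∑ j, A i j * B i j

/-- The embedding of a `2 × 2` matrix as the upper left block of a `3 × 3` matrix. -/
def iota (G : Mat2) : Mat3 := !![G 0 0, G 0 1, 0; G 1 0, G 1 1, 0; 0, 0, 0]

/-- The canonical orthonormal basis `G₁, G₂, G₃` of the symmetric `2 × 2` matrices. -/
def basisG : Fin 3 → Mat2 :=
  ![!![1, 0; 0, 0], !![0, 0; 0, 1], (1 / Real.sqrt 2) • !![0, 1; 1, 0]]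

/-- The coefficients of a symmetric `2 × 2` matrix in the orthonormal basis `basisG`. -/
def coeffG (i : Fin 3) (G : Mat2) : ℝ := frob G (basisG i)

/-- `q` is orthotropic with the coefficients `q₁, q₂, q₁₂, q₃`. -/
def IsOrthotropicWith (q : Mat2 → ℝ) (q₁ q₂ q₁₂ q₃ : ℝ) : Prop :=
  ∀ G : Mat2, G.IsSymm →
    q G = ((coeffG 0 G) ^ 2 * q₁ + coeffG 0 G * coeffG 1 G * q₁₂ + (coeffG 1 G) ^ 2 * q₂)
      + (coeffG 2 G) ^ 2 * q₃

/-! ### Admissible quadratic forms and prestrains -/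

/-- `ℤ²`-periodicity in the in-plane variable `y`. -/
def IsPeriodic {X : Type} (f : Pt → X) : Prop :=
  ∀ k l : ℤ, ∀ᵐ p ∂(volume.restrict Slab), f (p.1, p.2.1 + (k : ℝ), p.2.2 + (l : ℝ)) = f p

/-- `q` is a quadratic form on `3 × 3` matrices with `α |sym G|² ≤ q(G) ≤ β |sym G|²`. -/
def IsClassQ (α β : ℝ) (q : Mat3 → ℝ) : Prop :=
  (∃ q' : QuadraticForm ℝ Mat3, ∀ G, q G = q' G) ∧
    ∀ G, α * frob (symPart G) (symPart G) ≤ q G ∧ q G ≤ β * frob (symPart G) (symPart G)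

/-- Periodic admissible quadratic forms (for the lattice `ℤ²`). -/
structure IsAdmissibleForm (α β : ℝ) (Q : Pt → Mat3 → ℝ) : Prop where
  borel : Measurable fun z : Slab × (Fin 3 → Fin 3 → ℝ) => Q z.1 (Matrix.of z.2)
  classQ : ∀ᵐ p ∂(volume.restrict Slab), IsClassQ α β (Q p)
  periodic : ∀ G : Mat3, IsPeriodic fun p => Q p G

/-- Periodic admissible prestrains (for the lattice `ℤ²`). -/
structure IsAdmissiblePrestrain (B : Pt → Mat3) : Prop where
  borel : ∀ i j, Measurable fun p : Slab => B p i j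
  symm : ∀ p ∈ Slab, (B p).IsSymm
  square_integrable : IntegrableOn (fun p => frob (B p) (B p)) Box
  periodic : IsPeriodic B

/-! ### Sobolev functions -/

/-- The coordinate directions, in the order `y₁, y₂, x₃`. -/
def dir : Fin 3 → Pt := ![(0, 1, 0), (0, 0, 1), (1, 0, 0)]

/-- `g = (∂_{y₁} u, ∂_{y₂} u, ∂₃ u)` in the weak sense on the slab. -/
structure IsWeakGrad (u : Pt → ℝ) (g : Fin 3 → Pt → ℝ) : Prop where
  locallyIntegrable : LocallyIntegrableOn u Slab
  locallyIntegrable_grad : ∀ i, LocallyIntegrableOn (g i) Slab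
  integral_eq : ∀ i, ∀ η : Pt → ℝ, ContDiff ℝ ∞ η → HasCompactSupport η → tsupport η ⊆ Slab →
    ∫ p in Slab, u p * fderiv ℝ η p (dir i) = - ∫ p in Slab, g i p * η p

/-- `u` belongs to the space `H¹_γ(□)` of local `H¹` functions on the slab that are `ℤ²`-periodic
in `y` and square integrable over `□` together with their gradient, and `g` is the weak gradient
of `u`. (For `γ ∈ (0, ∞)` the parameter only enters the norm, not the set of functions.) -/
structure MemH1 (u : Pt → ℝ) (g : Fin 3 → Pt → ℝ) : Prop where
  weakGrad : IsWeakGrad u g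
  periodic : IsPeriodic u
  memLp : MemLp u 2 (volume.restrict Box)
  memLp_grad : ∀ i, MemLp (g i) 2 (volume.restrict Box)

/-- The matrix `∇_γ φ(p)`, with the entries `∂_{y₁} φᵢ`, `∂_{y₂} φᵢ`, `γ⁻¹ ∂₃ φᵢ` in row `i`,
where `g i` is the gradient of the component `φᵢ`. -/
def scaledGrad (γ : ℝ) (g : Fin 3 → Fin 3 → Pt → ℝ) (p : Pt) : Mat3 :=
  Matrix.of fun i => ![g i 0 p, g i 1 p, γ⁻¹ * g i 2 p]

/-! ### The homogenized quadratic form -/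

/-- The homogenized quadratic form `Q_hom^γ(G)`: the infimum of
`⨍_□ Q(x₃, y, ι(x₃ G + M) + sym ∇_γ φ)` over symmetric `M` and `φ ∈ H¹_γ(□; ℝ³)`. -/
def Qhom (γ : ℝ) (Q : Pt → Mat3 → ℝ) (G : Mat2) : ℝ :=
  sInf {e : ℝ | ∃ (M : Mat2) (φ : Fin 3 → Pt → ℝ) (g : Fin 3 → Fin 3 → Pt → ℝ),
    M.IsSymm ∧ (∀ i, MemH1 (φ i) (g i)) ∧
    e = ∫ p in Box, Q p (iota (p.1 • G + M) + symPart (scaledGrad γ g p))}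

/-! ### The effective prestrain -/

/-- The scalar product `⨍_□ 𝕃 F : F'`, where `𝕃` is obtained from `Q` by polarization. -/
def innerQ (Q : Pt → Mat3 → ℝ) (F F' : Pt → Mat3) : ℝ :=
  ∫ p in Box, (1 / 2 : ℝ) * (Q p (F p + F' p) - Q p (F p) - Q p (F' p))

/-- The subspace of fields of the form `ι(M) + sym ∇_γ φ`. -/
def Hrel (γ : ℝ) : Set (Pt → Mat3) :=
  {F | ∃ (M : Mat2) (φ : Fin 3 → Pt → ℝ) (g : Fin 3 → Fin 3 → Pt → ℝ),
    M.IsSymm ∧ (∀ i, MemH1 (φ i) (g i)) ∧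
    ∀ᵐ p ∂(volume.restrict Slab), F p = iota M + symPart (scaledGrad γ g p)}

/-- The field `(x₃, y) ↦ ι(x₃ G)`. -/
def bendingField (G : Mat2) : Pt → Mat3 := fun p => iota (p.1 • G)

/-- The subspace of fields of the form `ι(x₃ G) + χ` with `χ ∈ Hrel γ`. -/
def Hgamma (γ : ℝ) : Set (Pt → Mat3) :=
  {F | ∃ (G : Mat2) (χ : Pt → Mat3), G.IsSymm ∧ χ ∈ Hrel γ ∧
    ∀ᵐ p ∂(volume.restrict Slab), F p = bendingField G p + χ p}

/-- The orthogonal complement of `Hrel γ` in `Hgamma γ`. -/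
def HrelPerp (γ : ℝ) (Q : Pt → Mat3 → ℝ) : Set (Pt → Mat3) :=
  {F | F ∈ Hgamma γ ∧ ∀ χ ∈ Hrel γ, innerQ Q F χ = 0}

/-- `P` is (a representative of) the orthogonal projection of `F` onto the subspace `V`, with
respect to the scalar product `innerQ Q`. -/
def IsOrthProj (Q : Pt → Mat3 → ℝ) (V : Set (Pt → Mat3)) (F P : Pt → Mat3) : Prop :=
  P ∈ V ∧ ∀ χ ∈ V, innerQ Q (F - P) χ = 0

/-- `A` is the effective prestrain associated with `Q` and `B`: the symmetric matrix for which
`ι(x₃ A)` and `sym B` have the same orthogonal projection onto `HrelPerp γ Q`, that is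
`A = E⁻¹(P(sym B))` for the linear map `E(G) = P(ι(x₃ G))`, where `P` denotes that projection. -/
def IsEffectivePrestrain (γ : ℝ) (Q : Pt → Mat3 → ℝ) (B : Pt → Mat3) (A : Mat2) : Prop :=
  A.IsSymm ∧ ∃ P : Pt → Mat3,
    IsOrthProj Q (HrelPerp γ Q) (bendingField A) P ∧
    IsOrthProj Q (HrelPerp γ Q) (fun p => symPart (B p)) P

/-! ### Averages of the shear modulus -/

/-- The harmonic mean over one period. -/
def harmonicMean (μ : ℝ → ℝ) : ℝ := (∫ t in Ioo (-1 / 2 : ℝ) (1 / 2), 1 / μ t)⁻¹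

/-- The arithmetic mean over one period. -/
def arithmeticMean (μ : ℝ → ℝ) : ℝ := ∫ t in Ioo (-1 / 2 : ℝ) (1 / 2), μ t

/-- The energies `⨍_□ μ ((√12 x₃ + ∂_{y₁} w)² + (γ⁻¹ ∂₃ w)²)` of all `w ∈ H¹_γ(□; ℝ)` with
mean value zero and `∂_{y₂} w = 0` a.e. -/
def shearEnergies (μ : ℝ → ℝ) (γ : ℝ) : Set ℝ :=
  {e | ∃ (w : Pt → ℝ) (g : Fin 3 → Pt → ℝ), MemH1 w g ∧ ∫ p in Box, w p = 0 ∧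
    (∀ᵐ p ∂(volume.restrict Box), g 1 p = 0) ∧
    e = ∫ p in Box, μ p.2.1 * ((Real.sqrt 12 * p.1 + g 0 p) ^ 2 + (γ⁻¹ * g 2 p) ^ 2)}

/-- The weighted average `μ_γ`. -/
def muGamma (μ : ℝ → ℝ) (γ : ℝ) : ℝ := sInf (shearEnergies μ γ)

end PlateLaminate

end

open PlateLaminate

noncomputable section

namespace PlateLaminate

/-! For `Q = 2μ|sym ·|²` everything reduces to one explicit family of fields. Given symmetric `A`,
take the corrector `φ = (A₁₁ x₃ ψ(y₁), (2A₁₂/√12) w, -A₁₁ γ⁻¹ Ψ(y₁))`, where `ψ' = ⟨μ⟩_h/μ - 1`, `Ψ'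
= ψ`, and `w` solves the shear problem. In the field `relaxed`, which is `ι(x₃A) + sym ∇_γ φ`, the
third component of `φ` cancels the (1,3) strain created by the first. The (1,1) stress is `2⟨μ⟩_h
A₁₁ x₃`, free of `y₁`; the (2,2) stress is `2μ A₂₂ x₃`, free of `y₂`; the shear stresses satisfy the
Euler equation of `w`. Hence the field is orthogonal to the whole relaxation space
(`IsModulus.bil_relaxed_rel`), and its Gram form is diagonal with entries built from `⟨μ⟩_h`, `μ̄`,
`μ_γ` (`IsModulus.bil_relaxed_relaxed`). Pythagoras gives (b). Since these fields span the
orthogonal complement up to null fields, the effective prestrain solves a diagonal linear system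
with positive coefficients (`isEffectivePrestrain_iff`), which yields its existence and uniqueness
as well as (c).

The shear problem is solved without constraints, by projecting in a Hilbert space onto the weighted
gradients. This space is closed by Poincaré's inequality (`exists_poincare`, `isClosed_gradSpace`).
The gradient of the minimizer is unique and the data do not depend on `y₂`, so this gradient is
invariant under translations in `y₂`. Therefore `∂_{y₂}w` is orthogonal to itself and vanishes
(`exists_isShearSol`): the unconstrained minimizer already lies in the constrained class.

For (a), the competitor `0` gives the upper bound, and completing a square pointwise gives the lower
one. Monotonicity and continuity follow by comparing the energies of one competitor for two values
of `γ`. As `γ → ∞`, the competitor `√12 x₃ ψ(y₁)` has energy `⟨μ⟩_h + O(γ⁻²)`. As `γ → 0`, only the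
mixed term `∫ μ x₃ ∂_{y₁}w` can lower the energy below `μ̄`. Because `μ x₃` has zero average in
`x₃`, two integrations by parts move the derivative to `∂₃w`, which is `O(γ)`
(`exists_bound_integral_mul_grad`). If strict monotonicity failed, then `∂₃w = 0` for some `γ`, the
mixed term would vanish and `μ_γ` would equal `μ̄`; for nonconstant `μ` a multiple of the competitor
above has smaller energy.

The weak derivatives are handled with products of test functions of one variable. Their span is
dense in `L²(□)`, and averages and primitives in one coordinate act on a single factor. -/

/-! ### The product measure on the box and resampling of one coordinate. -/

/-- Lebesgue measure on `(-1/2, 1/2)`. -/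
def lam : Measure ℝ := volume.restrict (Ioo (-1 / 2 : ℝ) (1 / 2))

/-- Lebesgue measure on the box, as a product. -/
def nu : Measure Pt := lam.prod (lam.prod lam)

instance isProbabilityMeasure_lam : IsProbabilityMeasure lam := ⟨by simp [lam]; norm_num⟩

instance isProbabilityMeasure_nu : IsProbabilityMeasure nu := by unfold nu; infer_instance

lemma restrict_Box : volume.restrict Box = nu := by
  have h : volume.restrict (Ico (-1 / 2 : ℝ) (1 / 2)) = lam :=
    Measure.restrict_congr_set Ioo_ae_eq_Ico.symm
  rw [nu, Box, Measure.volume_eq_prod, Measure.volume_eq_prod, ← Measure.prod_restrict,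
    ← Measure.prod_restrict, h, lam]

/-- The coordinates of a point, in the order `y₁, y₂, x₃`. -/
def coord (i : Fin 3) (p : Pt) : ℝ := ![p.2.1, p.2.2, p.1] i

/-- Replace the `i`-th coordinate by `s`. -/
def repl (i : Fin 3) (p : Pt) (s : ℝ) : Pt := ![(p.1, s, p.2.2), (p.1, p.2.1, s), (s, p.2)] i

@[simp] lemma coord_zero (p : Pt) : coord 0 p = p.2.1 := rfl
@[simp] lemma coord_one (p : Pt) : coord 1 p = p.2.2 := rfl
@[simp] lemma coord_two (p : Pt) : coord 2 p = p.1 := rfl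
@[simp] lemma repl_zero (p : Pt) (s : ℝ) : repl 0 p s = (p.1, s, p.2.2) := rfl
@[simp] lemma repl_one (p : Pt) (s : ℝ) : repl 1 p s = (p.1, p.2.1, s) := rfl
@[simp] lemma repl_two (p : Pt) (s : ℝ) : repl 2 p s = (s, p.2) := rfl

lemma coord_repl (i j : Fin 3) (p : Pt) (s : ℝ) :
    coord j (repl i p s) = if j = i then s else coord j p := by
  fin_cases i <;> fin_cases j <;> simp [repl, coord]

@[fun_prop]
lemma contDiff_coord (i : Fin 3) {n : WithTop ℕ∞} : ContDiff ℝ n (coord i) := by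
  fin_cases i
  · exact contDiff_fst.comp contDiff_snd
  · exact contDiff_snd.comp contDiff_snd
  · exact contDiff_fst

@[fun_prop]
lemma measurable_coord (i : Fin 3) : Measurable (coord i) :=
  (contDiff_coord i (n := 0)).continuous.measurable

lemma measurable_repl (i : Fin 3) : Measurable fun z : Pt × ℝ => repl i z.1 z.2 := by
  fin_cases i <;> (simp [repl]; fun_prop)

lemma continuous_repl (i : Fin 3) (p : Pt) : Continuous (repl i p) := by
  fin_cases i
  · exact continuous_const.prodMk (continuous_id.prodMk continuous_const)
  · exact continuous_const.prodMk (continuous_const.prodMk continuous_id)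
  · exact continuous_id.prodMk continuous_const

/-- All factors are probability measures, so discarding one coordinate and drawing it again
independently does not change the product measure. This serves as Fubini's theorem in an arbitrary
coordinate. -/
lemma measurePreserving_repl (i : Fin 3) :
    MeasurePreserving (fun z : Pt × ℝ => repl i z.1 z.2) (nu.prod lam) nu := by
  refine ⟨measurable_repl i, ?_⟩
  have : IsFiniteMeasure ((nu.prod lam).map fun z : Pt × ℝ => repl i z.1 z.2) :=
    Measure.isFiniteMeasure_map _ _
  refine Measure.ext_prod₃ fun {s t u} hs ht hu => ?_
  rw [Measure.map_apply (measurable_repl i) (hs.prod (ht.prod hu))]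
  have h1 : nu (s ×ˢ t ×ˢ u) = lam s * (lam t * lam u) := by simp [nu]
  rw [h1]
  fin_cases i
  · have : (fun z : Pt × ℝ => repl 0 z.1 z.2) ⁻¹' (s ×ˢ t ×ˢ u) = (s ×ˢ (univ : Set ℝ) ×ˢ u) ×ˢ t := by
      ext z; simp; tauto
    simp only [Fin.zero_eta, this]
    simp [nu]; ring
  · have : (fun z : Pt × ℝ => repl 1 z.1 z.2) ⁻¹' (s ×ˢ t ×ˢ u) = (s ×ˢ t ×ˢ (univ : Set ℝ)) ×ˢ u := by
      ext z; simp; tauto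
    simp only [Fin.mk_one, this]
    simp [nu]; ring
  · have : (fun z : Pt × ℝ => repl 2 z.1 z.2) ⁻¹' (s ×ˢ t ×ˢ u) = ((univ : Set ℝ) ×ˢ t ×ˢ u) ×ˢ s := by
      ext z; simp; tauto
    simp only [Fin.reduceFinMk, this]
    simp [nu]; ring

lemma measurePreserving_coord (i : Fin 3) : MeasurePreserving (coord i) nu lam := by
  have h1 : MeasurePreserving (fun z : Pt × ℝ => z.2) (nu.prod lam) lam := measurePreserving_snd
  have h2 := measurePreserving_repl i
  refine ⟨measurable_coord i, ?_⟩
  rw [← h2.map_eq, Measure.map_map (measurable_coord i) (measurable_repl i)]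
  conv_rhs => rw [← h1.map_eq]
  congr 1
  ext z
  simp [coord_repl]

/-! ### Products of test functions and the fundamental lemma. -/

/-- The infinitely differentiable functions with compact support in `(-1/2, 1/2)`. -/
structure IsTest (φ : ℝ → ℝ) : Prop where
  contDiff : ContDiff ℝ ∞ φ
  compact : HasCompactSupport φ
  tsupport_subset : tsupport φ ⊆ Ioo (-1 / 2 : ℝ) (1 / 2)

/-- The product of three functions of one coordinate each. -/
def tensor (a : Fin 3 → ℝ → ℝ) (p : Pt) : ℝ := ∏ i, a i (coord i p)

lemma integrable_comp_repl (i : Fin 3) {h : Pt → ℝ} (hh : Integrable h nu) :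
    Integrable (fun z : Pt × ℝ => h (repl i z.1 z.2)) (nu.prod lam) :=
  (measurePreserving_repl i).integrable_comp_of_integrable hh

lemma integral_comp_repl (i : Fin 3) {h : Pt → ℝ} (hh : Integrable h nu) :
    ∫ p, ∫ s, h (repl i p s) ∂lam ∂nu = ∫ p, h p ∂nu := by
  rw [← integral_prod (fun z : Pt × ℝ => h (repl i z.1 z.2)) (integrable_comp_repl i hh)]
  have := (measurePreserving_repl i).map_eq
  conv_rhs => rw [← this]
  rw [integral_map (measurable_repl i).aemeasurable]
  rw [this]; exact hh.1

lemma integral_comp_repl' (i : Fin 3) {h : Pt → ℝ} (hh : Integrable h nu) :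
    ∫ s, ∫ p, h (repl i p s) ∂nu ∂lam = ∫ p, h p ∂nu := by
  rw [← integral_comp_repl i hh, integral_integral_swap]
  exact (integrable_comp_repl i hh).swap

/-- Integrating out the other coordinates leaves a function `Φ` of one variable, and the
one-dimensional fundamental lemma gives `Φ = 0`. This upgrades one factor at a time from test
functions to bounded measurable functions. -/
lemma integral_mul_coord_eq_zero (i : Fin 3) {h : Pt → ℝ} (hh : Integrable h nu)
    (h0 : ∀ φ : ℝ → ℝ, IsTest φ → ∫ p, h p * φ (coord i p) ∂nu = 0) {φ : ℝ → ℝ}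
    (hφ : Measurable φ) {C : ℝ} (hC : ∀ s, |φ s| ≤ C) : ∫ p, h p * φ (coord i p) ∂nu = 0 := by
  set Φ : ℝ → ℝ := fun s => ∫ p, h (repl i p s) ∂nu with hΦ
  have hΦi : Integrable Φ lam := (integrable_comp_repl i hh).integral_prod_right
  have key : ∀ {φ : ℝ → ℝ} {C : ℝ}, Measurable φ → (∀ s, |φ s| ≤ C) →
      ∫ p, h p * φ (coord i p) ∂nu = ∫ s, φ s * Φ s ∂lam := by
    intro φ C hφ hC
    have hI : Integrable (fun p => h p * φ (coord i p)) nu :=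
      hh.mul_bdd (c := C) (hφ.comp (measurable_coord i)).aestronglyMeasurable
        (Eventually.of_forall fun p => hC _)
    rw [← integral_comp_repl' i hI]
    refine integral_congr_ae (Eventually.of_forall fun s => ?_)
    simp only [coord_repl, if_true, hΦ, integral_mul_const]
    ring
  rw [key hφ hC]
  have hz : ∀ᵐ s, s ∈ Ioo (-1 / 2 : ℝ) (1 / 2) → Φ s = 0 := by
    refine isOpen_Ioo.ae_eq_zero_of_integral_contDiff_smul_eq_zero
      (IntegrableOn.locallyIntegrableOn hΦi) fun g hg hc hs => ?_
    obtain ⟨C, hC⟩ := hc.exists_bound_of_continuous hg.continuous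
    have := key hg.continuous.measurable hC
    rw [h0 g ⟨hg, hc, hs⟩, lam] at this
    rw [← setIntegral_eq_integral_of_forall_compl_eq_zero (s := Ioo (-1 / 2 : ℝ) (1 / 2))]
    · exact this.symm
    · intro x hx
      rw [image_eq_zero_of_notMem_tsupport fun h => hx (hs h), zero_smul]
  rw [← ae_restrict_iff' measurableSet_Ioo] at hz
  refine (integral_congr_ae (hz.mono fun s hs => ?_)).trans (integral_zero _ _)
  simp [hs]

/-- The three test factors are replaced one after another by indicators. Then `h` integrates to zero
over all measurable boxes, so the finite measures with densities `h⁺` and `h⁻` agree on boxes and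
hence coincide. -/
lemma ae_eq_zero_of_integral_tensor {h : Pt → ℝ} (hh : Integrable h nu)
    (h0 : ∀ a : Fin 3 → ℝ → ℝ, (∀ i, IsTest (a i)) → ∫ p, h p * tensor a p ∂nu = 0) :
    h =ᵐ[nu] 0 := by
  have hb : ∀ {φ : ℝ → ℝ}, IsTest φ → ∃ C, ∀ s, |φ s| ≤ C := fun hφ =>
    hφ.compact.exists_bound_of_continuous hφ.contDiff.continuous
  have hi : ∀ {S : Set ℝ} (s : ℝ), |S.indicator (1 : ℝ → ℝ) s| ≤ 1 := by
    intro S s; by_cases hs : s ∈ S <;> simp [hs]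
  have hm : ∀ {S : Set ℝ}, MeasurableSet S → Measurable (S.indicator (1 : ℝ → ℝ)) := fun hS =>
    measurable_one.indicator hS
  have mulI : ∀ {k : Pt → ℝ} (i : Fin 3) {φ : ℝ → ℝ} {C : ℝ}, Integrable k nu → Measurable φ →
      (∀ s, |φ s| ≤ C) → Integrable (fun p => k p * φ (coord i p)) nu := fun i _ C hk hφ hC =>
    hk.mul_bdd (c := C) (hφ.comp (measurable_coord i)).aestronglyMeasurable
      (Eventually.of_forall fun p => hC _)
  have s1 : ∀ {S : Set ℝ}, MeasurableSet S → ∀ {b c : ℝ → ℝ}, IsTest b → IsTest c →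
      ∫ p, h p * b (coord 1 p) * c (coord 2 p) * S.indicator 1 (coord 0 p) ∂nu = 0 := by
    intro S hS b c hb' hc'
    obtain ⟨Cb, hCb⟩ := hb hb'
    obtain ⟨Cc, hCc⟩ := hb hc'
    refine integral_mul_coord_eq_zero 0 (mulI 2 (mulI 1 hh hb'.contDiff.continuous.measurable hCb)
      hc'.contDiff.continuous.measurable hCc) (fun φ hφ => ?_) (hm hS) hi
    rw [← h0 ![φ, b, c] (fun i => by fin_cases i <;> simpa)]
    refine integral_congr_ae (Eventually.of_forall fun p => ?_)
    simp [tensor, Fin.prod_univ_three]; ring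
  have s2 : ∀ {S T : Set ℝ}, MeasurableSet S → MeasurableSet T → ∀ {c : ℝ → ℝ}, IsTest c →
      ∫ p, h p * c (coord 2 p) * S.indicator 1 (coord 0 p) * T.indicator 1 (coord 1 p) ∂nu = 0 := by
    intro S T hS hT c hc'
    obtain ⟨Cc, hCc⟩ := hb hc'
    refine integral_mul_coord_eq_zero 1 (mulI 0 (mulI 2 hh hc'.contDiff.continuous.measurable hCc)
      (hm hS) hi) (fun φ hφ => ?_) (hm hT) hi
    rw [← s1 hS hφ hc']
    refine integral_congr_ae (Eventually.of_forall fun p => ?_)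
    ring
  have s3 : ∀ {S T U : Set ℝ}, MeasurableSet S → MeasurableSet T → MeasurableSet U →
      ∫ p, h p * S.indicator 1 (coord 0 p) * T.indicator 1 (coord 1 p)
        * U.indicator 1 (coord 2 p) ∂nu = 0 := by
    intro S T U hS hT hU
    refine integral_mul_coord_eq_zero 2 (mulI 1 (mulI 0 hh (hm hS) hi) (hm hT) hi)
      (fun φ hφ => ?_) (hm hU) hi
    rw [← s2 hS hT hφ]
    refine integral_congr_ae (Eventually.of_forall fun p => ?_)
    ring
  have hfin : ∀ {k : Pt → ℝ}, Integrable k nu →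
      IsFiniteMeasure (nu.withDensity fun p => ENNReal.ofReal (k p)) := fun hk =>
    isFiniteMeasure_withDensity_ofReal hk.2
  have := hfin hh
  have hset : ∀ S : Set Pt, ∫ p in S, h p ∂nu =
      (∫⁻ p in S, ENNReal.ofReal (h p) ∂nu).toReal - (∫⁻ p in S, ENNReal.ofReal (-h p) ∂nu).toReal :=
    fun S => integral_eq_lintegral_pos_part_sub_lintegral_neg_part hh.integrableOn
  have hlt : ∀ {k : Pt → ℝ}, Integrable k nu → ∀ S : Set Pt,
      ∫⁻ p in S, ENNReal.ofReal (k p) ∂nu ≠ ⊤ := fun hk S => hk.integrableOn.lintegral_lt_top.ne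
  have heq : (nu.withDensity fun p => ENNReal.ofReal (h p))
      = nu.withDensity fun p => ENNReal.ofReal (-h p) := by
    refine Measure.ext_prod₃ fun {s t u} hs ht hu => ?_
    have hS := hs.prod (ht.prod hu)
    rw [withDensity_apply _ hS, withDensity_apply _ hS]
    have h3 := s3 ht hu hs
    have : ∫ p in s ×ˢ t ×ˢ u, h p ∂nu = 0 := by
      rw [← h3, ← integral_indicator hS]
      refine integral_congr_ae (Eventually.of_forall fun p => ?_)
      by_cases h1 : p.1 ∈ s <;> by_cases h2 : p.2.1 ∈ t <;> by_cases h3 : p.2.2 ∈ u <;>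
        simp [indicator, h1, h2, h3]
    rw [hset, sub_eq_zero] at this
    exact (ENNReal.toReal_eq_toReal_iff' (hlt hh _) (hlt hh.neg _)).1 this
  refine hh.ae_eq_zero_of_forall_setIntegral_eq_zero fun S hS _ => ?_
  have := congrArg (fun m : Measure Pt => m S) heq
  simp only [withDensity_apply _ hS] at this
  rw [hset, this, sub_self]

/-! ### The norm of `L²(□)` -/

/-- The norm of `L²(□)`. -/
def nrm (f : Pt → ℝ) : ℝ := Real.sqrt (∫ p, f p ^ 2 ∂nu)

lemma nrm_nonneg (f : Pt → ℝ) : 0 ≤ nrm f := Real.sqrt_nonneg _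

lemma nrm_sq (f : Pt → ℝ) : nrm f ^ 2 = ∫ p, f p ^ 2 ∂nu :=
  Real.sq_sqrt (integral_nonneg fun _ => sq_nonneg _)

lemma nrm_congr {f g : Pt → ℝ} (h : f =ᵐ[nu] g) : nrm f = nrm g := by
  unfold nrm
  rw [integral_congr_ae (h.mono fun p hp => congrArg (· ^ 2) hp)]

lemma integral_mul_eq_inner {f g : Pt → ℝ} (hf : MemLp f 2 nu) (hg : MemLp g 2 nu) :
    ∫ p, f p * g p ∂nu = inner ℝ (hf.toLp f) (hg.toLp g) := by
  rw [L2.inner_def]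
  refine integral_congr_ae ?_
  filter_upwards [hf.coeFn_toLp, hg.coeFn_toLp] with p h1 h2
  rw [h1, h2]; simp [mul_comm]

lemma nrm_eq_norm {f : Pt → ℝ} (hf : MemLp f 2 nu) : nrm f = ‖hf.toLp f‖ := by
  have h := integral_mul_eq_inner hf hf
  rw [real_inner_self_eq_norm_sq] at h
  rw [nrm, ← Real.sqrt_sq (norm_nonneg (hf.toLp f)), ← h]
  simp only [pow_two]

lemma MemLp.integrable_mul_nu {f g : Pt → ℝ} (hf : MemLp f 2 nu) (hg : MemLp g 2 nu) :
    Integrable (fun p => f p * g p) nu := MemLp.integrable_mul hf hg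

lemma MemLp.integrable_nu {f : Pt → ℝ} (hf : MemLp f 2 nu) : Integrable f nu :=
  hf.integrable (by norm_num)

lemma abs_integral_mul_le {f g : Pt → ℝ} (hf : MemLp f 2 nu) (hg : MemLp g 2 nu) :
    |∫ p, f p * g p ∂nu| ≤ nrm f * nrm g := by
  rw [integral_mul_eq_inner hf hg, nrm_eq_norm hf, nrm_eq_norm hg]
  exact abs_real_inner_le_norm _ _

lemma nrm_sub_le {f g : Pt → ℝ} (hf : MemLp f 2 nu) (hg : MemLp g 2 nu) :
    nrm (fun p => f p - g p) ≤ nrm f + nrm g := by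
  have h := nrm_eq_norm (hf.sub hg)
  rw [MemLp.toLp_sub hf hg] at h
  rw [nrm_eq_norm hf, nrm_eq_norm hg]
  exact h.le.trans (norm_sub_le _ _)

lemma nrm_const_mul (c : ℝ) (f : Pt → ℝ) : nrm (fun p => c * f p) = |c| * nrm f := by
  simp only [nrm, mul_pow, integral_const_mul]
  rw [Real.sqrt_mul (sq_nonneg c), Real.sqrt_sq_eq_abs]

/-! ### Test functions of one variable -/

lemma IsTest.bdd {φ : ℝ → ℝ} (h : IsTest φ) : ∃ C, ∀ s, |φ s| ≤ C :=
  h.compact.exists_bound_of_continuous h.contDiff.continuous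

lemma IsTest.deriv {φ : ℝ → ℝ} (h : IsTest φ) : IsTest (deriv φ) :=
  ⟨h.contDiff.iterate_deriv 1, h.compact.deriv, tsupport_deriv_subset.trans h.tsupport_subset⟩

lemma IsTest.const_mul {φ : ℝ → ℝ} (h : IsTest φ) (c : ℝ) : IsTest fun s => c * φ s :=
  ⟨contDiff_const.mul h.contDiff, h.compact.mul_left,
    (tsupport_mul_subset_right (f := fun _ => c) (g := φ)).trans h.tsupport_subset⟩

lemma IsTest.sub {φ ψ : ℝ → ℝ} (h : IsTest φ) (h' : IsTest ψ) : IsTest fun s => φ s - ψ s :=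
  ⟨h.contDiff.sub h'.contDiff, h.compact.sub h'.compact,
    (tsupport_sub φ ψ).trans (union_subset h.tsupport_subset h'.tsupport_subset)⟩

lemma IsTest.exists_Icc {φ : ℝ → ℝ} (h : IsTest φ) :
    ∃ a b : ℝ, -1 / 2 < a ∧ a ≤ b ∧ b < 1 / 2 ∧ ∀ s, s ∉ Icc a b → φ s = 0 := by
  rcases (tsupport φ).eq_empty_or_nonempty with he | hne
  · refine ⟨0, 0, by norm_num, le_rfl, by norm_num, fun s _ => ?_⟩
    exact image_eq_zero_of_notMem_tsupport (by simp [he])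
  · have hc : IsCompact (tsupport φ) := h.compact
    obtain ⟨a, ha⟩ := hc.exists_isLeast hne
    obtain ⟨b, hb⟩ := hc.exists_isGreatest hne
    refine ⟨a, b, (h.tsupport_subset ha.1).1, ha.2 hb.1, (h.tsupport_subset hb.1).2, fun s hs => ?_⟩
    exact image_eq_zero_of_notMem_tsupport fun hs' => hs ⟨ha.2 hs', hb.2 hs'⟩

lemma integral_lam_eq {φ : ℝ → ℝ} : ∫ s, φ s ∂lam = ∫ s in (-1 / 2 : ℝ)..(1 / 2), φ s := by
  rw [intervalIntegral.integral_of_le (by norm_num), lam, integral_Ioc_eq_integral_Ioo]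

/-- The primitive vanishing at `-1/2`. -/
def prim (φ : ℝ → ℝ) (x : ℝ) : ℝ := ∫ s in (-1 / 2 : ℝ)..x, φ s

lemma hasDerivAt_prim {φ : ℝ → ℝ} (h : Continuous φ) (x : ℝ) : HasDerivAt (prim φ) (φ x) x :=
  intervalIntegral.integral_hasDerivAt_right (h.intervalIntegrable _ _)
    (h.stronglyMeasurableAtFilter _ _) h.continuousAt

lemma deriv_prim {φ : ℝ → ℝ} (h : Continuous φ) : deriv (prim φ) = φ :=
  funext fun x => (hasDerivAt_prim h x).deriv

lemma IsTest.prim_eq {φ : ℝ → ℝ} (h : IsTest φ) {a b x : ℝ} (ha : -1 / 2 < a) (hb : b < 1 / 2)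
    (h0 : ∀ s, s ∉ Icc a b → φ s = 0) :
    (x < a → prim φ x = 0) ∧ (b < x → prim φ x = ∫ s, φ s ∂lam) := by
  constructor
  · intro hx
    refine intervalIntegral.integral_zero_ae (Eventually.of_forall fun s hs => h0 s fun hs' => ?_)
    rcases mem_uIoc.1 hs with h1 | h1
    · linarith [hs'.1]
    · linarith [hs'.1]
  · intro hx
    have hi : ∀ a b, IntervalIntegrable φ volume a b := fun a b =>
      h.contDiff.continuous.intervalIntegrable a b
    rw [integral_lam_eq, prim, ← sub_eq_zero, intervalIntegral.integral_interval_sub_left (hi _ _) (hi _ _)]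
    refine intervalIntegral.integral_zero_ae (Eventually.of_forall fun s hs => h0 s fun hs' => ?_)
    rcases mem_uIoc.1 hs with h1 | h1
    · linarith [hs'.2]
    · linarith [hs'.2]

/-- The vanishing integral is what makes the primitive zero again to the right of the support. -/
lemma IsTest.prim {φ : ℝ → ℝ} (h : IsTest φ) (h0 : ∫ s, φ s ∂lam = 0) : IsTest (prim φ) := by
  obtain ⟨a, b, ha, hab, hb, hz⟩ := h.exists_Icc
  have hsupp : ∀ x, x ∉ Icc a b → PlateLaminate.prim φ x = 0 := by
    intro x hx
    by_cases h1 : x < a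
    · exact (h.prim_eq ha hb hz).1 h1
    · rw [(h.prim_eq ha hb hz).2 (by by_contra h2; exact hx ⟨not_lt.1 h1, not_lt.1 h2⟩), h0]
  have hts : tsupport (PlateLaminate.prim φ) ⊆ Icc a b :=
    closure_minimal (fun x hx => by by_contra h1; exact hx (hsupp x h1)) isClosed_Icc
  refine ⟨?_, ?_, hts.trans fun x hx => ⟨ha.trans_le hx.1, hx.2.trans_lt hb⟩⟩
  · rw [contDiff_infty_iff_deriv, deriv_prim h.contDiff.continuous]
    exact ⟨fun x => (hasDerivAt_prim h.contDiff.continuous x).differentiableAt, h.contDiff⟩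
  · exact HasCompactSupport.intro isCompact_Icc fun x hx => hsupp x hx

lemma IsTest.integrable {φ : ℝ → ℝ} (h : IsTest φ) : Integrable φ lam :=
  (h.contDiff.continuous.integrable_of_hasCompactSupport h.compact).restrict

lemma IsTest.prim_bdd {φ : ℝ → ℝ} (h : IsTest φ) : ∃ C, ∀ x, |PlateLaminate.prim φ x| ≤ C := by
  have hi := h.contDiff.continuous.integrable_of_hasCompactSupport h.compact (μ := volume)
  refine ⟨∫ s, |φ s|, fun x => ?_⟩
  exact intervalIntegral.norm_integral_le_integral_norm_uIoc.trans
    (setIntegral_le_integral hi.norm (Eventually.of_forall fun s => norm_nonneg _))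

lemma exists_bump : ∃ b : ℝ → ℝ, IsTest b ∧ ∫ s, b s ∂lam = 1 := by
  let f : ContDiffBump (0 : ℝ) := ⟨1 / 8, 1 / 4, by norm_num, by norm_num⟩
  have hs : tsupport (f.normed volume) ⊆ Ioo (-1 / 2 : ℝ) (1 / 2) := by
    rw [f.tsupport_normed_eq]
    intro x hx
    rw [Metric.mem_closedBall, Real.dist_eq, sub_zero, abs_le] at hx
    have h4 : f.rOut = 1 / 4 := rfl
    rw [h4] at hx
    constructor <;> linarith [hx.1, hx.2]
  refine ⟨f.normed volume, ⟨f.contDiff_normed, f.hasCompactSupport_normed, hs⟩, ?_⟩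
  rw [lam, setIntegral_eq_integral_of_forall_compl_eq_zero, f.integral_normed]
  exact fun x hx => image_eq_zero_of_notMem_tsupport fun h => hx (hs h)

/-- A fixed test function with integral one. -/
def bump : ℝ → ℝ := exists_bump.choose

lemma isTest_bump : IsTest bump := exists_bump.choose_spec.1

lemma integral_bump : ∫ s, bump s ∂lam = 1 := exists_bump.choose_spec.2

/-! ### Linear combinations of products of test functions -/

/-- The span of the products of test functions of one variable. -/
def TestSpan : Submodule ℝ (Pt → ℝ) :=
  Submodule.span ℝ {f | ∃ a : Fin 3 → ℝ → ℝ, (∀ i, IsTest (a i)) ∧ f = tensor a}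

lemma tensor_mem {a : Fin 3 → ℝ → ℝ} (ha : ∀ i, IsTest (a i)) : tensor a ∈ TestSpan :=
  Submodule.subset_span ⟨a, ha, rfl⟩

lemma contDiff_tensor {a : Fin 3 → ℝ → ℝ} (ha : ∀ i, ContDiff ℝ ∞ (a i)) :
    ContDiff ℝ ∞ (tensor a) := by
  unfold tensor
  exact contDiff_prod fun i _ => (ha i).comp (contDiff_coord i)

lemma testSpan_bdd {f : Pt → ℝ} (hf : f ∈ TestSpan) : Continuous f ∧ ∃ C, ∀ p, |f p| ≤ C := by
  induction hf using Submodule.span_induction with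
  | mem f hf =>
    obtain ⟨a, ha, rfl⟩ := hf
    refine ⟨(contDiff_tensor fun i => (ha i).contDiff).continuous, ?_⟩
    choose C hC using fun i => (ha i).bdd
    refine ⟨∏ i, C i, fun p => ?_⟩
    rw [tensor, Finset.abs_prod]
    exact Finset.prod_le_prod (fun i _ => abs_nonneg _) fun i _ => hC i _
  | zero => exact ⟨continuous_const, 0, fun p => by simp⟩
  | add f g _ _ hf hg =>
    obtain ⟨h1, C, hC⟩ := hf
    obtain ⟨h2, D, hD⟩ := hg
    exact ⟨h1.add h2, C + D, fun p => (abs_add_le _ _).trans (add_le_add (hC p) (hD p))⟩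
  | smul c f _ hf =>
    obtain ⟨h1, C, hC⟩ := hf
    refine ⟨h1.const_smul c, |c| * C, fun p => ?_⟩
    rw [Pi.smul_apply, smul_eq_mul, abs_mul]
    exact mul_le_mul_of_nonneg_left (hC p) (abs_nonneg c)

lemma memLp_of_bdd {f : Pt → ℝ} (hf : AEStronglyMeasurable f nu) {C : ℝ} (hC : ∀ p, |f p| ≤ C) :
    MemLp f 2 nu := MemLp.of_bound hf C (Eventually.of_forall hC)

lemma testSpan_memLp {f : Pt → ℝ} (hf : f ∈ TestSpan) : MemLp f 2 nu := by
  obtain ⟨h1, C, hC⟩ := testSpan_bdd hf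
  exact memLp_of_bdd h1.aestronglyMeasurable hC

/-- A subspace of a Hilbert space is dense when its orthogonal complement is trivial, and this is
the fundamental lemma for products. -/
lemma exists_testSpan_nrm_sub_lt {h : Pt → ℝ} (hh : MemLp h 2 nu) {ε : ℝ} (hε : 0 < ε) :
    ∃ f ∈ TestSpan, nrm (fun p => h p - f p) < ε := by
  let S : Submodule ℝ (Lp ℝ 2 nu) :=
    { carrier := {F | ∃ f ∈ TestSpan, F =ᵐ[nu] f}
      add_mem' := by
        rintro F G ⟨f, hf, hF⟩ ⟨g, hg, hG⟩
        exact ⟨f + g, add_mem hf hg, (Lp.coeFn_add F G).trans (hF.add hG)⟩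
      zero_mem' := ⟨0, zero_mem _, Lp.coeFn_zero _ _ _⟩
      smul_mem' := by
        rintro c F ⟨f, hf, hF⟩
        exact ⟨c • f, Submodule.smul_mem _ c hf, (Lp.coeFn_smul c F).trans (hF.const_smul c)⟩ }
  have hS : Sᗮ = ⊥ := by
    rw [Submodule.eq_bot_iff]
    intro F hF
    have hFL := Lp.memLp F
    refine (Lp.eq_zero_iff_ae_eq_zero).2
      (ae_eq_zero_of_integral_tensor (MemLp.integrable_nu hFL) fun a ha => ?_)
    have hT := testSpan_memLp (tensor_mem ha)
    have := (Submodule.mem_orthogonal S F).1 hF (hT.toLp _) ⟨_, tensor_mem ha, hT.coeFn_toLp⟩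
    rw [integral_mul_eq_inner hFL hT, Lp.toLp_coeFn, real_inner_comm]
    exact this
  have hcl : hh.toLp h ∈ closure (S : Set (Lp ℝ 2 nu)) := by
    rw [← Submodule.topologicalClosure_coe, (Submodule.topologicalClosure_eq_top_iff).2 hS]
    trivial
  obtain ⟨F, ⟨f, hf, hF⟩, hlt⟩ := Metric.mem_closure_iff.1 hcl ε hε
  refine ⟨f, hf, ?_⟩
  have hfL := testSpan_memLp hf
  have hFe : F = hfL.toLp f := Lp.ext (hF.trans hfL.coeFn_toLp.symm)
  have := nrm_eq_norm (hh.sub hfL)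
  rw [MemLp.toLp_sub hh hfL] at this
  rw [dist_eq_norm, hFe] at hlt
  exact this.le.trans_lt hlt

/-! ### Integral operators in one coordinate -/

/-- The integral operator with kernel `k` in the `i`-th coordinate. -/
def kop (k : ℝ → ℝ → ℝ) (i : Fin 3) (f : Pt → ℝ) (p : Pt) : ℝ :=
  ∫ s, k (coord i p) s * f (repl i p s) ∂lam

lemma memLp_comp_repl (i : Fin 3) {f : Pt → ℝ} (hf : MemLp f 2 nu) :
    MemLp (fun z : Pt × ℝ => f (repl i z.1 z.2)) 2 (nu.prod lam) :=
  hf.comp_measurePreserving (measurePreserving_repl i)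

/-- Jensen's inequality on each line in direction `i`, followed by resampling of that coordinate. -/
lemma kop_bound {k : ℝ → ℝ → ℝ} (hk : Measurable (Function.uncurry k)) {C : ℝ}
    (hC : ∀ x s, |k x s| ≤ C) (i : Fin 3) {f : Pt → ℝ} (hf : MemLp f 2 nu) :
    MemLp (kop k i f) 2 nu ∧ nrm (kop k i f) ≤ C * nrm f := by
  have hC0 : 0 ≤ C := (abs_nonneg _).trans (hC 0 0)
  have hz := memLp_comp_repl i hf
  have hkz : Measurable fun z : Pt × ℝ => k (coord i z.1) z.2 :=
    hk.comp (((measurable_coord i).comp measurable_fst).prodMk measurable_snd)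
  have hm : AEStronglyMeasurable (fun z : Pt × ℝ => k (coord i z.1) z.2 * f (repl i z.1 z.2))
      (nu.prod lam) := hkz.aestronglyMeasurable.mul hz.1
  have hsq : Integrable (fun z : Pt × ℝ => f (repl i z.1 z.2) ^ 2) (nu.prod lam) := hz.integrable_sq
  have hsqp : Integrable (fun p => ∫ s, f (repl i p s) ^ 2 ∂lam) nu := hsq.integral_prod_left
  have hpt : ∀ᵐ p ∂nu, kop k i f p ^ 2 ≤ C ^ 2 * ∫ s, f (repl i p s) ^ 2 ∂lam := by
    filter_upwards [hsq.prod_right_ae, hm.prodMk_left, hz.1.prodMk_left] with p h1 h2 h3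
    have hL : MemLp (fun s => f (repl i p s)) 2 lam := (memLp_two_iff_integrable_sq h3).2 h1
    have hL' : MemLp (fun s => k (coord i p) s * f (repl i p s)) 2 lam := by
      refine MemLp.of_le_mul hL h2 (c := C) (Eventually.of_forall fun s => ?_)
      rw [norm_mul]
      exact mul_le_mul_of_nonneg_right (hC _ _) (norm_nonneg _)
    -- Nonnegativity of the variance is `(∫ F)² ≤ ∫ F²` for a probability measure.
    have hv := ProbabilityTheory.variance_nonneg (fun s => k (coord i p) s * f (repl i p s)) lam
    rw [ProbabilityTheory.variance_eq_sub hL'] at hv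
    have : kop k i f p ^ 2 ≤ ∫ s, (k (coord i p) s * f (repl i p s)) ^ 2 ∂lam := by
      simpa [kop] using hv
    refine this.trans ?_
    rw [← integral_const_mul]
    refine integral_mono hL'.integrable_sq (h1.const_mul _) fun s => ?_
    simp only [mul_pow]
    refine mul_le_mul_of_nonneg_right ?_ (sq_nonneg _)
    rw [← sq_abs (k _ _)]
    exact pow_le_pow_left₀ (abs_nonneg _) (hC _ _) 2
  have hmk : AEStronglyMeasurable (kop k i f) nu := hm.integral_prod_right'
  have hi : Integrable (fun p => kop k i f p ^ 2) nu := by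
    refine (hsqp.const_mul (C ^ 2)).mono' (hmk.pow 2) (hpt.mono fun p hp => ?_)
    rwa [Real.norm_of_nonneg (sq_nonneg _)]
  refine ⟨(memLp_two_iff_integrable_sq hmk).2 hi, ?_⟩
  refine abs_le_of_sq_le_sq' ?_ (mul_nonneg hC0 (nrm_nonneg f)) |>.2
  rw [mul_pow, nrm_sq, nrm_sq, ← integral_comp_repl i hf.integrable_sq, ← integral_const_mul]
  exact integral_mono_ae hi (hsqp.const_mul _) hpt

lemma kop_add {k : ℝ → ℝ → ℝ} (hk : Measurable (Function.uncurry k)) {C : ℝ}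
    (hC : ∀ x s, |k x s| ≤ C) (i : Fin 3) {f g : Pt → ℝ} (hf : f ∈ TestSpan) (hg : g ∈ TestSpan) :
    kop k i (f + g) = kop k i f + kop k i g := by
  have hi : ∀ {f : Pt → ℝ}, f ∈ TestSpan → ∀ p,
      Integrable (fun s => k (coord i p) s * f (repl i p s)) lam := by
    intro f hf p
    obtain ⟨h1, D, hD⟩ := testSpan_bdd hf
    have h2 : Measurable fun s => k (coord i p) s := hk.comp (measurable_const.prodMk measurable_id)
    refine Integrable.of_bound (h2.aestronglyMeasurable.mul
      (h1.comp (continuous_repl i p)).aestronglyMeasurable) (C * D) (Eventually.of_forall fun s => ?_)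
    rw [norm_mul]
    exact mul_le_mul (hC _ _) (hD _) (norm_nonneg _) ((abs_nonneg _).trans (hC 0 0))
  ext p
  simp only [kop, Pi.add_apply, mul_add]
  exact integral_add (hi hf p) (hi hg p)

lemma kop_smul (k : ℝ → ℝ → ℝ) (i : Fin 3) (c : ℝ) (f : Pt → ℝ) :
    kop k i (c • f) = c • kop k i f := by
  ext p
  simp only [kop, Pi.smul_apply, smul_eq_mul, ← integral_const_mul]
  congr 1; ext s; ring

lemma tensor_update (a : Fin 3 → ℝ → ℝ) (i : Fin 3) (φ : ℝ → ℝ) (p : Pt) :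
    tensor (Function.update a i φ) p
      = φ (coord i p) * ∏ j ∈ Finset.univ.erase i, a j (coord j p) := by
  rw [tensor, ← Finset.mul_prod_erase _ _ (Finset.mem_univ i), Function.update_self]
  congr 1
  refine Finset.prod_congr rfl fun j hj => ?_
  rw [Function.update_of_ne (Finset.ne_of_mem_erase hj)]

lemma tensor_repl (a : Fin 3 → ℝ → ℝ) (i : Fin 3) (p : Pt) (s : ℝ) :
    tensor a (repl i p s) = a i s * ∏ j ∈ Finset.univ.erase i, a j (coord j p) := by
  rw [tensor, ← Finset.mul_prod_erase _ _ (Finset.mem_univ i), coord_repl, if_pos rfl]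
  congr 1
  refine Finset.prod_congr rfl fun j hj => ?_
  rw [coord_repl, if_neg (Finset.ne_of_mem_erase hj)]

lemma kop_tensor (k : ℝ → ℝ → ℝ) (i : Fin 3) (a : Fin 3 → ℝ → ℝ) :
    kop k i (tensor a) = tensor (Function.update a i fun x => ∫ s, k x s * a i s ∂lam) := by
  ext p
  rw [tensor_update, kop, ← integral_mul_const]
  congr 1; ext s
  rw [tensor_repl]; ring

lemma isTest_update {a : Fin 3 → ℝ → ℝ} (ha : ∀ i, IsTest (a i)) (i : Fin 3) {φ : ℝ → ℝ}
    (hφ : IsTest φ) (j : Fin 3) : IsTest (Function.update a i φ j) := by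
  by_cases h : j = i
  · subst h; simpa using hφ
  · simpa [h] using ha j

/-- The weighted average in the `i`-th coordinate. -/
def wavg : Fin 3 → (Pt → ℝ) → Pt → ℝ := kop fun x _ => bump x

/-- The primitive in the `i`-th coordinate of `f - wavg i f`. -/
def wprim : Fin 3 → (Pt → ℝ) → Pt → ℝ := kop fun x s => (Iio x).indicator 1 s - prim bump x

lemma wavg_kernel : Measurable (Function.uncurry fun x (_ : ℝ) => bump x) ∧
    ∃ C, ∀ x : ℝ, ℝ → |bump x| ≤ C := by
  obtain ⟨C, hC⟩ := isTest_bump.bdd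
  exact ⟨isTest_bump.contDiff.continuous.measurable.comp measurable_fst, C, fun x _ => hC x⟩

lemma wprim_kernel :
    Measurable (Function.uncurry fun x s => (Iio x).indicator (1 : ℝ → ℝ) s - prim bump x) ∧
    ∃ C, ∀ x s : ℝ, |(Iio x).indicator (1 : ℝ → ℝ) s - prim bump x| ≤ C := by
  obtain ⟨C, hC⟩ := isTest_bump.prim_bdd
  constructor
  · refine Measurable.sub ?_ ?_
    · have : (fun z : ℝ × ℝ => (Iio z.1).indicator (1 : ℝ → ℝ) z.2)
          = {z : ℝ × ℝ | z.2 < z.1}.indicator 1 := by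
        ext z; simp [indicator]
      exact this ▸ measurable_one.indicator (measurableSet_lt measurable_snd measurable_fst)
    · have : Continuous (prim bump) := continuous_iff_continuousAt.2 fun x =>
        (hasDerivAt_prim isTest_bump.contDiff.continuous x).continuousAt
      exact this.measurable.comp measurable_fst
  · refine ⟨1 + C, fun x s => (abs_sub _ _).trans (add_le_add ?_ (hC x))⟩
    by_cases h : s ∈ Iio x <;> simp [h]

lemma exists_wavg_bound : ∃ C, 0 ≤ C ∧ ∀ i {f : Pt → ℝ}, MemLp f 2 nu →
    MemLp (wavg i f) 2 nu ∧ nrm (wavg i f) ≤ C * nrm f := by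
  obtain ⟨h, C, hC⟩ := wavg_kernel
  exact ⟨C, (abs_nonneg _).trans (hC 0 0), fun i f hf => kop_bound h hC i hf⟩

lemma exists_wprim_bound : ∃ C, 0 ≤ C ∧ ∀ i {f : Pt → ℝ}, MemLp f 2 nu →
    MemLp (wprim i f) 2 nu ∧ nrm (wprim i f) ≤ C * nrm f := by
  obtain ⟨h, C, hC⟩ := wprim_kernel
  exact ⟨C, (abs_nonneg _).trans (hC 0 0), fun i f hf => kop_bound h hC i hf⟩

lemma wavg_add (i : Fin 3) {f g : Pt → ℝ} (hf : f ∈ TestSpan) (hg : g ∈ TestSpan) :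
    wavg i (f + g) = wavg i f + wavg i g := by
  obtain ⟨h, C, hC⟩ := wavg_kernel
  exact kop_add h hC i hf hg

lemma wprim_add (i : Fin 3) {f g : Pt → ℝ} (hf : f ∈ TestSpan) (hg : g ∈ TestSpan) :
    wprim i (f + g) = wprim i f + wprim i g := by
  obtain ⟨h, C, hC⟩ := wprim_kernel
  exact kop_add h hC i hf hg

lemma wavg_tensor (i : Fin 3) (a : Fin 3 → ℝ → ℝ) :
    wavg i (tensor a) = tensor (Function.update a i fun x => (∫ s, a i s ∂lam) * bump x) := by
  rw [wavg, kop_tensor]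
  congr 2; ext x
  rw [integral_const_mul, mul_comm]

/-- The part of a test function with vanishing integral. -/
def meanFree (φ : ℝ → ℝ) (x : ℝ) : ℝ := φ x - (∫ s, φ s ∂lam) * bump x

lemma IsTest.meanFree {φ : ℝ → ℝ} (h : IsTest φ) :
    IsTest (meanFree φ) ∧ ∫ s, meanFree φ s ∂lam = 0 := by
  refine ⟨h.sub (isTest_bump.const_mul _), ?_⟩
  simp only [PlateLaminate.meanFree]
  rw [integral_sub h.integrable (isTest_bump.integrable.const_mul _), integral_const_mul,
    integral_bump, mul_one, sub_self]

/-- The indicator in the kernel produces the primitive of `a i`; the term `prim bump` subtracts the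
integral of `a i` times the primitive of `bump`. The new factor is again a test function, since
`meanFree (a i)` has integral zero. -/
lemma wprim_tensor (i : Fin 3) {a : Fin 3 → ℝ → ℝ} (ha : ∀ i, IsTest (a i)) :
    wprim i (tensor a) = tensor (Function.update a i (prim (meanFree (a i)))) := by
  rw [wprim, kop_tensor]
  congr 2; ext x
  have hc := (ha i).contDiff.continuous
  have hb := isTest_bump.contDiff.continuous
  have h1 : ∫ s, (Iio x).indicator (1 : ℝ → ℝ) s * a i s ∂lam = prim (a i) x := by
    obtain ⟨l, r, hl, hlr, hr, h0⟩ := (ha i).exists_Icc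
    have h2 : ∀ s, (Iio x).indicator (1 : ℝ → ℝ) s * a i s = (Iio x).indicator (a i) s := fun s => by
      by_cases hs : s ∈ Iio x <;> simp [hs]
    simp only [h2]
    rw [integral_indicator measurableSet_Iio, lam, Measure.restrict_restrict measurableSet_Iio]
    rcases le_or_gt x (-1 / 2) with hx | hx
    · rw [((ha i).prim_eq hl hr h0).1 (by linarith)]
      have : Iio x ∩ Ioo (-1 / 2 : ℝ) (1 / 2) = ∅ := by
        ext s; simp only [mem_inter_iff, mem_Iio, mem_Ioo, mem_empty_iff_false, iff_false]
        rintro ⟨h1, h2, _⟩; linarith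
      rw [this, Measure.restrict_empty, integral_zero_measure]
    · rcases le_or_gt x (1 / 2) with hx' | hx'
      · have : Iio x ∩ Ioo (-1 / 2 : ℝ) (1 / 2) = Ioo (-1 / 2) x := by
          ext s; simp only [mem_inter_iff, mem_Iio, mem_Ioo]
          exact ⟨fun h => ⟨h.2.1, h.1⟩, fun h => ⟨h.2, h.1, h.2.trans_le hx'⟩⟩
        rw [this, prim, intervalIntegral.integral_of_le hx.le, integral_Ioc_eq_integral_Ioo]
      · have : Iio x ∩ Ioo (-1 / 2 : ℝ) (1 / 2) = Ioo (-1 / 2) (1 / 2) := by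
          ext s; simp only [mem_inter_iff, mem_Iio, mem_Ioo]
          exact ⟨fun h => h.2, fun h => ⟨h.2.trans hx', h⟩⟩
        rw [this, ((ha i).prim_eq hl hr h0).2 (by linarith), lam]
  have hint : Integrable (fun s => (Iio x).indicator (1 : ℝ → ℝ) s * a i s) lam := by
    refine (ha i).integrable.mono ?_ (Eventually.of_forall fun s => ?_)
    · exact (measurable_one.indicator measurableSet_Iio).aestronglyMeasurable.mul
        hc.aestronglyMeasurable
    · by_cases hs : s ∈ Iio x <;> simp [hs]
  simp only [sub_mul]
  rw [integral_sub hint ((ha i).integrable.const_mul _), h1, integral_const_mul]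
  simp only [prim, meanFree]
  rw [intervalIntegral.integral_sub (hc.intervalIntegrable _ _)
    ((hb.intervalIntegrable _ _).const_mul _), intervalIntegral.integral_const_mul]
  ring

lemma tensor_sub_wavg (i : Fin 3) (a : Fin 3 → ℝ → ℝ) :
    tensor a - wavg i (tensor a) = tensor (Function.update a i (meanFree (a i))) := by
  ext p
  have h : tensor a p = tensor (Function.update a i (a i)) p := by rw [Function.update_eq_self]
  rw [Pi.sub_apply, wavg_tensor, h, tensor_update, tensor_update, tensor_update, meanFree]
  ring

lemma wavg_mem (i : Fin 3) {f : Pt → ℝ} (hf : f ∈ TestSpan) : wavg i f ∈ TestSpan := by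
  induction hf using Submodule.span_induction with
  | mem f hf =>
    obtain ⟨a, ha, rfl⟩ := hf
    rw [wavg_tensor]
    exact tensor_mem (isTest_update ha i (isTest_bump.const_mul _))
  | zero => convert! zero_mem TestSpan; ext p; simp [wavg, kop]
  | add f g hf hg h1 h2 => rw [wavg_add i hf hg]; exact add_mem h1 h2
  | smul c f _ h => rw [wavg, kop_smul]; exact Submodule.smul_mem _ c h

/-- Each weighted average replaces one factor by a multiple of `bump`, so after all three directions
only a scalar is left. -/
lemma wavg_wavg_wavg {f : Pt → ℝ} (hf : f ∈ TestSpan) :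
    ∃ c : ℝ, wavg 1 (wavg 0 (wavg 2 f)) = c • tensor fun _ => bump := by
  induction hf using Submodule.span_induction with
  | mem f hf =>
    obtain ⟨a, ha, rfl⟩ := hf
    refine ⟨(∫ s, a 0 s ∂lam) * (∫ s, a 1 s ∂lam) * (∫ s, a 2 s ∂lam), ?_⟩
    rw [wavg_tensor, wavg_tensor, wavg_tensor]
    ext p
    simp [tensor, Fin.prod_univ_three]
    ring
  | zero => exact ⟨0, by ext p; simp [wavg, kop]⟩
  | add f g hf hg h1 h2 =>
    obtain ⟨c, hc⟩ := h1
    obtain ⟨d, hd⟩ := h2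
    refine ⟨c + d, ?_⟩
    rw [wavg_add 2 hf hg, wavg_add 0 (wavg_mem 2 hf) (wavg_mem 2 hg),
      wavg_add 1 (wavg_mem 0 (wavg_mem 2 hf)) (wavg_mem 0 (wavg_mem 2 hg)), hc, hd, add_smul]
  | smul c f _ h =>
    obtain ⟨d, hd⟩ := h
    refine ⟨c * d, ?_⟩
    simp only [wavg, kop_smul] at hd ⊢
    rw [hd, smul_smul]

/-! ### Weak derivatives in the box -/

/-- `g` is the weak gradient of `u` in the interior of the box, tested with products of functions
of one variable. -/
structure IsBoxGrad (u : Pt → ℝ) (g : Fin 3 → Pt → ℝ) : Prop where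
  memLp : MemLp u 2 nu
  memLp_grad : ∀ i, MemLp (g i) 2 nu
  integral_eq : ∀ i, ∀ a : Fin 3 → ℝ → ℝ, (∀ j, IsTest (a j)) →
    ∫ p, u p * tensor (Function.update a i (deriv (a i))) p ∂nu = - ∫ p, g i p * tensor a p ∂nu

lemma kop_memLp_wprim (i : Fin 3) {f : Pt → ℝ} (hf : f ∈ TestSpan) : MemLp (wprim i f) 2 nu := by
  obtain ⟨C, -, h⟩ := exists_wprim_bound
  exact (h i (testSpan_memLp hf)).1

/-- On products, `f - wavg i f` is the `i`-th partial derivative of the test function `wprim i f`,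
so this is integration by parts, extended by linearity. -/
lemma IsBoxGrad.integral_sub_wavg {u : Pt → ℝ} {g : Fin 3 → Pt → ℝ} (h : IsBoxGrad u g) (i : Fin 3)
    {f : Pt → ℝ} (hf : f ∈ TestSpan) :
    ∫ p, u p * (f - wavg i f) p ∂nu = - ∫ p, g i p * wprim i f p ∂nu := by
  induction hf using Submodule.span_induction with
  | mem f hf =>
    obtain ⟨a, ha, rfl⟩ := hf
    have hm := (ha i).meanFree
    have := h.integral_eq i _ (isTest_update ha i (hm.1.prim hm.2))
    rw [Function.update_self, deriv_prim hm.1.contDiff.continuous, Function.update_idem] at this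
    rw [tensor_sub_wavg, this, wprim_tensor i ha]
  | zero => simp [wavg, wprim, kop]
  | add f f' hf hf' h1 h2 =>
    have e : ∀ {f}, f ∈ TestSpan → MemLp (f - wavg i f) 2 nu := fun hf =>
      (testSpan_memLp hf).sub (testSpan_memLp (wavg_mem i hf))
    rw [wavg_add i hf hf', wprim_add i hf hf', add_sub_add_comm]
    simp only [Pi.add_apply (f - wavg i f), Pi.add_apply (wprim i f), mul_add]
    rw [integral_add (MemLp.integrable_mul_nu h.memLp (e hf)) (MemLp.integrable_mul_nu h.memLp (e hf')),
      integral_add (MemLp.integrable_mul_nu (h.memLp_grad i) (kop_memLp_wprim i hf))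
      (MemLp.integrable_mul_nu (h.memLp_grad i) (kop_memLp_wprim i hf')), h1, h2]
    ring
  | smul c f _ h1 =>
    rw [wavg, wprim, kop_smul, kop_smul, ← smul_sub]
    simp only [Pi.smul_apply c, smul_eq_mul, mul_left_comm _ c, integral_const_mul]
    rw [wavg, wprim] at h1
    rw [h1, mul_neg]

/-- Poincaré's inequality in the box. -/
lemma exists_poincare : ∃ C, 0 ≤ C ∧ ∀ {u : Pt → ℝ} {g : Fin 3 → Pt → ℝ}, IsBoxGrad u g →
    ∫ p, u p * tensor (fun _ => bump) p ∂nu = 0 → nrm u ≤ C * (nrm (g 0) + nrm (g 1) + nrm (g 2)) := by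
  obtain ⟨A, hA, hA'⟩ := exists_wavg_bound
  obtain ⟨P, hP, hP'⟩ := exists_wprim_bound
  refine ⟨P * (1 + A + A * A), by positivity, fun {u g} h h0 => ?_⟩
  set N := P * (1 + A + A * A) * (nrm (g 0) + nrm (g 1) + nrm (g 2)) with hN
  have n0 := nrm_nonneg (g 0)
  have n1 := nrm_nonneg (g 1)
  have n2 := nrm_nonneg (g 2)
  -- Bound by duality: averaging `f` successively in `x₃`, `y₁`, `y₂` telescopes it into three
  -- partial derivatives of test functions plus a multiple of the product of bumps, which `h0`
  -- annihilates.
  have hdual : ∀ f ∈ TestSpan, |∫ p, u p * f p ∂nu| ≤ N * nrm f := by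
    intro f hf
    have m2 := wavg_mem 2 hf
    have m0 := wavg_mem 0 m2
    have m1 := wavg_mem 1 m0
    have split : ∀ i {f}, f ∈ TestSpan → ∫ p, u p * f p ∂nu
        = - ∫ p, g i p * wprim i f p ∂nu + ∫ p, u p * wavg i f p ∂nu := by
      intro i f hf
      rw [← h.integral_sub_wavg i hf, ← integral_add (MemLp.integrable_mul_nu h.memLp
        ((testSpan_memLp hf).sub (testSpan_memLp (wavg_mem i hf))))
        (MemLp.integrable_mul_nu h.memLp (testSpan_memLp (wavg_mem i hf)))]
      congr 1; ext p; simp only [Pi.sub_apply]; ring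
    have e1 := split 2 hf
    have e2 := split 0 m2
    have e3 := split 1 m0
    obtain ⟨c, hc⟩ := wavg_wavg_wavg hf
    have e4 : ∫ p, u p * wavg 1 (wavg 0 (wavg 2 f)) p ∂nu = 0 := by
      simp only [hc, Pi.smul_apply, smul_eq_mul, mul_left_comm _ c, integral_const_mul, h0, mul_zero]
    have b : ∀ i {f}, f ∈ TestSpan → |∫ p, g i p * wprim i f p ∂nu| ≤ nrm (g i) * (P * nrm f) := by
      intro i f hf
      exact (abs_integral_mul_le (h.memLp_grad i) (kop_memLp_wprim i hf)).trans
        (mul_le_mul_of_nonneg_left (hP' i (testSpan_memLp hf)).2 (nrm_nonneg _))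
    have b1 := b 2 hf
    have b2 := b 0 m2
    have b3 := b 1 m0
    have k1 := (hA' 2 (testSpan_memLp hf)).2
    have k2 := (hA' 0 (testSpan_memLp m2)).2
    have nf := nrm_nonneg f
    have k3 : nrm (wavg 0 (wavg 2 f)) ≤ A * (A * nrm f) :=
      k2.trans (mul_le_mul_of_nonneg_left k1 hA)
    have c2 : nrm (g 0) * (P * nrm (wavg 2 f)) ≤ nrm (g 0) * (P * (A * nrm f)) := by gcongr
    have c3 : nrm (g 1) * (P * nrm (wavg 0 (wavg 2 f))) ≤ nrm (g 1) * (P * (A * (A * nrm f))) := by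
      gcongr
    rw [e1, e2, e3, e4]
    have t : ∀ x y z : ℝ, |-x + (-y + (-z + 0))| ≤ |x| + |y| + |z| := by
      intro x y z
      have e : -x + (-y + (-z + 0)) = -(x + y + z) := by ring
      rw [e, abs_neg]
      exact abs_add_three x y z
    have w1 : 0 ≤ P * nrm f := by positivity
    have w2 : 0 ≤ A * A := by positivity
    calc _ ≤ _ := t _ _ _
      _ ≤ nrm (g 2) * (P * nrm f) + nrm (g 0) * (P * (A * nrm f))
          + nrm (g 1) * (P * (A * (A * nrm f))) := by linarith
      _ = P * nrm f * (nrm (g 2) + A * nrm (g 0) + A * A * nrm (g 1)) := by ring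
      _ ≤ P * nrm f * ((1 + A + A * A) * (nrm (g 0) + nrm (g 1) + nrm (g 2))) := by
          refine mul_le_mul_of_nonneg_left ?_ w1
          nlinarith [mul_nonneg hA n0, mul_nonneg hA n1, mul_nonneg hA n2, mul_nonneg w2 n0,
            mul_nonneg w2 n1, mul_nonneg w2 n2]
      _ = N * nrm f := by rw [hN]; ring
  have hN0 : 0 ≤ N := by positivity
  by_contra hlt
  push Not at hlt
  have hu := nrm_nonneg u
  set d := (nrm u - N) with hd
  have hd0 : 0 < d := sub_pos.2 hlt
  have hu0 : 0 < nrm u := hN0.trans_lt hlt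
  -- With `δ = ‖u - f‖`, the dual bound gives `‖u‖² ≤ N(‖u‖ + δ) + ‖u‖δ`, that is `‖u‖ d ≤ δ(‖u‖ +
  -- N)`. The value of `ε` is chosen to contradict this.
  obtain ⟨f, hf, hε⟩ := exists_testSpan_nrm_sub_lt h.memLp (ε := nrm u * d / (nrm u + N)) (by positivity)
  have hfL := testSpan_memLp hf
  have hsub : MemLp (fun p => u p - f p) 2 nu := h.memLp.sub hfL
  have e1 : nrm u ^ 2 = ∫ p, u p * f p ∂nu + ∫ p, u p * (u p - f p) ∂nu := by
    rw [nrm_sq, ← integral_add (MemLp.integrable_mul_nu h.memLp hfL)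
      (MemLp.integrable_mul_nu h.memLp hsub)]
    congr 1; ext p; ring
  have e2 := (le_abs_self _).trans (hdual f hf)
  have e3 := (le_abs_self _).trans (abs_integral_mul_le h.memLp hsub)
  have e4 : nrm f ≤ nrm u + nrm (fun p => u p - f p) := by
    have := nrm_sub_le h.memLp hsub
    simpa only [sub_sub_cancel] using this
  set δ := nrm (fun p => u p - f p)
  have e3' : ∫ p, u p * (u p - f p) ∂nu ≤ nrm u * δ := e3
  have e5 : δ * (nrm u + N) < nrm u * d := by rwa [lt_div_iff₀ (by positivity)] at hε
  have e6 := mul_le_mul_of_nonneg_left e4 hN0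
  nlinarith

/-- If the average of `a` in `x₃` vanishes, then `∫ a ∂₁u` is controlled by `∂₃u`, up to a small
multiple of the norm of `∂₁u`. -/
lemma exists_bound_integral_mul_grad {a : Pt → ℝ} (ha : MemLp a 2 nu) (ha0 : wavg 2 a =ᵐ[nu] 0)
    {ε : ℝ} (hε : 0 < ε) : ∃ C, ∀ {u : Pt → ℝ} {g : Fin 3 → Pt → ℝ}, IsBoxGrad u g →
      |∫ p, a p * g 0 p ∂nu| ≤ ε * nrm (g 0) + C * nrm (g 2) := by
  obtain ⟨A, hA, hA'⟩ := exists_wavg_bound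
  obtain ⟨f, hf, hlt⟩ := exists_testSpan_nrm_sub_lt ha (ε := ε / (1 + A)) (by positivity)
  have hfL := testSpan_memLp hf
  -- For a product, `f - wavg 2 f = ∂₃F` with `F = wprim 2 f`, and two integrations by parts give `∫
  -- ∂₃F ∂₁u = ∫ ∂₁F ∂₃u`. So `k = ∂₁F`, independently of `u`.
  have key : ∃ k, MemLp k 2 nu ∧ ∀ {u : Pt → ℝ} {g : Fin 3 → Pt → ℝ}, IsBoxGrad u g →
      ∫ p, (f - wavg 2 f) p * g 0 p ∂nu = ∫ p, k p * g 2 p ∂nu := by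
    clear hlt hfL
    induction hf using Submodule.span_induction with
    | mem f hf =>
      obtain ⟨a, ha, rfl⟩ := hf
      have hm := (ha 2).meanFree
      have hT := isTest_update (isTest_update ha 2 (hm.1.prim hm.2)) 0 (ha 0).deriv
      refine ⟨_, testSpan_memLp (tensor_mem hT), fun {u g} h => ?_⟩
      have h1 := h.integral_eq 2 _ hT
      have h2 := h.integral_eq 0 _ (isTest_update ha 2 hm.1)
      rw [tensor_sub_wavg]
      simp only [mul_comm _ (g _ _)]
      rw [← neg_inj, ← h1, ← h2, Function.update_of_ne (by decide), Function.update_of_ne (by decide),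
        Function.update_self, deriv_prim hm.1.contDiff.continuous,
        Function.update_comm (by decide : (0 : Fin 3) ≠ 2) _ _ (Function.update a 2 _),
        Function.update_idem, Function.update_comm (by decide : (2 : Fin 3) ≠ 0)]
    | zero => exact ⟨0, MemLp.zero, fun _ => by simp [wavg, kop]⟩
    | add f f' hf hf' h1 h2 =>
      obtain ⟨k, hk, hk'⟩ := h1
      obtain ⟨l, hl, hl'⟩ := h2
      refine ⟨k + l, hk.add hl, fun {u g} h => ?_⟩
      have e : ∀ {f}, f ∈ TestSpan → MemLp (f - wavg 2 f) 2 nu := fun hf =>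
        (testSpan_memLp hf).sub (testSpan_memLp (wavg_mem 2 hf))
      rw [wavg_add 2 hf hf', add_sub_add_comm]
      simp only [Pi.add_apply (f - wavg 2 f), Pi.add_apply k, add_mul]
      rw [integral_add (MemLp.integrable_mul_nu (e hf) (h.memLp_grad 0))
        (MemLp.integrable_mul_nu (e hf') (h.memLp_grad 0)),
        integral_add (MemLp.integrable_mul_nu hk (h.memLp_grad 2))
        (MemLp.integrable_mul_nu hl (h.memLp_grad 2)), hk' h, hl' h]
    | smul c f _ h1 =>
      obtain ⟨k, hk, hk'⟩ := h1
      refine ⟨c • k, hk.const_smul c, fun {u g} h => ?_⟩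
      rw [wavg, kop_smul, ← smul_sub]
      simp only [Pi.smul_apply c, smul_eq_mul, mul_assoc, integral_const_mul]
      have := hk' h
      rw [wavg] at this
      rw [this]
  obtain ⟨k, hk, hk'⟩ := key
  refine ⟨nrm k, fun {u g} h => ?_⟩
  have hsub : MemLp (fun p => a p - f p) 2 nu := ha.sub hfL
  have hw := hA' 2 hsub
  have hrest : MemLp (fun p => (a p - f p) - wavg 2 (fun p => a p - f p) p) 2 nu := hsub.sub hw.1
  -- Since `a` averages to zero, `a` is the sum of `f - wavg 2 f` and of `(a - f) - wavg 2 (a - f)`.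
  -- The norm of the latter is at most `(1 + A)‖a - f‖`, which explains the accuracy `ε / (1 + A)`.
  have hweq : ∀ᵐ p ∂nu, wavg 2 (fun p => a p - f p) p = - wavg 2 f p := by
    filter_upwards [ha0, (integrable_comp_repl 2 (MemLp.integrable_nu ha)).prod_right_ae] with p h1 h2
    have hfi : Integrable (fun s => f (repl 2 p s)) lam := by
      obtain ⟨c1, D, hD⟩ := testSpan_bdd hf
      exact Integrable.of_bound (c1.comp (continuous_repl 2 p)).aestronglyMeasurable D
        (Eventually.of_forall fun s => hD _)
    simp only [wavg, kop, integral_const_mul, Pi.zero_apply] at h1 ⊢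
    rw [integral_sub h2 hfi, mul_sub, h1, zero_sub]
  have e1 : ∫ p, a p * g 0 p ∂nu
      = ∫ p, ((a p - f p) - wavg 2 (fun p => a p - f p) p) * g 0 p ∂nu + ∫ p, k p * g 2 p ∂nu := by
    rw [← hk' h, ← integral_add (MemLp.integrable_mul_nu hrest (h.memLp_grad 0))
      (MemLp.integrable_mul_nu (hfL.sub (testSpan_memLp (wavg_mem 2 hf))) (h.memLp_grad 0))]
    refine integral_congr_ae (hweq.mono fun p hp => ?_)
    simp only [hp, Pi.sub_apply]; ring
  have e2 : nrm (fun p => (a p - f p) - wavg 2 (fun p => a p - f p) p) ≤ ε := by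
    refine (nrm_sub_le hsub hw.1).trans ?_
    rw [lt_div_iff₀ (by positivity)] at hlt
    linarith [hw.2]
  rw [e1]
  refine (abs_add_le _ _).trans (add_le_add ?_ (abs_integral_mul_le hk (h.memLp_grad 2)))
  exact (abs_integral_mul_le hrest (h.memLp_grad 0)).trans
    (mul_le_mul_of_nonneg_right e2 (nrm_nonneg _))

/-! ### The slab and the box. -/

lemma isOpen_Slab : IsOpen Slab := isOpen_Ioo.prod isOpen_univ

lemma measurableSet_Slab : MeasurableSet Slab := isOpen_Slab.measurableSet

lemma measurableSet_Box : MeasurableSet Box :=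
  measurableSet_Ioo.prod (measurableSet_Ico.prod measurableSet_Ico)

lemma Box_subset_Slab : Box ⊆ Slab := prod_mono le_rfl (subset_univ _)

lemma ae_nu_of_ae_Slab {P : Pt → Prop} (h : ∀ᵐ p ∂(volume.restrict Slab), P p) : ∀ᵐ p ∂nu, P p := by
  rw [← restrict_Box]
  exact ae_mono (Measure.restrict_mono Box_subset_Slab le_rfl) h

/-! ### Products as test functions in the slab -/

lemma coord_add_smul_dir (i j : Fin 3) (p : Pt) (t : ℝ) :
    coord j (p + t • dir i) = if j = i then coord j p + t else coord j p := by
  fin_cases i <;> fin_cases j <;> simp [coord, dir]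

lemma fderiv_tensor {a : Fin 3 → ℝ → ℝ} (ha : ∀ i, ContDiff ℝ ∞ (a i)) (i : Fin 3) (p : Pt) :
    fderiv ℝ (tensor a) p (dir i) = tensor (Function.update a i (deriv (a i))) p := by
  have hd : DifferentiableAt ℝ (tensor a) p := (contDiff_tensor ha).differentiable (by simp) p
  rw [← hd.lineDeriv_eq_fderiv, lineDeriv, tensor_update]
  have h1 : (fun t : ℝ => tensor a (p + t • dir i))
      = fun t => a i (coord i p + t) * ∏ j ∈ Finset.univ.erase i, a j (coord j p) := by
    ext t
    rw [tensor, ← Finset.mul_prod_erase _ _ (Finset.mem_univ i), coord_add_smul_dir, if_pos rfl]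
    congr 1
    refine Finset.prod_congr rfl fun j hj => ?_
    rw [coord_add_smul_dir, if_neg (Finset.ne_of_mem_erase hj)]
  rw [h1, deriv_mul_const_field, deriv_comp_const_add, add_zero]

lemma tensor_eq_zero {a : Fin 3 → ℝ → ℝ} {p : Pt} (i : Fin 3) (h : a i (coord i p) = 0) :
    tensor a p = 0 := Finset.prod_eq_zero (Finset.mem_univ i) h

lemma hasCompactSupport_tensor {a : Fin 3 → ℝ → ℝ} (hc : ∀ i, HasCompactSupport (a i)) :
    HasCompactSupport (tensor a) := by
  have hK : IsCompact (tsupport (a 2) ×ˢ tsupport (a 0) ×ˢ tsupport (a 1)) :=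
    IsCompact.prod (hc 2) (IsCompact.prod (hc 0) (hc 1))
  refine HasCompactSupport.intro hK fun p hp => ?_
  simp only [mem_prod, not_and_or] at hp
  rcases hp with h | h | h
  · exact tensor_eq_zero 2 (image_eq_zero_of_notMem_tsupport h)
  · exact tensor_eq_zero 0 (image_eq_zero_of_notMem_tsupport h)
  · exact tensor_eq_zero 1 (image_eq_zero_of_notMem_tsupport h)

lemma tsupport_tensor {a : Fin 3 → ℝ → ℝ} (h : IsTest (a 2)) : tsupport (tensor a) ⊆ Slab := by
  have h1 : tsupport (tensor a) ⊆ coord 2 ⁻¹' tsupport (a 2) := by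
    refine closure_minimal (fun p hp => ?_)
      ((isClosed_tsupport _).preimage (contDiff_coord 2 (n := 0)).continuous)
    by_contra h2
    exact hp (tensor_eq_zero 2 (image_eq_zero_of_notMem_tsupport h2))
  exact fun p hp => ⟨h.tsupport_subset (h1 hp), trivial⟩

lemma IsTest.eq_zero {φ : ℝ → ℝ} (h : IsTest φ) {s : ℝ} (hs : s ∉ Ioo (-1 / 2 : ℝ) (1 / 2)) :
    φ s = 0 := image_eq_zero_of_notMem_tsupport fun h' => hs (h.tsupport_subset h')

lemma tensor_eq_zero_of_notMem {a : Fin 3 → ℝ → ℝ} (ha : ∀ i, IsTest (a i)) {p : Pt}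
    (hp : p ∉ Box) : tensor a p = 0 := by
  simp only [Box, mem_prod, not_and_or] at hp
  rcases hp with h | h | h
  · exact tensor_eq_zero 2 ((ha 2).eq_zero h)
  · exact tensor_eq_zero 0 ((ha 0).eq_zero fun h' => h ⟨h'.1.le, h'.2⟩)
  · exact tensor_eq_zero 1 ((ha 1).eq_zero fun h' => h ⟨h'.1.le, h'.2⟩)

lemma IsWeakGrad.integral_tensor {u : Pt → ℝ} {g : Fin 3 → Pt → ℝ} (h : IsWeakGrad u g) (i : Fin 3)
    {a : Fin 3 → ℝ → ℝ} (ha : ∀ i, ContDiff ℝ ∞ (a i)) (hc : ∀ i, HasCompactSupport (a i))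
    (h2 : IsTest (a 2)) :
    ∫ p in Slab, u p * tensor (Function.update a i (deriv (a i))) p
      = - ∫ p in Slab, g i p * tensor a p := by
  rw [← h.integral_eq i _ (contDiff_tensor ha) (hasCompactSupport_tensor hc) (tsupport_tensor h2)]
  simp only [fderiv_tensor ha]

/-- Products of test functions of `(-1/2, 1/2)` are test functions of the slab that vanish outside
the box. -/
lemma MemH1.isBoxGrad {u : Pt → ℝ} {g : Fin 3 → Pt → ℝ} (h : MemH1 u g) : IsBoxGrad u g := by
  refine ⟨restrict_Box ▸ h.memLp, fun i => restrict_Box ▸ h.memLp_grad i, fun i a ha => ?_⟩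
  have key : ∀ (f : Pt → ℝ) {b : Fin 3 → ℝ → ℝ}, (∀ i, IsTest (b i)) →
      ∫ p, f p * tensor b p ∂nu = ∫ p in Slab, f p * tensor b p := fun f b hb => by
    rw [← restrict_Box]
    refine (setIntegral_eq_of_subset_of_forall_sdiff_eq_zero measurableSet_Slab
      Box_subset_Slab fun p hp => ?_).symm
    rw [tensor_eq_zero_of_notMem hb hp.2, mul_zero]
  rw [key u (isTest_update ha i (ha i).deriv), key (g i) ha]
  exact h.weakGrad.integral_tensor i (fun i => (ha i).contDiff) (fun i => (ha i).compact) (ha 2)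

/-! ### Translations -/

lemma add_mem_Slab {v : Pt} (hv : v.1 = 0) {p : Pt} : p + v ∈ Slab ↔ p ∈ Slab := by
  simp [Slab, hv]

instance isAddHaarMeasure_volume : (volume : Measure Pt).IsAddHaarMeasure :=
  have : (volume : Measure (ℝ × ℝ)).IsAddHaarMeasure :=
    Measure.prod.instIsAddHaarMeasure (volume : Measure ℝ) (volume : Measure ℝ)
  Measure.prod.instIsAddHaarMeasure (volume : Measure ℝ) (volume : Measure (ℝ × ℝ))

lemma measurePreserving_add_Slab {v : Pt} (hv : v.1 = 0) :
    MeasurePreserving (fun p : Pt => p + v) (volume.restrict Slab) (volume.restrict Slab) := by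
  have := (measurePreserving_add_right (volume : Measure Pt) v).restrict_preimage measurableSet_Slab
  have e : (fun p : Pt => p + v) ⁻¹' Slab = Slab := by ext p; exact add_mem_Slab hv
  rwa [e] at this

lemma locallyIntegrableOn_comp_add {f : Pt → ℝ} (hf : LocallyIntegrableOn f Slab) {v : Pt}
    (hv : v.1 = 0) : LocallyIntegrableOn (fun p => f (p + v)) Slab := by
  intro x hx
  obtain ⟨U, hU, hUi⟩ := hf (x + v) ((add_mem_Slab hv).2 hx)
  refine ⟨(fun p : Pt => p + v) ⁻¹' U, ?_, ?_⟩
  · refine mem_map.1 ((tendsto_nhdsWithin_iff (s := Slab)).2 ⟨?_, ?_⟩ hU)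
    · exact ((continuous_id.add continuous_const).tendsto x).mono_left nhdsWithin_le_nhds
    · exact eventually_nhdsWithin_of_forall fun p hp => (add_mem_Slab hv).2 hp
  · exact ((measurePreserving_add_right (volume : Measure Pt) v).integrableOn_comp_preimage
      (measurableEmbedding_addRight v)).2 hUi

lemma IsWeakGrad.comp_add {u : Pt → ℝ} {g : Fin 3 → Pt → ℝ} (h : IsWeakGrad u g) {v : Pt}
    (hv : v.1 = 0) : IsWeakGrad (fun p => u (p + v)) fun i p => g i (p + v) := by
  refine ⟨locallyIntegrableOn_comp_add h.1 hv, fun i => locallyIntegrableOn_comp_add (h.2 i) hv,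
    fun i η hη hc hs => ?_⟩
  have key : ∀ F : Pt → ℝ, ∫ p in Slab, F (p + v) = ∫ p in Slab, F p := fun F =>
    (measurePreserving_add_Slab hv).integral_comp (measurableEmbedding_addRight v) F
  have hηv : ContDiff ℝ ∞ fun p : Pt => η (p - v) := hη.comp (contDiff_id.sub contDiff_const)
  have hcv : HasCompactSupport fun p : Pt => η (p - v) :=
    hc.comp_homeomorph (Homeomorph.subRight v)
  have hsv : tsupport (fun p : Pt => η (p - v)) ⊆ Slab := by
    intro p hp
    have : p - v ∈ tsupport η := by
      have hcl : IsClosed ((fun p : Pt => p - v) ⁻¹' tsupport η) :=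
        (isClosed_tsupport η).preimage (continuous_id.sub continuous_const)
      have hsub : Function.support (fun p : Pt => η (p - v)) ⊆ (fun p : Pt => p - v) ⁻¹' tsupport η :=
        fun q hq => subset_tsupport η hq
      exact closure_minimal hsub hcl hp
    have := hs this
    rwa [← add_mem_Slab hv, sub_add_cancel] at this
  have := h.integral_eq i _ hηv hcv hsv
  rw [← key, ← key (fun p => g i p * η (p - v))] at this
  simp only [add_sub_cancel_right] at this
  rw [← this]
  congr 1; ext p
  have := fderiv_comp_sub (𝕜 := ℝ) (f := η) v (x := p + v)
  rw [this, add_sub_cancel_right]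

/-- The lattice vector with integer coordinates `z`. -/
def shv (z : ℤ × ℤ) : Pt := (0, z.1, z.2)

lemma isPeriodic_iff {X : Type} {f : Pt → X} :
    IsPeriodic f ↔ ∀ z, ∀ᵐ p ∂(volume.restrict Slab), f (p + shv z) = f p := by
  have e : ∀ (p : Pt) z, p + shv z = (p.1, p.2.1 + (z.1 : ℝ), p.2.2 + (z.2 : ℝ)) := fun p z => by
    simp [shv, Prod.ext_iff]
  simp only [e]
  exact ⟨fun h z => h z.1 z.2, fun h k l => h (k, l)⟩

lemma IsPeriodic.comp₂ {f g : Pt → ℝ} (hf : IsPeriodic f) (hg : IsPeriodic g) (F : ℝ → ℝ → ℝ) :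
    IsPeriodic fun p => F (f p) (g p) := fun k l => by
  filter_upwards [hf k l, hg k l] with p h1 h2
  rw [h1, h2]

lemma IsPeriodic.comp_add {f : Pt → ℝ} (hf : IsPeriodic f) {v : Pt} (hv : v.1 = 0) :
    IsPeriodic fun p => f (p + v) := by
  rw [isPeriodic_iff] at hf ⊢
  intro z
  filter_upwards [(measurePreserving_add_Slab hv).quasiMeasurePreserving.ae (hf z)] with p hp
  rw [← hp]; congr 1; abel

lemma IsWeakGrad.ae_eq {u u' : Pt → ℝ} {g g' : Fin 3 → Pt → ℝ} (h : IsWeakGrad u g)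
    (h' : IsWeakGrad u' g') (huu : u =ᵐ[volume.restrict Slab] u') (i : Fin 3) :
    g i =ᵐ[volume.restrict Slab] g' i := by
  have hl : LocallyIntegrableOn (fun p => g i p - g' i p) Slab := (h.2 i).sub (h'.2 i)
  have := isOpen_Slab.ae_eq_zero_of_integral_contDiff_smul_eq_zero hl fun η hη hc hs => by
    have hi : ∀ {f : Pt → ℝ}, LocallyIntegrableOn f Slab → IntegrableOn (fun p => f p * η p) Slab := by
      intro f hf
      have : IntegrableOn (fun p => η p • f p) (tsupport η) :=
        IntegrableOn.continuousOn_smul (hf.integrableOn_compact_subset hs hc)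
          hη.continuous.continuousOn hc
      simp only [smul_eq_mul, mul_comm (η _)] at this
      refine IntegrableOn.of_forall_sdiff_eq_zero this measurableSet_Slab fun p hp => ?_
      rw [image_eq_zero_of_notMem_tsupport hp.2, mul_zero]
    rw [← setIntegral_eq_integral_of_forall_compl_eq_zero (s := Slab)]
    · have e : ∀ p, η p • (g i p - g' i p) = g i p * η p - g' i p * η p := fun p => by
        simp only [smul_eq_mul]; ring
      simp only [e]
      rw [integral_sub (hi (h.2 i)) (hi (h'.2 i)), sub_eq_zero, ← neg_inj,
        ← h.integral_eq i η hη hc hs, ← h'.integral_eq i η hη hc hs]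
      exact integral_congr_ae (huu.mono fun p hp => by simp only [hp])
    · intro p hp
      rw [image_eq_zero_of_notMem_tsupport fun h => hp (hs h), zero_smul]
  rw [← ae_restrict_iff' measurableSet_Slab] at this
  exact this.mono fun p hp => sub_eq_zero.1 hp

/-- `MemH1` demands periodicity of `u` only. A lattice translate of `g` is a weak gradient of a
translate of `u`, which is `u` almost everywhere, and weak gradients are unique. -/
lemma MemH1.periodic_grad {u : Pt → ℝ} {g : Fin 3 → Pt → ℝ} (h : MemH1 u g) (i : Fin 3) :
    IsPeriodic (g i) := by
  have hp := isPeriodic_iff.1 h.periodic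
  exact isPeriodic_iff.2 fun z => (h.weakGrad.comp_add (v := shv z) rfl).ae_eq h.weakGrad (hp z) i

/-! ### Unfolding -/

/-- The translate of the box by a lattice vector. -/
def cell (z : ℤ × ℤ) : Set Pt := (fun p : Pt => p - shv z) ⁻¹' Box

lemma measurableSet_cell (z : ℤ × ℤ) : MeasurableSet (cell z) :=
  measurableSet_Box.preimage (measurable_id.sub measurable_const)

/-- The half-open cells partition the slab, and the index of the cell containing a point is read off
with the floor function. -/
lemma mem_cell {z : ℤ × ℤ} {p : Pt} : p ∈ cell z ↔ p.1 ∈ Ioo (-1 / 2 : ℝ) (1 / 2) ∧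
    z.1 = ⌊p.2.1 + 1 / 2⌋ ∧ z.2 = ⌊p.2.2 + 1 / 2⌋ := by
  have key : ∀ (x : ℝ) (k : ℤ), x - k ∈ Ico (-1 / 2 : ℝ) (1 / 2) ↔ k = ⌊x + 1 / 2⌋ := by
    intro x k
    rw [eq_comm, Int.floor_eq_iff]
    simp only [mem_Ico]
    constructor <;> rintro ⟨h1, h2⟩ <;> constructor <;> linarith
  simp only [cell, mem_preimage, Box, mem_prod, Prod.fst_sub, Prod.snd_sub, shv, sub_zero, key]

lemma disjoint_cell {z w : ℤ × ℤ} (h : z ≠ w) : Disjoint (cell z) (cell w) := by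
  rw [Set.disjoint_left]
  intro p h1 h2
  rw [mem_cell] at h1 h2
  exact h (Prod.ext (h1.2.1.trans h2.2.1.symm) (h1.2.2.trans h2.2.2.symm))

lemma cell_subset_Slab (z : ℤ × ℤ) : cell z ⊆ Slab := fun _ hp => ⟨(mem_cell.1 hp).1, trivial⟩

lemma cell_preimage (z : ℤ × ℤ) : (fun p : Pt => p + shv z) ⁻¹' cell z = Box := by
  ext p; simp [cell]

lemma integrableOn_cell {F : Pt → ℝ} (z : ℤ × ℤ) :
    IntegrableOn F (cell z) ↔ Integrable (fun p => F (p + shv z)) nu := by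
  rw [← restrict_Box, ← cell_preimage z]
  exact ((measurePreserving_add_right (volume : Measure Pt) (shv z)).integrableOn_comp_preimage
      (measurableEmbedding_addRight _)).symm

lemma setIntegral_cell (F : Pt → ℝ) (z : ℤ × ℤ) :
    ∫ p in cell z, F p = ∫ p, F (p + shv z) ∂nu := by
  rw [← restrict_Box, ← cell_preimage z]
  exact ((measurePreserving_add_right (volume : Measure Pt) (shv z)).setIntegral_preimage_emb
      (measurableEmbedding_addRight _) F (cell z)).symm

lemma integral_Slab_eq_sum {F : Pt → ℝ} (Z : Finset (ℤ × ℤ))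
    (h0 : ∀ p, (∀ z ∈ Z, p ∉ cell z) → F p = 0)
    (hi : ∀ z ∈ Z, Integrable (fun p => F (p + shv z)) nu) :
    IntegrableOn F Slab ∧ ∫ p in Slab, F p = ∑ z ∈ Z, ∫ p, F (p + shv z) ∂nu := by
  have hsub : (⋃ z ∈ Z, cell z) ⊆ Slab := iUnion₂_subset fun z _ => cell_subset_Slab z
  have h0' : ∀ p ∈ Slab \ ⋃ z ∈ Z, cell z, F p = 0 := fun p hp =>
    h0 p fun z hz h => hp.2 (mem_iUnion₂.2 ⟨z, hz, h⟩)
  have hI : ∀ z ∈ Z, IntegrableOn F (cell z) := fun z hz => (integrableOn_cell z).2 (hi z hz)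
  refine ⟨IntegrableOn.of_forall_sdiff_eq_zero ((integrableOn_finset_iUnion).2 hI)
    measurableSet_Slab h0', ?_⟩
  rw [setIntegral_eq_of_subset_of_forall_sdiff_eq_zero measurableSet_Slab hsub h0',
    integral_biUnion_finset Z (fun z _ => measurableSet_cell z)
      (fun z _ w _ hzw => disjoint_cell hzw) hI]
  exact Finset.sum_congr rfl fun z _ => setIntegral_cell F z

lemma IsPeriodic.ae_nu {f : Pt → ℝ} (hf : IsPeriodic f) (z : ℤ × ℤ) :
    ∀ᵐ p ∂nu, f (p + shv z) = f p := ae_nu_of_ae_Slab (isPeriodic_iff.1 hf z)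

/-- The lattice points whose cells cover the points of the slab with `|y₁|, |y₂| ≤ N`. -/
def cells (N : ℕ) : Finset (ℤ × ℤ) := Finset.Icc (-N : ℤ) N ×ˢ Finset.Icc (-N : ℤ) N

lemma exists_mem_cell {N : ℕ} {p : Pt} (hp : p ∈ Slab) (h1 : |p.2.1| ≤ N) (h2 : |p.2.2| ≤ N) :
    ∃ z ∈ cells N, p ∈ cell z := by
  have key : ∀ {x : ℝ}, |x| ≤ N → ⌊x + 1 / 2⌋ ∈ Finset.Icc (-N : ℤ) N := by
    intro x hx
    rw [abs_le] at hx
    rw [Finset.mem_Icc]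
    constructor
    · rw [Int.le_floor]; push_cast; linarith [hx.1]
    · rw [← Int.lt_add_one_iff, Int.floor_lt]; push_cast; linarith [hx.2]
  exact ⟨(⌊p.2.1 + 1 / 2⌋, ⌊p.2.2 + 1 / 2⌋), Finset.mem_product.2 ⟨key h1, key h2⟩,
    mem_cell.2 ⟨hp.1, rfl, rfl⟩⟩

lemma exists_cells {η : Pt → ℝ} (hc : HasCompactSupport η) (hs : tsupport η ⊆ Slab) :
    ∃ N : ℕ, ∀ p, (∀ z ∈ cells N, p ∉ cell z) → η p = 0 := by
  obtain ⟨R, hR⟩ := (IsCompact.isBounded hc).exists_norm_le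
  obtain ⟨N, hN⟩ := exists_nat_ge R
  refine ⟨N, fun p hp => ?_⟩
  by_contra h0
  have hpt : p ∈ tsupport η := subset_tsupport η h0
  have hn := (hR p hpt).trans hN
  rw [Prod.norm_def, Prod.norm_def, max_le_iff, max_le_iff] at hn
  obtain ⟨z, hz, hpz⟩ := exists_mem_cell (hs hpt) hn.2.1 hn.2.2
  exact hp z hz hpz

lemma IsPeriodic.locallyIntegrableOn {f : Pt → ℝ} (hf : IsPeriodic f) (hi : Integrable f nu) :
    LocallyIntegrableOn f Slab := by
  intro x hx
  obtain ⟨N, hN⟩ := exists_nat_ge (‖x.2‖ + 1)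
  refine ⟨⋃ z ∈ cells N, cell z, ?_, (integrableOn_finset_iUnion).2 fun z _ =>
    (integrableOn_cell z).2 (hi.congr ((hf.ae_nu z).mono fun p hp => hp.symm))⟩
  have h1 : ∀ᶠ p in 𝓝[Slab] x, ‖p.2‖ < N := by
    refine nhdsWithin_le_nhds ?_
    refine (continuous_snd.norm).continuousAt.eventually_lt continuousAt_const ?_
    linarith
  filter_upwards [h1, self_mem_nhdsWithin] with p hp hps
  rw [Prod.norm_def, max_lt_iff] at hp
  obtain ⟨z, hz, hpz⟩ := exists_mem_cell hps hp.1.le hp.2.le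
  exact mem_iUnion₂.2 ⟨z, hz, hpz⟩

/-- The support of `η` meets finitely many cells, and in each of them a periodic `f` has the same
`L²` norm. Integration against `η` is thus continuous for the norm of `L²(□)`, which lets weak
derivatives pass to limits. -/
lemma exists_bound_integral_Slab {η : Pt → ℝ} (hη : Continuous η) (hc : HasCompactSupport η)
    (hs : tsupport η ⊆ Slab) : ∃ K, ∀ f : Pt → ℝ, IsPeriodic f → MemLp f 2 nu →
      IntegrableOn (fun p => f p * η p) Slab ∧ |∫ p in Slab, f p * η p| ≤ K * nrm f := by
  obtain ⟨N, hN⟩ := exists_cells hc hs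
  obtain ⟨C, hC⟩ := hc.exists_bound_of_continuous hη
  refine ⟨∑ z ∈ cells N, nrm fun p => η (p + shv z), fun f hf hL => ?_⟩
  have hηL : ∀ z, MemLp (fun p => η (p + shv z)) 2 nu := fun z =>
    memLp_of_bdd (hη.comp (continuous_id.add continuous_const)).aestronglyMeasurable
      (C := C) fun p => hC _
  have hae : ∀ z, (fun p => f p * η (p + shv z)) =ᵐ[nu] fun p => f (p + shv z) * η (p + shv z) :=
    fun z => (hf.ae_nu z).mono fun p hp => by simp only [hp]
  obtain ⟨h1, h2⟩ := integral_Slab_eq_sum (F := fun p => f p * η p) (cells N)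
    (fun p hp => by rw [hN p hp, mul_zero]) fun z _ =>
      (MemLp.integrable_mul_nu hL (hηL z)).congr (hae z)
  refine ⟨h1, ?_⟩
  rw [h2, Finset.sum_mul]
  refine (Finset.abs_sum_le_sum_abs _ _).trans (Finset.sum_le_sum fun z _ => ?_)
  rw [← integral_congr_ae (hae z), mul_comm]
  exact abs_integral_mul_le hL (hηL z)

/-! ### Averages in one coordinate -/

/-- The average in the `i`-th coordinate. -/
def avg (i : Fin 3) (f : Pt → ℝ) (p : Pt) : ℝ := ∫ s, f (repl i p s) ∂lam

lemma avg_eq_kop (i : Fin 3) (f : Pt → ℝ) : avg i f = kop (fun _ _ => 1) i f := by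
  ext p; simp [avg, kop]

lemma memLp_avg (i : Fin 3) {f : Pt → ℝ} (hf : MemLp f 2 nu) : MemLp (avg i f) 2 nu := by
  rw [avg_eq_kop]
  exact (kop_bound (C := 1) measurable_const (fun _ _ => by simp) i hf).1

lemma repl_repl (i : Fin 3) (p : Pt) (s t : ℝ) : repl i (repl i p s) t = repl i p t := by
  fin_cases i <;> rfl

lemma avg_repl (i : Fin 3) (f : Pt → ℝ) (p : Pt) (s : ℝ) : avg i f (repl i p s) = avg i f p := by
  simp only [avg, repl_repl]

lemma integral_mul_avg (i : Fin 3) {f k : Pt → ℝ} (hf : MemLp f 2 nu) (hk : MemLp k 2 nu)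
    (h : ∀ p s, k (repl i p s) = k p) : ∫ p, f p * k p ∂nu = ∫ p, avg i f p * k p ∂nu := by
  rw [← integral_comp_repl i (MemLp.integrable_mul_nu hf hk)]
  simp only [h, integral_mul_const, avg]

/-! ### A partition of unity and derivatives in the periodic directions. -/

/-- A smooth function supported in `[-1, 1]` whose integer translates add up to one. -/
def pou (y : ℝ) : ℝ := Real.smoothTransition (y + 1) - Real.smoothTransition y

lemma contDiff_pou : ContDiff ℝ ∞ pou :=
  (Real.smoothTransition.contDiff.comp (contDiff_id.add contDiff_const)).sub
    Real.smoothTransition.contDiff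

lemma pou_eq_zero {y : ℝ} (hy : 1 ≤ |y|) : pou y = 0 := by
  rcases le_abs.1 hy with h | h
  · rw [pou, Real.smoothTransition.one_of_one_le h, Real.smoothTransition.one_of_one_le (by linarith),
      sub_self]
  · rw [pou, Real.smoothTransition.zero_of_nonpos (by linarith),
      Real.smoothTransition.zero_of_nonpos (by linarith), sub_self]

lemma hasCompactSupport_pou : HasCompactSupport pou :=
  HasCompactSupport.intro (isCompact_Icc (a := (-1 : ℝ)) (b := 1)) fun y hy => pou_eq_zero (by
    by_contra h
    exact hy (abs_le.1 (not_le.1 h).le))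

lemma sum_pou {y : ℝ} (hy : y ∈ Ioo (-1 : ℝ) 1) : pou (y - 1) + pou y + pou (y + 1) = 1 := by
  have h1 : Real.smoothTransition (y + 1 + 1) = 1 :=
    Real.smoothTransition.one_of_one_le (by linarith [hy.1])
  have h2 : Real.smoothTransition (y - 1) = 0 :=
    Real.smoothTransition.zero_of_nonpos (by linarith [hy.2])
  simp only [pou, sub_add_cancel, h1, h2]; ring

lemma sum_deriv_pou {y : ℝ} (hy : y ∈ Ioo (-1 : ℝ) 1) :
    deriv pou (y - 1) + deriv pou y + deriv pou (y + 1) = 0 := by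
  have hd : Differentiable ℝ pou := contDiff_pou.differentiable (by simp)
  have h : HasDerivAt (fun y => pou (y - 1) + pou y + pou (y + 1))
      (deriv pou (y - 1) + deriv pou y + deriv pou (y + 1)) y :=
    (((hd (y - 1)).hasDerivAt.comp_sub_const y 1).add (hd y).hasDerivAt).add
      ((hd (y + 1)).hasDerivAt.comp_add_const y 1)
  have h1 : (fun y => pou (y - 1) + pou y + pou (y + 1)) =ᶠ[𝓝 y] fun _ => 1 := by
    filter_upwards [isOpen_Ioo.mem_nhds hy] with z hz using sum_pou hz
  exact h.unique ((hasDerivAt_const y (1 : ℝ)).congr_of_eventuallyEq h1)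

lemma cells_one : cells 1 = ({-1, 0, 1} : Finset ℤ) ×ˢ ({-1, 0, 1} : Finset ℤ) := rfl

/-- The in-plane factors vanish outside `(-1, 1)`, so only the nine cells around the origin
contribute; periodicity of `f` folds them onto the box. -/
lemma integral_Slab_tensor {f : Pt → ℝ} (hf : IsPeriodic f) (hL : MemLp f 2 nu)
    {b : Fin 3 → ℝ → ℝ} (hb : ∀ i, Continuous (b i)) (hc : ∀ i, HasCompactSupport (b i))
    (h2 : IsTest (b 2)) (h0 : ∀ i s, 1 ≤ |s| → b i s = 0) :
    ∫ p in Slab, f p * tensor b p = ∫ p, f p *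
      ((b 0 (p.2.1 - 1) + b 0 p.2.1 + b 0 (p.2.1 + 1))
      * (b 1 (p.2.2 - 1) + b 1 p.2.2 + b 1 (p.2.2 + 1)) * b 2 p.1) ∂nu := by
  have hcont : Continuous (tensor b) := by
    unfold tensor
    exact continuous_finsetProd _ fun i _ => (hb i).comp (contDiff_coord i (n := 0)).continuous
  obtain ⟨C, hC⟩ := (hasCompactSupport_tensor hc).exists_bound_of_continuous hcont
  have hηL : ∀ z, MemLp (fun p => tensor b (p + shv z)) 2 nu := fun z =>
    memLp_of_bdd (hcont.comp (continuous_id.add continuous_const)).aestronglyMeasurable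
      (C := C) fun p => hC _
  have hae : ∀ z, (fun p => f p * tensor b (p + shv z)) =ᵐ[nu]
      fun p => f (p + shv z) * tensor b (p + shv z) :=
    fun z => (hf.ae_nu z).mono fun p hp => by simp only [hp]
  have hI : ∀ z, Integrable (fun p => f p * tensor b (p + shv z)) nu := fun z =>
    MemLp.integrable_mul_nu hL (hηL z)
  rw [(integral_Slab_eq_sum (F := fun p => f p * tensor b p) (cells 1) (fun p hp => ?_)
    fun z _ => (hI z).congr (hae z)).2]
  · simp only [← integral_congr_ae (hae _)]
    rw [← integral_finsetSum _ fun z _ => hI z]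
    congr 1; ext p
    rw [cells_one, ← Finset.mul_sum, Finset.sum_product]
    simp [tensor, Fin.prod_univ_three, shv, ← sub_eq_add_neg]
    left; ring
  · by_cases hs : p.1 ∈ Ioo (-1 / 2 : ℝ) (1 / 2)
    · by_contra hne
      have h1 : ∀ i, |coord i p| ≤ 1 := fun i => by
        by_contra h
        exact hne (by rw [tensor_eq_zero i (h0 i _ (not_le.1 h).le), mul_zero])
      obtain ⟨z, hz, hpz⟩ := exists_mem_cell (N := 1) (p := p) ⟨hs, trivial⟩ (by simpa using h1 0)
        (by simpa using h1 1)
      exact hp z hz hpz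
    · rw [tensor_eq_zero 2 (h2.eq_zero hs), mul_zero]

lemma IsTest.eq_zero_of_one_le {φ : ℝ → ℝ} (h : IsTest φ) {s : ℝ} (hs : 1 / 2 ≤ |s|) : φ s = 0 :=
  h.eq_zero fun hs' => by
    rcases le_abs.1 hs with h | h <;> linarith [hs'.1, hs'.2]

lemma IsTest.sum_eq {φ : ℝ → ℝ} (h : IsTest φ) {s : ℝ} (hs : s ∈ Ioo (-1 / 2 : ℝ) (1 / 2)) :
    φ (s - 1) + φ s + φ (s + 1) = φ s := by
  rw [h.eq_zero fun h' => by linarith [h'.1, hs.2], h.eq_zero (s := s + 1) fun h' => by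
    linarith [h'.2, hs.1], zero_add, add_zero]

lemma ae_coord_mem (i : Fin 3) : ∀ᵐ p ∂nu, coord i p ∈ Ioo (-1 / 2 : ℝ) (1 / 2) :=
  (measurePreserving_coord i).quasiMeasurePreserving.ae (ae_restrict_mem measurableSet_Ioo)

/-- The `j`-th factor of the test function is taken to be `pou`. After folding onto the box it
becomes the constant one and its derivative becomes zero, so constants in a periodic direction are
admissible as test factors. -/
lemma integral_grad_mul_tensor_eq_zero {u : Pt → ℝ} {g : Fin 3 → Pt → ℝ} (h : MemH1 u g)
    {j : Fin 3} (hj : j ≠ 2) {a : Fin 3 → ℝ → ℝ} (ha : ∀ i, IsTest (a i)) :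
    ∫ p, g j p * tensor (Function.update a j fun _ => 1) p ∂nu = 0 := by
  have hupd : ∀ {P : (ℝ → ℝ) → Prop} {φ : ℝ → ℝ} (_ : ∀ i, P (a i)) (_ : P φ) i,
      P (Function.update a j φ i) := by
    intro P φ h1 h2 i
    by_cases hi : i = j
    · subst hi; simpa
    · simpa [hi] using h1 i
  have ha0 : ∀ i s, 1 ≤ |s| → a i s = 0 := fun i s hs => (ha i).eq_zero_of_one_le (by linarith)
  have hdp : Continuous (deriv pou) := contDiff_pou.continuous_deriv (by simp)
  -- The endpoints `±1` need an argument: the set where the derivative is nonzero is open and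
  -- contained in `[-1, 1]`, hence in the open interval.
  have hd0 : ∀ s, 1 ≤ |s| → deriv pou s = 0 := by
    intro s hs
    by_contra hne
    have h1 : tsupport pou ⊆ Icc (-1) 1 := closure_minimal (fun y hy => by
      by_contra h; exact hy (pou_eq_zero (by by_contra h'; exact h (abs_le.1 (not_le.1 h').le))))
      isClosed_Icc
    have h3 : IsOpen (Function.support (deriv pou)) := hdp.isOpen_support
    have h4 : Function.support (deriv pou) ⊆ Ioo (-1) 1 := by
      rw [← interior_Icc]
      exact h3.subset_interior_iff.2 (support_deriv_subset.trans h1)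
    have h5 := h4 hne
    exact absurd (abs_lt.2 h5) (not_lt.2 hs)
  have e := h.weakGrad.integral_tensor j (a := Function.update a j pou)
    (hupd (P := ContDiff ℝ ∞) (fun i => (ha i).contDiff) contDiff_pou)
    (hupd (P := HasCompactSupport) (fun i => (ha i).compact) hasCompactSupport_pou)
    (by rw [Function.update_of_ne hj.symm]; exact ha 2)
  rw [Function.update_self, Function.update_idem] at e
  rw [integral_Slab_tensor h.periodic h.isBoxGrad.memLp
      (hupd (P := Continuous) (fun i => (ha i).contDiff.continuous) hdp)
      (hupd (P := HasCompactSupport) (fun i => (ha i).compact) hasCompactSupport_pou.deriv)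
      (by rw [Function.update_of_ne hj.symm]; exact ha 2)
      (hupd (P := fun φ => ∀ s, 1 ≤ |s| → φ s = 0) ha0 hd0),
    integral_Slab_tensor (h.periodic_grad j) (h.isBoxGrad.memLp_grad j)
      (hupd (P := Continuous) (fun i => (ha i).contDiff.continuous) contDiff_pou.continuous)
      (hupd (P := HasCompactSupport) (fun i => (ha i).compact) hasCompactSupport_pou)
      (by rw [Function.update_of_ne hj.symm]; exact ha 2)
      (hupd (P := fun φ => ∀ s, 1 ≤ |s| → φ s = 0) ha0 fun s => pou_eq_zero)] at e
  have hmem : ∀ {s : ℝ}, s ∈ Ioo (-1 / 2 : ℝ) (1 / 2) → s ∈ Ioo (-1 : ℝ) 1 := fun hs =>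
    ⟨by linarith [hs.1], by linarith [hs.2]⟩
  rw [eq_comm, neg_eq_iff_eq_neg] at e
  refine Eq.trans ?_ (e.trans ?_)
  · refine integral_congr_ae ?_
    filter_upwards [ae_coord_mem 0, ae_coord_mem 1] with p h1 h2
    simp only [coord_zero, coord_one] at h1 h2
    fin_cases j
    · simp [tensor, Fin.prod_univ_three, sum_pou (hmem h1), (ha 1).sum_eq h2]
    · simp [tensor, Fin.prod_univ_three, sum_pou (hmem h2), (ha 0).sum_eq h1]
    · exact absurd rfl hj
  · rw [neg_eq_zero]
    refine (integral_congr_ae ?_).trans (integral_zero _ _)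
    filter_upwards [ae_coord_mem 0, ae_coord_mem 1] with p h1 h2
    simp only [coord_zero, coord_one] at h1 h2
    fin_cases j
    · simp [sum_deriv_pou (hmem h1)]
    · simp [sum_deriv_pou (hmem h2)]
    · exact absurd rfl hj

lemma avg_tensor (i : Fin 3) (a : Fin 3 → ℝ → ℝ) (p : Pt) :
    avg i (tensor a) p = (∫ s, a i s ∂lam) * tensor (Function.update a i fun _ => 1) p := by
  rw [avg_eq_kop, kop_tensor, tensor_update, tensor_update]
  simp

/-- The average in a periodic direction of the corresponding partial derivative vanishes. -/
lemma MemH1.avg_grad_eq_zero {u : Pt → ℝ} {g : Fin 3 → Pt → ℝ} (h : MemH1 u g) {j : Fin 3}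
    (hj : j ≠ 2) : avg j (g j) =ᵐ[nu] 0 := by
  have hg := h.isBoxGrad.memLp_grad j
  refine ae_eq_zero_of_integral_tensor (MemLp.integrable_nu (memLp_avg j hg)) fun a ha => ?_
  have hT := testSpan_memLp (tensor_mem ha)
  have h1 := integral_mul_avg j hT (memLp_avg j hg) (avg_repl j (g j))
  have h2 := integral_mul_avg j hg (memLp_avg j hT) (avg_repl j (tensor a))
  have h3 : ∫ p, g j p * avg j (tensor a) p ∂nu = 0 := by
    simp only [avg_tensor, mul_left_comm _ (∫ s, a j s ∂lam), integral_const_mul,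
      integral_grad_mul_tensor_eq_zero h hj ha, mul_zero]
  simp only [mul_comm (avg j (g j) _)]
  rw [h1, ← h3, h2]
  simp only [mul_comm]

/-- As `k` does not depend on the coordinate `j`, only the average of the partial derivative in that
coordinate enters. -/
lemma MemH1.integral_mul_grad_eq_zero {u : Pt → ℝ} {g : Fin 3 → Pt → ℝ} (h : MemH1 u g) {j : Fin 3}
    (hj : j ≠ 2) {k : Pt → ℝ} (hk : MemLp k 2 nu) (hkj : ∀ p s, k (repl j p s) = k p) :
    ∫ p, k p * g j p ∂nu = 0 := by
  simp only [mul_comm (k _)]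
  rw [integral_mul_avg j (h.isBoxGrad.memLp_grad j) hk hkj]
  refine (integral_congr_ae ((h.avg_grad_eq_zero hj).mono fun p hp => ?_)).trans (integral_zero _ _)
  simp [hp]

/-! ### Operations on Sobolev functions -/

lemma MemH1.mk' {u : Pt → ℝ} {g : Fin 3 → Pt → ℝ} (hu : IsPeriodic u) (hg : ∀ i, IsPeriodic (g i))
    (hL : MemLp u 2 nu) (hgL : ∀ i, MemLp (g i) 2 nu)
    (h : ∀ i, ∀ η : Pt → ℝ, ContDiff ℝ ∞ η → HasCompactSupport η → tsupport η ⊆ Slab →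
      ∫ p in Slab, u p * fderiv ℝ η p (dir i) = - ∫ p in Slab, g i p * η p) : MemH1 u g :=
  ⟨⟨hu.locallyIntegrableOn (MemLp.integrable_nu hL),
    fun i => (hg i).locallyIntegrableOn (MemLp.integrable_nu (hgL i)), h⟩, hu,
    restrict_Box ▸ hL, fun i => restrict_Box ▸ hgL i⟩

lemma test_fderiv {η : Pt → ℝ} (hη : ContDiff ℝ ∞ η) (hc : HasCompactSupport η)
    (hs : tsupport η ⊆ Slab) (v : Pt) : Continuous (fun p => fderiv ℝ η p v) ∧
      HasCompactSupport (fun p => fderiv ℝ η p v) ∧ tsupport (fun p => fderiv ℝ η p v) ⊆ Slab :=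
  ⟨(hη.continuous_fderiv (by simp)).clm_apply continuous_const, hc.fderiv_apply ℝ v,
    (tsupport_fderiv_apply_subset ℝ v).trans hs⟩

lemma integrableOn_Slab_mul {f η : Pt → ℝ} (hf : IsPeriodic f) (hL : MemLp f 2 nu)
    (hη : Continuous η) (hc : HasCompactSupport η) (hs : tsupport η ⊆ Slab) :
    IntegrableOn (fun p => f p * η p) Slab := by
  obtain ⟨K, hK⟩ := exists_bound_integral_Slab hη hc hs
  exact (hK f hf hL).1

lemma MemH1.memLp_nu {u : Pt → ℝ} {g : Fin 3 → Pt → ℝ} (h : MemH1 u g) : MemLp u 2 nu :=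
  h.isBoxGrad.memLp

lemma MemH1.memLp_grad_nu {u : Pt → ℝ} {g : Fin 3 → Pt → ℝ} (h : MemH1 u g) (i : Fin 3) :
    MemLp (g i) 2 nu := h.isBoxGrad.memLp_grad i

lemma MemH1.add {u v : Pt → ℝ} {g k : Fin 3 → Pt → ℝ} (h : MemH1 u g) (h' : MemH1 v k) :
    MemH1 (fun p => u p + v p) fun i p => g i p + k i p := by
  refine MemH1.mk' (h.periodic.comp₂ h'.periodic (· + ·))
    (fun i => (h.periodic_grad i).comp₂ (h'.periodic_grad i) (· + ·)) (h.memLp_nu.add h'.memLp_nu)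
    (fun i => (h.memLp_grad_nu i).add (h'.memLp_grad_nu i)) fun i η hη hc hs => ?_
  obtain ⟨d1, d2, d3⟩ := test_fderiv hη hc hs (dir i)
  simp only [add_mul]
  rw [integral_add (integrableOn_Slab_mul h.periodic h.memLp_nu d1 d2 d3)
    (integrableOn_Slab_mul h'.periodic h'.memLp_nu d1 d2 d3),
    integral_add (integrableOn_Slab_mul (h.periodic_grad i) (h.memLp_grad_nu i) hη.continuous hc hs)
    (integrableOn_Slab_mul (h'.periodic_grad i) (h'.memLp_grad_nu i) hη.continuous hc hs),
    h.weakGrad.integral_eq i η hη hc hs, h'.weakGrad.integral_eq i η hη hc hs]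
  ring

lemma MemH1.const_mul {u : Pt → ℝ} {g : Fin 3 → Pt → ℝ} (h : MemH1 u g) (c : ℝ) :
    MemH1 (fun p => c * u p) fun i p => c * g i p := by
  refine MemH1.mk' (h.periodic.comp₂ h.periodic fun x _ => c * x)
    (fun i => (h.periodic_grad i).comp₂ (h.periodic_grad i) fun x _ => c * x)
    (h.memLp_nu.const_mul c) (fun i => (h.memLp_grad_nu i).const_mul c) fun i η hη hc hs => ?_
  simp only [mul_assoc, integral_const_mul]
  rw [h.weakGrad.integral_eq i η hη hc hs, mul_neg]

lemma MemH1.sub {u v : Pt → ℝ} {g k : Fin 3 → Pt → ℝ} (h : MemH1 u g) (h' : MemH1 v k) :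
    MemH1 (fun p => u p - v p) fun i p => g i p - k i p := by
  have := h.add (h'.const_mul (-1))
  simpa only [neg_one_mul, ← sub_eq_add_neg] using this

lemma memH1_const (c : ℝ) : MemH1 (fun _ => c) fun _ _ => 0 := by
  have hp : ∀ c : ℝ, IsPeriodic fun _ : Pt => c := fun c k l => Eventually.of_forall fun _ => rfl
  refine MemH1.mk' (hp c) (fun _ => hp 0) (memLp_const c) (fun _ => memLp_const 0)
    fun i η hη hc hs => ?_
  obtain ⟨d1, d2, d3⟩ := test_fderiv hη hc hs (dir i)
  have hd : Differentiable ℝ η := hη.differentiable (by simp)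
  rw [setIntegral_eq_integral_of_forall_compl_eq_zero fun p hp => by
    rw [image_eq_zero_of_notMem_tsupport fun h => hp (d3 h), mul_zero]]
  have := integral_mul_fderiv_eq_neg_fderiv_mul_of_integrable (μ := (volume : Measure Pt)) (𝕜 := ℝ)
    (f := fun _ => c) (g := η) (v := dir i) (by simp)
    ((d1.integrable_of_hasCompactSupport d2).const_mul c)
    ((hη.continuous.integrable_of_hasCompactSupport hc).const_mul c)
    (fun _ _ => differentiableAt_const c) (fun p _ => hd p)
  rw [this]
  simp

/-- Both sides of the integration by parts formula are continuous in `L²(□)` on periodic functions.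
-/
lemma memH1_of_tendsto {u : ℕ → Pt → ℝ} {g : ℕ → Fin 3 → Pt → ℝ} (h : ∀ n, MemH1 (u n) (g n))
    {U : Pt → ℝ} {G : Fin 3 → Pt → ℝ} (hU : IsPeriodic U) (hG : ∀ i, IsPeriodic (G i))
    (hUL : MemLp U 2 nu) (hGL : ∀ i, MemLp (G i) 2 nu)
    (tu : Tendsto (fun n => nrm fun p => u n p - U p) atTop (𝓝 0))
    (tg : ∀ i, Tendsto (fun n => nrm fun p => g n i p - G i p) atTop (𝓝 0)) : MemH1 U G := by
  refine MemH1.mk' hU hG hUL hGL fun i η hη hc hs => ?_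
  have key : ∀ {f : ℕ → Pt → ℝ} {F η : Pt → ℝ}, (∀ n, IsPeriodic (f n)) → IsPeriodic F →
      (∀ n, MemLp (f n) 2 nu) → MemLp F 2 nu →
      Tendsto (fun n => nrm fun p => f n p - F p) atTop (𝓝 0) → Continuous η →
      HasCompactSupport η → tsupport η ⊆ Slab →
      Tendsto (fun n => ∫ p in Slab, f n p * η p) atTop (𝓝 (∫ p in Slab, F p * η p)) := by
    intro f F η hf hF hfL hFL ht hη hc hs
    obtain ⟨K, hK⟩ := exists_bound_integral_Slab hη hc hs
    rw [tendsto_iff_dist_tendsto_zero]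
    refine squeeze_zero (fun _ => dist_nonneg) (fun n => ?_) (by simpa using ht.const_mul K)
    have := (hK _ ((hf n).comp₂ hF (· - ·)) ((hfL n).sub hFL)).2
    simp only [sub_mul] at this
    rw [integral_sub (integrableOn_Slab_mul (hf n) (hfL n) hη hc hs)
      (integrableOn_Slab_mul hF hFL hη hc hs)] at this
    exact this
  obtain ⟨d1, d2, d3⟩ := test_fderiv hη hc hs (dir i)
  have t1 := key (fun n => (h n).periodic) hU (fun n => (h n).memLp_nu) hUL tu d1 d2 d3
  have t2 := key (fun n => (h n).periodic_grad i) (hG i) (fun n => (h n).memLp_grad_nu i) (hGL i)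
    (tg i) hη.continuous hc hs
  simp only [(h _).weakGrad.integral_eq i η hη hc hs] at t1
  exact tendsto_nhds_unique t1 t2.neg

/-! ### Reduction to the period cell -/

/-- The representative modulo `1` in `[-1/2, 1/2)`. -/
def red (y : ℝ) : ℝ := y - ⌊y + 1 / 2⌋

lemma measurable_red : Measurable red :=
  measurable_id.sub ((measurable_from_top (f := fun n : ℤ => (n : ℝ))).comp
    (Int.measurable_floor.comp (measurable_id.add_const _)))

lemma red_add_int (y : ℝ) (k : ℤ) : red (y + k) = red y := by
  have : y + k + 1 / 2 = y + 1 / 2 + k := by ring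
  rw [red, red, this, Int.floor_add_intCast]; push_cast; ring

lemma red_eq {y : ℝ} (hy : y ∈ Ico (-1 / 2 : ℝ) (1 / 2)) : red y = y := by
  have : ⌊y + 1 / 2⌋ = 0 := by
    rw [Int.floor_eq_iff]; push_cast; constructor <;> linarith [hy.1, hy.2]
  rw [red, this, Int.cast_zero, sub_zero]

/-- The `y`-periodic extension of the restriction of a function to the box. -/
def ext (f : Pt → ℝ) (p : Pt) : ℝ := f (p.1, red p.2.1, red p.2.2)

lemma isPeriodic_ext (f : Pt → ℝ) : IsPeriodic (ext f) := fun k l =>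
  Eventually.of_forall fun p => by simp only [ext, red_add_int]

lemma ext_ae_eq (f : Pt → ℝ) : ext f =ᵐ[nu] f := by
  have hI : ∀ {s : ℝ}, s ∈ Ioo (-1 / 2 : ℝ) (1 / 2) → s ∈ Ico (-1 / 2 : ℝ) (1 / 2) := fun hs =>
    ⟨hs.1.le, hs.2⟩
  filter_upwards [ae_coord_mem 0, ae_coord_mem 1] with p h1 h2
  simp only [coord_zero, coord_one] at h1 h2
  simp only [ext, red_eq (hI h1), red_eq (hI h2)]

/-! ### Translations in `y₂` -/

/-- The preimage of a set under `red` is invariant under integer translations, so it has the same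
measure in every fundamental domain; two intervals of length one that differ by the shift `τ` are
compared. -/
lemma measurePreserving_red_add (τ : ℝ) : MeasurePreserving (fun y => red (y + τ)) lam lam := by
  have hm : Measurable fun y => red (y + τ) := measurable_red.comp (measurable_id.add_const τ)
  refine ⟨hm, Measure.ext fun S hS => ?_⟩
  have hA : MeasurableSet (red ⁻¹' S) := measurable_red hS
  have hlam : lam = volume.restrict (Ioc (-1 / 2 : ℝ) (-1 / 2 + 1)) := by
    rw [lam, Measure.restrict_congr_set Ioo_ae_eq_Ioc]; norm_num
  have hlam' : lam S = volume (red ⁻¹' S ∩ Ioc (-1 / 2 : ℝ) (-1 / 2 + 1)) := by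
    rw [← Measure.restrict_apply hA, ← hlam, lam, Measure.restrict_apply hA,
      Measure.restrict_apply hS]
    congr 1; ext y
    simp only [mem_inter_iff, mem_preimage, and_congr_left_iff]
    intro hy
    rw [red_eq ⟨hy.1.le, hy.2⟩]
  have hdom := fun t : ℝ => isAddFundamentalDomain_Ioc (zero_lt_one' ℝ) t (μ := volume)
  have hinv : ∀ g : AddSubgroup.zmultiples (1 : ℝ), (fun x => g +ᵥ x) ⁻¹' (red ⁻¹' S) = red ⁻¹' S := by
    rintro ⟨_, k, rfl⟩
    ext y
    simp only [mem_preimage, AddSubgroup.vadd_def, vadd_eq_add, zsmul_eq_mul, mul_one]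
    rw [add_comm, red_add_int]
  rw [Measure.map_apply hm hS, hlam', (hdom (-1 / 2)).measure_set_eq (hdom (-1 / 2 + τ)) hA hinv,
    hlam, Measure.restrict_apply (hm hS)]
  rw [← measure_preimage_add_right volume τ (red ⁻¹' S ∩ _)]
  congr 1; ext y
  simp only [mem_inter_iff, mem_preimage, mem_Ioc]
  constructor <;> rintro ⟨h1, h2, h3⟩ <;> exact ⟨h1, by linarith, by linarith⟩

/-- Translation by `τ` in the direction `y₂`, modulo the period. -/
def rot (τ : ℝ) (p : Pt) : Pt := (p.1, p.2.1, red (p.2.2 + τ))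

lemma measurePreserving_rot (τ : ℝ) : MeasurePreserving (rot τ) nu nu :=
  (MeasurePreserving.id lam).prod ((MeasurePreserving.id lam).prod (measurePreserving_red_add τ))

lemma measurePreserving_rot_prod :
    MeasurePreserving (fun z : ℝ × Pt => rot z.1 z.2) (lam.prod nu) nu := by
  have hm : Measurable (Function.uncurry rot) := by
    refine (measurable_fst.comp measurable_snd).prodMk
      ((measurable_fst.comp (measurable_snd.comp measurable_snd)).prodMk ?_)
    exact measurable_red.comp
      ((measurable_snd.comp (measurable_snd.comp measurable_snd)).add measurable_fst)
  exact measurePreserving_snd.comp ((MeasurePreserving.id lam).skew_product (g := rot) hm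
    (Eventually.of_forall fun τ => (measurePreserving_rot τ).map_eq))

/-- The vector `τ e₂`. -/
def tv (τ : ℝ) : Pt := (0, 0, τ)

lemma IsPeriodic.comp_tv_ae_eq {f : Pt → ℝ} (hf : IsPeriodic f) (τ : ℝ) :
    ∀ᵐ p ∂nu, f (p + tv τ) = f (rot τ p) := by
  have h := isPeriodic_iff.1 (hf.comp_add (v := tv τ) rfl)
  -- The lattice vector that carries `p + tv τ` to `rot τ p` depends on `p`, so periodicity is
  -- needed for all lattice vectors outside one common null set.
  have hall : ∀ᵐ p ∂(volume.restrict Slab), ∀ z, f (p + shv z + tv τ) = f (p + tv τ) :=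
    ae_all_iff.2 h
  filter_upwards [ae_nu_of_ae_Slab hall] with p hp
  rw [← hp (0, -⌊p.2.2 + τ + 1 / 2⌋)]
  congr 1
  simp only [shv, tv, rot, red, Prod.ext_iff, Prod.fst_add, Prod.snd_add]
  push_cast
  refine ⟨by ring, by ring, by ring⟩

lemma integral_comp_tv {f : Pt → ℝ} (hf : IsPeriodic f) (hi : AEStronglyMeasurable f nu) (τ : ℝ) :
    ∫ p, f (p + tv τ) ∂nu = ∫ p, f p ∂nu := by
  rw [integral_congr_ae (hf.comp_tv_ae_eq τ)]
  have h := measurePreserving_rot τ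
  conv_rhs => rw [← h.map_eq]
  rw [integral_map h.measurable.aemeasurable (by rw [h.map_eq]; exact hi)]

lemma memLp_comp_tv {f : Pt → ℝ} (hf : IsPeriodic f) (hL : MemLp f 2 nu) (τ : ℝ) :
    MemLp (fun p => f (p + tv τ)) 2 nu :=
  (hL.comp_measurePreserving (measurePreserving_rot τ)).ae_eq
    ((hf.comp_tv_ae_eq τ).mono fun _ hp => hp.symm)

lemma MemH1.comp_tv {u : Pt → ℝ} {g : Fin 3 → Pt → ℝ} (h : MemH1 u g) (τ : ℝ) :
    MemH1 (fun p => u (p + tv τ)) fun i p => g i (p + tv τ) :=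
  ⟨h.weakGrad.comp_add rfl, h.periodic.comp_add rfl,
    restrict_Box ▸ memLp_comp_tv h.periodic h.memLp_nu τ,
    fun i => restrict_Box ▸ memLp_comp_tv (h.periodic_grad i) (h.memLp_grad_nu i) τ⟩

/-- A field that is invariant under translations in `y₂` is orthogonal to `∂_{y₂} u`. -/
lemma MemH1.integral_mul_grad_one_eq_zero {u : Pt → ℝ} {g : Fin 3 → Pt → ℝ} (h : MemH1 u g)
    {a : Pt → ℝ} (ha : IsPeriodic a) (haL : MemLp a 2 nu)
    (hinv : ∀ τ, ∀ᵐ p ∂nu, a (p + tv τ) = a p) : ∫ p, a p * g 1 p ∂nu = 0 := by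
  have hg := h.memLp_grad_nu 1
  have hp := h.periodic_grad 1
  -- The integral does not change when `∂_{y₂}u` alone is translated. Averaging over `τ` replaces
  -- this derivative by its average in `y₂`, which is zero.
  have h1 : ∀ τ, ∫ p, a p * g 1 (rot τ p) ∂nu = ∫ p, a p * g 1 p ∂nu := by
    intro τ
    rw [← integral_comp_tv (ha.comp₂ hp (· * ·)) (haL.1.mul hg.1) τ]
    refine integral_congr_ae ?_
    filter_upwards [hinv τ, hp.comp_tv_ae_eq τ] with p e1 e2
    simp only [e1, e2]
  have hI : Integrable (fun z : ℝ × Pt => a z.2 * g 1 (rot z.1 z.2)) (lam.prod nu) :=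
    MemLp.integrable_mul (haL.comp_measurePreserving measurePreserving_snd)
      (hg.comp_measurePreserving measurePreserving_rot_prod)
  have h2 : ∫ τ, ∫ p, a p * g 1 (rot τ p) ∂nu ∂lam = ∫ p, a p * g 1 p ∂nu := by
    simp only [h1, integral_const]; simp
  rw [← h2, integral_integral_swap hI]
  refine (integral_congr_ae ?_).trans (integral_zero _ _)
  filter_upwards [h.avg_grad_eq_zero (j := 1) (by decide), (memLp_comp_repl 1 hg).1.prodMk_left]
    with p e1 e2
  rw [integral_const_mul]
  have : ∫ τ, g 1 (rot τ p) ∂lam = avg 1 (g 1) p := by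
    have hr := measurePreserving_red_add p.2.2
    unfold avg
    conv_rhs => rw [← hr.map_eq]
    rw [integral_map hr.measurable.aemeasurable (by rw [hr.map_eq]; exact e2)]
    simp only [rot, repl_one, add_comm]
  rw [this, e1]; simp

/-! ### The shear problem -/

/-- A measurable, one-periodic function with values between the positive numbers `a ≤ b`. -/
structure IsModulus (a b : ℝ) (μ : ℝ → ℝ) : Prop where
  pos : 0 < a
  measurable : Measurable μ
  lower : ∀ t, a ≤ μ t
  upper : ∀ t, μ t ≤ b
  periodic : ∀ t, μ (t + 1) = μ t

lemma IsModulus.mu_pos {a b : ℝ} {μ : ℝ → ℝ} (h : IsModulus a b μ) (t : ℝ) : 0 < μ t :=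
  h.pos.trans_le (h.lower t)

lemma IsModulus.measurable_y {a b : ℝ} {μ : ℝ → ℝ} (h : IsModulus a b μ) :
    Measurable fun p : Pt => μ p.2.1 := h.measurable.comp (measurable_coord 0)

lemma IsModulus.memLp_mul {a b : ℝ} {μ : ℝ → ℝ} (h : IsModulus a b μ) {f : Pt → ℝ}
    (hf : MemLp f 2 nu) : MemLp (fun p => μ p.2.1 * f p) 2 nu := by
  refine MemLp.of_le_mul hf (h.measurable_y.aestronglyMeasurable.mul hf.1) (c := b)
    (Eventually.of_forall fun p => ?_)
  rw [norm_mul, Real.norm_of_nonneg (h.mu_pos _).le]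
  exact mul_le_mul_of_nonneg_right (h.upper _) (norm_nonneg _)

lemma IsModulus.isPeriodic {a b : ℝ} {μ : ℝ → ℝ} (h : IsModulus a b μ) :
    IsPeriodic fun p : Pt => μ p.2.1 := fun k l => Eventually.of_forall fun p => by
  have : Function.Periodic μ 1 := h.periodic
  simpa using this.int_mul k p.2.1

lemma nrm_le_of_ae {f g : Pt → ℝ} {c : ℝ} (hc : 0 ≤ c) (hf : MemLp f 2 nu) (hg : MemLp g 2 nu)
    (h : ∀ᵐ p ∂nu, |f p| ≤ c * |g p|) : nrm f ≤ c * nrm g := by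
  refine abs_le_of_sq_le_sq' ?_ (mul_nonneg hc (nrm_nonneg g)) |>.2
  rw [mul_pow, nrm_sq, nrm_sq, ← integral_const_mul]
  refine integral_mono_ae hf.integrable_sq (hg.integrable_sq.const_mul _) (h.mono fun p hp => ?_)
  have := pow_le_pow_left₀ (abs_nonneg _) hp 2
  rwa [mul_pow, sq_abs, sq_abs] at this

lemma integral_tensor_bump : ∫ p, tensor (fun _ => bump) p ∂nu = 1 := by
  have : ∀ p : Pt, tensor (fun _ => bump) p = bump p.1 * (bump p.2.1 * bump p.2.2) := fun p => by
    simp [tensor, Fin.prod_univ_three]; ring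
  simp only [this, nu]
  rw [integral_prod_mul bump (fun q : ℝ × ℝ => bump q.1 * bump q.2), integral_prod_mul bump bump]
  simp [integral_bump]

lemma MemH1.sub_const {u : Pt → ℝ} {g : Fin 3 → Pt → ℝ} (h : MemH1 u g) (c : ℝ) :
    MemH1 (fun p => u p - c) g := by
  have := h.sub (memH1_const c)
  simpa using this

/-- The weights in the energy of the shear problem. -/
def wt (μ : ℝ → ℝ) (γ : ℝ) (i : Fin 3) (p : Pt) : ℝ := Real.sqrt (μ p.2.1) * ![1, 1, γ⁻¹] i

lemma IsModulus.wt_bounds {a b : ℝ} {μ : ℝ → ℝ} (h : IsModulus a b μ) {γ : ℝ} (hγ : 0 < γ) :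
    (∀ i, Measurable (wt μ γ i)) ∧ (∀ i p, 0 < wt μ γ i p) ∧
      ∃ l u, 0 < l ∧ 0 ≤ u ∧ ∀ i p, l ≤ wt μ γ i p ∧ wt μ γ i p ≤ u := by
  have hg : 0 < γ⁻¹ := inv_pos.2 hγ
  have hpos : ∀ i p, 0 < wt μ γ i p := fun i p =>
    mul_pos (Real.sqrt_pos.2 (h.mu_pos _)) (by fin_cases i <;> simp [hγ])
  refine ⟨fun i => (h.measurable_y.sqrt).mul_const _, hpos, Real.sqrt a * min 1 γ⁻¹,
    Real.sqrt b * max 1 γ⁻¹, mul_pos (Real.sqrt_pos.2 h.pos) (lt_min one_pos hg), by positivity,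
    fun i p => ⟨?_, ?_⟩⟩
  · refine mul_le_mul (Real.sqrt_le_sqrt (h.lower _)) ?_ (by positivity) (by positivity)
    fin_cases i <;> simp
  · refine mul_le_mul (Real.sqrt_le_sqrt (h.upper _)) ?_ ?_ (by positivity)
    · fin_cases i <;> simp
    · fin_cases i <;> simp [hγ.le]

/-- The weighted gradients of Sobolev functions. -/
def gradSpace (μ : ℝ → ℝ) (γ : ℝ) : Submodule ℝ (PiLp 2 fun _ : Fin 3 => Lp ℝ 2 nu) where
  carrier := {V | ∃ u g, MemH1 u g ∧ ∀ i, V i =ᵐ[nu] fun p => wt μ γ i p * g i p}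
  add_mem' := by
    rintro V W ⟨u, g, h, hV⟩ ⟨v, k, h', hW⟩
    refine ⟨_, _, h.add h', fun i => ?_⟩
    filter_upwards [hV i, hW i, Lp.coeFn_add (V i) (W i)] with p h1 h2 h3
    rw [PiLp.add_apply, h3, Pi.add_apply, h1, h2]; ring
  zero_mem' := by
    refine ⟨_, _, memH1_const 0, fun i => ?_⟩
    filter_upwards [Lp.coeFn_zero ℝ 2 nu] with p h1
    rw [PiLp.zero_apply, h1]; simp
  smul_mem' := by
    rintro c V ⟨u, g, h, hV⟩
    refine ⟨_, _, h.const_mul c, fun i => ?_⟩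
    filter_upwards [hV i, Lp.coeFn_smul c (V i)] with p h1 h2
    rw [PiLp.smul_apply, h2, Pi.smul_apply, h1, smul_eq_mul]; ring

/-- Poincaré's inequality turns convergence of gradients into convergence of suitably normalized
functions, and `MemH1` is stable under `L²` limits. -/
lemma isClosed_gradSpace {a b : ℝ} {μ : ℝ → ℝ} (hμ : IsModulus a b μ) {γ : ℝ} (hγ : 0 < γ) :
    IsClosed (gradSpace μ γ : Set (PiLp 2 fun _ : Fin 3 => Lp ℝ 2 nu)) := by
  obtain ⟨wm, wpos, l, b', hl, hb', hw⟩ := hμ.wt_bounds hγ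
  refine IsSeqClosed.isClosed fun V V₀ hV hlim => ?_
  choose u₀ g h₀ hVg using hV
  set T := tensor fun _ => bump
  have hT : MemLp T 2 nu := testSpan_memLp (tensor_mem fun _ => isTest_bump)
  -- Subtracting constants leaves the gradients unchanged and achieves the normalization `∫ u T = 0`
  -- required by `exists_poincare`; it works because `∫ T = 1`.
  set u : ℕ → Pt → ℝ := fun n p => u₀ n p - ∫ q, u₀ n q * T q ∂nu with hu
  have h : ∀ n, MemH1 (u n) (g n) := fun n => (h₀ n).sub_const _
  have hmean : ∀ n, ∫ p, u n p * T p ∂nu = 0 := fun n => by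
    simp only [hu, sub_mul]
    rw [integral_sub (MemLp.integrable_mul_nu (h₀ n).memLp_nu hT)
      ((MemLp.integrable_nu hT).const_mul _), integral_const_mul, integral_tensor_bump, mul_one,
      sub_self]
  obtain ⟨C, hC, hP⟩ := exists_poincare
  have hcomp : ∀ (W : PiLp 2 fun _ : Fin 3 => Lp ℝ 2 nu) i, ‖W i‖ ≤ ‖W‖ := fun W i =>
    PiLp.norm_apply_le W i
  have hwt : ∀ {f F : Pt → ℝ} {i}, MemLp f 2 nu → MemLp F 2 nu →
      (∀ᵐ p ∂nu, F p = wt μ γ i p * f p) → nrm f ≤ l⁻¹ * nrm F := by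
    intro f F i hf hF he
    refine nrm_le_of_ae (inv_nonneg.2 hl.le) hf hF (he.mono fun p hp => ?_)
    rw [hp, abs_mul, abs_of_pos (wpos i p), ← mul_assoc]
    refine le_mul_of_one_le_left (abs_nonneg _) ?_
    rw [inv_mul_eq_div, one_le_div hl]
    exact (hw i p).1
  have hLp : ∀ F : Lp ℝ 2 nu, nrm F = ‖F‖ := fun F => by
    rw [nrm_eq_norm (Lp.memLp F), Lp.toLp_coeFn]
  have hgd : ∀ n m i, nrm (fun p => g n i p - g m i p) ≤ l⁻¹ * ‖V n - V m‖ := fun n m i => by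
    refine (hwt (((h n).memLp_grad_nu i).sub ((h m).memLp_grad_nu i)) (Lp.memLp (V n i - V m i))
      (i := i) ?_).trans ?_
    · filter_upwards [hVg n i, hVg m i, Lp.coeFn_sub (V n i) (V m i)] with p h1 h2 h3
      rw [h3, Pi.sub_apply, h1, h2, Pi.sub_apply, mul_sub]
    · rw [hLp]
      exact mul_le_mul_of_nonneg_left (hcomp (V n - V m) i) (inv_nonneg.2 hl.le)
  have hud : ∀ n m, nrm (fun p => u n p - u m p) ≤ C * (3 * l⁻¹) * ‖V n - V m‖ := fun n m => by
    have hd := (h n).sub (h m)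
    refine (hP hd.isBoxGrad ?_).trans ?_
    · have e := integral_sub (MemLp.integrable_mul_nu (h n).memLp_nu hT)
        (MemLp.integrable_mul_nu (h m).memLp_nu hT)
      rw [hmean, hmean, sub_zero] at e
      rw [← e]; congr 1; ext p; ring
    · rw [mul_assoc]
      refine mul_le_mul_of_nonneg_left ?_ hC
      linarith [hgd n m 0, hgd n m 1, hgd n m 2]
  set K := C * (3 * l⁻¹) with hK
  have hK0 : 0 ≤ K := by positivity
  have hcau : CauchySeq fun n => (h n).memLp_nu.toLp (u n) := by
    have hVc := hlim.cauchySeq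
    rw [Metric.cauchySeq_iff] at hVc ⊢
    intro ε hε
    obtain ⟨N, hN⟩ := hVc (ε / (K + 1)) (by positivity)
    refine ⟨N, fun m hm n hn => ?_⟩
    have h1 := hN m hm n hn
    rw [dist_eq_norm, ← MemLp.toLp_sub, ← nrm_eq_norm]
    rw [dist_eq_norm, lt_div_iff₀ (by positivity)] at h1
    refine lt_of_le_of_lt (hud m n) (lt_of_le_of_lt ?_ h1)
    nlinarith [norm_nonneg (V m - V n)]
  obtain ⟨U, hU⟩ := cauchySeq_tendsto_of_complete hcau
  set G : Fin 3 → Pt → ℝ := fun i p => (wt μ γ i p)⁻¹ * V₀ i p with hG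
  have hGL : ∀ i, MemLp (G i) 2 nu := fun i => by
    refine MemLp.of_le_mul (Lp.memLp (V₀ i)) (((wm i).inv).aestronglyMeasurable.mul
      (Lp.memLp (V₀ i)).1) (c := l⁻¹) (Eventually.of_forall fun p => ?_)
    rw [norm_mul, norm_inv, Real.norm_of_nonneg (wpos i p).le]
    exact mul_le_mul_of_nonneg_right (inv_anti₀ hl (hw i p).1) (norm_nonneg _)
  have hGw : ∀ i p, wt μ γ i p * G i p = V₀ i p := fun i p => by
    rw [hG]; simp only; rw [mul_inv_cancel_left₀ (wpos i p).ne']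
  -- The limits are determined only almost everywhere in the box, so they are extended periodically
  -- before `memH1_of_tendsto` applies.
  have hext : ∀ {f : Pt → ℝ}, MemLp f 2 nu → MemLp (ext f) 2 nu := fun hf =>
    hf.ae_eq (ext_ae_eq _).symm
  refine ⟨ext U, fun i => ext (G i), memH1_of_tendsto h (isPeriodic_ext _) (fun i => isPeriodic_ext _)
    (hext (Lp.memLp U)) (fun i => hext (hGL i)) ?_ fun i => ?_, fun i => ?_⟩
  · have h1 := tendsto_iff_norm_sub_tendsto_zero.1 hU
    refine h1.congr fun n => ?_
    rw [← hLp]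
    refine nrm_congr ?_
    filter_upwards [ext_ae_eq U, Lp.coeFn_sub ((h n).memLp_nu.toLp (u n)) U,
      (h n).memLp_nu.coeFn_toLp] with p e1 e2 e3
    rw [e1, e2, Pi.sub_apply, e3]
  · have h1 := tendsto_iff_norm_sub_tendsto_zero.1 hlim
    refine squeeze_zero (fun _ => nrm_nonneg _) (fun n => ?_) (by simpa using h1.const_mul l⁻¹)
    have e : nrm (fun p => g n i p - ext (G i) p) = nrm fun p => g n i p - G i p := by
      refine nrm_congr ?_
      filter_upwards [ext_ae_eq (G i)] with p hp
      rw [hp]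
    rw [e]
    refine (hwt (((h n).memLp_grad_nu i).sub (hGL i)) (Lp.memLp (V n i - V₀ i)) (i := i) ?_).trans ?_
    · filter_upwards [hVg n i, Lp.coeFn_sub (V n i) (V₀ i)] with p h1 h3
      rw [h3, Pi.sub_apply, h1, ← hGw, Pi.sub_apply, mul_sub]
    · rw [hLp]
      exact mul_le_mul_of_nonneg_left (hcomp (V n - V₀) i) (inv_nonneg.2 hl.le)
  · filter_upwards [ext_ae_eq (G i)] with p hp
    rw [hp, hGw]

lemma IsModulus.memLp_wt_mul {a b : ℝ} {μ : ℝ → ℝ} (hμ : IsModulus a b μ) {γ : ℝ} (hγ : 0 < γ)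
    (i : Fin 3) {f : Pt → ℝ} (hf : MemLp f 2 nu) : MemLp (fun p => wt μ γ i p * f p) 2 nu := by
  obtain ⟨wm, wpos, l, b', hl, hb', hw⟩ := hμ.wt_bounds hγ
  refine MemLp.of_le_mul hf ((wm i).aestronglyMeasurable.mul hf.1) (c := b')
    (Eventually.of_forall fun p => ?_)
  rw [norm_mul, Real.norm_of_nonneg (wpos i p).le]
  exact mul_le_mul_of_nonneg_right (hw i p).2 (norm_nonneg _)

lemma memLp_bdd_Slab {f : Pt → ℝ} (hf : Measurable f) {C : ℝ}
    (hC : ∀ p : Pt, |p.1| ≤ 1 / 2 → |f p| ≤ C) : MemLp f 2 nu := by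
  refine MemLp.of_bound hf.aestronglyMeasurable C ((ae_coord_mem 2).mono fun p hp => ?_)
  rw [coord_two] at hp
  exact hC p (abs_le.2 ⟨by linarith [hp.1], by linarith [hp.2]⟩)

lemma memLp_x3 : MemLp (fun p : Pt => p.1) 2 nu := memLp_bdd_Slab measurable_fst fun _ hp => hp

/-- Let `D` be the weighted field `√12 x₃` in the slot of `∂_{y₁}`. The projection of `-D` onto the
closed space of weighted gradients minimizes `‖D + W‖²`, and the orthogonality relation is the Euler
equation. The functional includes `(∂_{y₂}w)²`, and `w` is unconstrained. -/
lemma exists_full_minimizer {a b : ℝ} {μ : ℝ → ℝ} (hμ : IsModulus a b μ) {γ : ℝ} (hγ : 0 < γ) :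
    ∃ w g, MemH1 w g ∧ ∀ v k, MemH1 v k → ∫ p, μ p.2.1 * ((Real.sqrt 12 * p.1 + g 0 p) * k 0 p
      + g 1 p * k 1 p + γ⁻¹ ^ 2 * g 2 p * k 2 p) ∂nu = 0 := by
  have hcl := isClosed_gradSpace hμ hγ
  have : CompleteSpace (gradSpace μ γ) := hcl.completeSpace_coe
  have hx : MemLp (fun p : Pt => Real.sqrt 12 * p.1) 2 nu := memLp_x3.const_mul _
  set D : PiLp 2 fun _ : Fin 3 => Lp ℝ 2 nu :=
    WithLp.toLp 2 fun i => if i = 0 then (hμ.memLp_wt_mul hγ 0 hx).toLp _ else 0 with hD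
  obtain ⟨w, g, h, hW⟩ := (gradSpace μ γ).starProjection_apply_mem (-D)
  set W := (gradSpace μ γ).starProjection (-D) with hWd
  refine ⟨w, g, h, fun v k hv => ?_⟩
  set X : PiLp 2 fun _ : Fin 3 => Lp ℝ 2 nu :=
    WithLp.toLp 2 fun i => (hμ.memLp_wt_mul hγ i (hv.memLp_grad_nu i)).toLp _ with hX
  have hXm : X ∈ gradSpace μ γ := ⟨v, k, hv, fun i =>
    (hμ.memLp_wt_mul hγ i (hv.memLp_grad_nu i)).coeFn_toLp⟩
  have horth := (gradSpace μ γ).starProjection_inner_eq_zero (-D) X hXm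
  have e1 : inner ℝ (D + W) X = (0 : ℝ) := by
    have : -D - W = -(D + W) := by abel
    rw [← hWd, this, inner_neg_left, neg_eq_zero] at horth
    exact horth
  have hμs : ∀ t, Real.sqrt (μ t) * Real.sqrt (μ t) = μ t := fun t =>
    Real.mul_self_sqrt (hμ.mu_pos t).le
  have hi : ∀ i, ∃ F : Pt → ℝ, MemLp F 2 nu ∧ (D + W) i =ᵐ[nu] F ∧
      F = fun p => wt μ γ i p * ((if i = 0 then Real.sqrt 12 * p.1 else 0) + g i p) := by
    intro i
    refine ⟨_, hμ.memLp_wt_mul hγ i (MemLp.add ?_ (h.memLp_grad_nu i)), ?_, rfl⟩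
    · by_cases hi : i = 0
      · simpa [hi] using hx
      · simp [hi]
    · by_cases hi : i = 0
      · subst hi
        filter_upwards [hW 0, Lp.coeFn_add (D 0) (W 0),
          (hμ.memLp_wt_mul hγ 0 hx).coeFn_toLp] with p h1 h2 h3
        rw [PiLp.add_apply, h2, Pi.add_apply, h1]
        simp only [hD, if_true]
        rw [h3, Pi.add_apply, mul_add]
      · filter_upwards [hW i] with p h1
        rw [PiLp.add_apply]
        simp only [hD, hi, if_false, zero_add, h1, Pi.add_apply]
  rw [PiLp.inner_apply] at e1
  have e2 : ∀ i, inner ℝ ((D + W) i) (X i) = ∫ p, (wt μ γ i p *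
      ((if i = 0 then Real.sqrt 12 * p.1 else 0) + g i p)) * (wt μ γ i p * k i p) ∂nu := by
    intro i
    obtain ⟨F, hF, hFe, rfl⟩ := hi i
    rw [integral_mul_eq_inner hF (hμ.memLp_wt_mul hγ i (hv.memLp_grad_nu i))]
    congr 1
    exact Lp.ext (hFe.trans hF.coeFn_toLp.symm)
  simp only [e2] at e1
  rw [← integral_finsetSum] at e1
  · rw [← e1]
    congr 1; ext p
    simp only [Fin.sum_univ_three, wt, Matrix.cons_val]
    rw [← hμs p.2.1]
    simp
    ring
  · intro i _
    obtain ⟨F, hF, -, rfl⟩ := hi i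
    exact MemLp.integrable_mul_nu hF (hμ.memLp_wt_mul hγ i (hv.memLp_grad_nu i))

/-- The Euler–Lagrange equations of the shear problem, tested with arbitrary Sobolev functions. -/
structure IsShearSol (μ : ℝ → ℝ) (γ : ℝ) (w : Pt → ℝ) (g : Fin 3 → Pt → ℝ) : Prop where
  memH1 : MemH1 w g
  mean : ∫ p, w p ∂nu = 0
  grad_one : g 1 =ᵐ[nu] 0
  euler : ∀ v k, MemH1 v k → ∫ p, μ p.2.1 * ((Real.sqrt 12 * p.1 + g 0 p) * k 0 p
      + γ⁻¹ ^ 2 * g 2 p * k 2 p) ∂nu = 0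
  orth_zero : ∀ v k, MemH1 v k → ∫ p, μ p.2.1 * (Real.sqrt 12 * p.1 + g 0 p) * k 1 p ∂nu = 0
  orth_two : ∀ v k, MemH1 v k → ∫ p, μ p.2.1 * g 2 p * k 1 p ∂nu = 0

/-- Translates of the full minimizer in `y₂` solve the same equation, so its gradient is invariant
under these translations. Invariant fields are orthogonal to all derivatives in `y₂`; in particular
`∂_{y₂}w` is orthogonal to itself and vanishes. The Euler equation thereby holds for test functions
that may depend on `y₂`. -/
lemma exists_isShearSol {a b : ℝ} {μ : ℝ → ℝ} (hμ : IsModulus a b μ) {γ : ℝ} (hγ : 0 < γ) :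
    ∃ w g, IsShearSol μ γ w g := by
  obtain ⟨w, g, h, hEL⟩ := exists_full_minimizer hμ hγ
  have hx : MemLp (fun p : Pt => Real.sqrt 12 * p.1) 2 nu := memLp_x3.const_mul _
  have hxp : IsPeriodic fun p : Pt => Real.sqrt 12 * p.1 := fun k l => Eventually.of_forall fun _ => rfl
  have hI : ∀ {v k}, MemH1 v k → ∀ {f : Fin 3 → Pt → ℝ}, (∀ i, MemLp (f i) 2 nu) →
      Integrable (fun p => μ p.2.1 * ((Real.sqrt 12 * p.1 + f 0 p) * k 0 p
      + f 1 p * k 1 p + γ⁻¹ ^ 2 * f 2 p * k 2 p)) nu := by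
    intro v k hv f hf
    have i0 := MemLp.integrable_mul_nu (hμ.memLp_mul (hx.add (hf 0))) (hv.memLp_grad_nu 0)
    have i1 := MemLp.integrable_mul_nu (hμ.memLp_mul (hf 1)) (hv.memLp_grad_nu 1)
    have i2 := MemLp.integrable_mul_nu (hμ.memLp_mul ((hf 2).const_mul (γ⁻¹ ^ 2)))
      (hv.memLp_grad_nu 2)
    refine ((i0.add i1).add i2).congr (Eventually.of_forall fun p => ?_)
    simp only [Pi.add_apply]; ring
  have hinv : ∀ τ i, ∀ᵐ p ∂nu, g i (p + tv τ) = g i p := by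
    intro τ
    have hτ := h.comp_tv τ
    have hd := hτ.sub h
    -- The equation of the translate: test the equation of `w` with the difference shifted by `-τ`
    -- and translate the integral by `τ`. Neither `μ` nor `x₃` is affected.
    have e1 : ∫ p, μ p.2.1 * ((Real.sqrt 12 * p.1 + g 0 (p + tv τ)) * (g 0 (p + tv τ) - g 0 p)
        + g 1 (p + tv τ) * (g 1 (p + tv τ) - g 1 p)
        + γ⁻¹ ^ 2 * g 2 (p + tv τ) * (g 2 (p + tv τ) - g 2 p)) ∂nu = 0 := by
      have hd' := hd.comp_tv (-τ)
      have e := hEL _ _ hd'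
      have hm := (hI hd' h.memLp_grad_nu).1
      have htv : ∀ p : Pt, p + tv τ + tv (-τ) = p := fun p => by simp [tv, add_assoc]
      rw [← integral_comp_tv ?_ hm τ] at e
      · rw [← e]
        congr 1; ext p
        rw [htv p]
        simp [tv]
      · have pg := h.periodic_grad
        have pd := hd'.periodic_grad
        exact hμ.isPeriodic.comp₂ ((((hxp.comp₂ (pg 0) (· + ·)).comp₂ (pd 0) (· * ·)).comp₂
          ((pg 1).comp₂ (pd 1) (· * ·)) (· + ·)).comp₂
          ((pg 2).comp₂ (pd 2) fun x y => γ⁻¹ ^ 2 * x * y) (· + ·)) (· * ·)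
    have e2 := hEL _ _ hd
    have e3 : ∫ p, μ p.2.1 * ((g 0 (p + tv τ) - g 0 p) ^ 2 + (g 1 (p + tv τ) - g 1 p) ^ 2
        + γ⁻¹ ^ 2 * (g 2 (p + tv τ) - g 2 p) ^ 2) ∂nu = 0 := by
      have := integral_sub (hI hd hτ.memLp_grad_nu) (hI hd h.memLp_grad_nu)
      rw [e1, e2, sub_zero] at this
      rw [← this]; congr 1; ext p; ring
    have hnn : ∀ p : Pt, 0 ≤ μ p.2.1 * ((g 0 (p + tv τ) - g 0 p) ^ 2 + (g 1 (p + tv τ) - g 1 p) ^ 2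
        + γ⁻¹ ^ 2 * (g 2 (p + tv τ) - g 2 p) ^ 2) := fun p =>
      mul_nonneg (hμ.mu_pos _).le (by positivity)
    have hint := (hI hd hτ.memLp_grad_nu).sub (hI hd h.memLp_grad_nu)
    rw [integral_eq_zero_iff_of_nonneg hnn (hint.congr (Eventually.of_forall fun p => by
      simp only [Pi.sub_apply]; ring))] at e3
    have hγ2 : 0 < γ⁻¹ ^ 2 := by positivity
    intro i
    filter_upwards [e3] with p hp
    rw [Pi.zero_apply, mul_eq_zero, or_iff_right (hμ.mu_pos _).ne'] at hp
    have s0 := sq_nonneg (g 0 (p + tv τ) - g 0 p)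
    have s1 := sq_nonneg (g 1 (p + tv τ) - g 1 p)
    have s2 := sq_nonneg (g 2 (p + tv τ) - g 2 p)
    have s3 := mul_nonneg hγ2.le s2
    rw [← sub_eq_zero, ← sq_eq_zero_iff]
    fin_cases i
    · simp only [Fin.zero_eta]; linarith
    · simp only [Fin.mk_one]; linarith
    · simp only [Fin.reduceFinMk]
      have : γ⁻¹ ^ 2 * (g 2 (p + tv τ) - g 2 p) ^ 2 = 0 := by linarith
      exact (mul_eq_zero.1 this).resolve_left hγ2.ne'
  have horth : ∀ {f : Pt → ℝ}, IsPeriodic f → MemLp f 2 nu → (∀ τ, ∀ᵐ p ∂nu, f (p + tv τ) = f p) →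
      ∀ v k, MemH1 v k → ∫ p, μ p.2.1 * f p * k 1 p ∂nu = 0 := by
    intro f hf hfL hfi v k hv
    refine hv.integral_mul_grad_one_eq_zero (hμ.isPeriodic.comp₂ hf (· * ·)) (hμ.memLp_mul hfL)
      fun τ => ?_
    filter_upwards [hfi τ] with p hp
    simp only [hp]; simp [tv]
  have o1 := horth (h.periodic_grad 1) (h.memLp_grad_nu 1) fun τ => hinv τ 1
  have hg1 : g 1 =ᵐ[nu] 0 := by
    have e := o1 w g h
    have hnn : ∀ p : Pt, 0 ≤ μ p.2.1 * g 1 p * g 1 p := fun p => by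
      rw [mul_assoc]; exact mul_nonneg (hμ.mu_pos _).le (mul_self_nonneg _)
    rw [integral_eq_zero_iff_of_nonneg hnn
      (MemLp.integrable_mul_nu (hμ.memLp_mul (h.memLp_grad_nu 1)) (h.memLp_grad_nu 1))] at e
    filter_upwards [e] with p hp
    simpa [(hμ.mu_pos p.2.1).ne'] using hp
  refine ⟨fun p => w p - ∫ q, w q ∂nu, g, h.sub_const _, ?_, hg1, fun v k hv => ?_,
    horth (hxp.comp₂ (h.periodic_grad 0) (· + ·)) (hx.add (h.memLp_grad_nu 0)) fun τ => ?_,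
    horth (h.periodic_grad 2) (h.memLp_grad_nu 2) fun τ => hinv τ 2⟩
  · rw [integral_sub (MemLp.integrable_nu h.memLp_nu) (integrable_const _)]; simp
  · rw [← hEL v k hv]
    refine integral_congr_ae (hg1.mono fun p hp => ?_)
    simp [hp]
  · filter_upwards [hinv τ 0] with p hp
    rw [hp]; simp [tv]

/-! ### Periodic primitives -/

/-- A bounded, measurable, one-periodic function with mean value zero. -/
structure IsMeanFree (φ : ℝ → ℝ) (C : ℝ) : Prop where
  measurable : Measurable φ
  bdd : ∀ t, |φ t| ≤ C
  periodic : Function.Periodic φ 1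
  mean : ∫ t, φ t ∂lam = 0

/-- The primitive with mean value zero. -/
def pprim (φ : ℝ → ℝ) (t : ℝ) : ℝ :=
  (∫ s in (0 : ℝ)..t, φ s) - ∫ r, (∫ s in (0 : ℝ)..r, φ s) ∂lam

namespace IsMeanFree

variable {φ : ℝ → ℝ} {C : ℝ}

lemma locallyIntegrable (h : IsMeanFree φ C) : LocallyIntegrable φ volume :=
  (locallyIntegrable_const C).mono h.measurable.aestronglyMeasurable
    (Eventually.of_forall fun t => (h.bdd t).trans (le_abs_self C))

lemma intervalIntegrable (h : IsMeanFree φ C) (a b : ℝ) : IntervalIntegrable φ volume a b :=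
  intervalIntegrable_iff.2 <|
    (h.locallyIntegrable.integrableOn_isCompact isCompact_uIcc).mono_set uIoc_subset_uIcc

lemma pprim_sub (h : IsMeanFree φ C) (s t : ℝ) : pprim φ s - pprim φ t = ∫ r in t..s, φ r := by
  rw [pprim, pprim, sub_sub_sub_cancel_right,
    intervalIntegral.integral_interval_sub_left (h.intervalIntegrable _ _) (h.intervalIntegrable _ _)]

lemma pprim_lipschitz (h : IsMeanFree φ C) (s t : ℝ) : |pprim φ s - pprim φ t| ≤ C * |s - t| := by
  rw [h.pprim_sub]
  exact intervalIntegral.norm_integral_le_of_norm_le_const (f := φ) fun r _ => h.bdd r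

lemma nonneg (h : IsMeanFree φ C) : 0 ≤ C := (abs_nonneg _).trans (h.bdd 0)

lemma continuous_pprim (h : IsMeanFree φ C) : Continuous (pprim φ) :=
  (LipschitzWith.of_dist_le' (K := C) fun s t => h.pprim_lipschitz s t).continuous

lemma ae_hasDerivAt_pprim (h : IsMeanFree φ C) : ∀ᵐ t, HasDerivAt (pprim φ) (φ t) t :=
  (_root_.LocallyIntegrable.ae_hasDerivAt_integral h.locallyIntegrable).mono fun _ ht => (ht 0).sub_const _

/-- The increment over one period is the integral of `φ` over a period, which vanishes. -/
lemma pprim_periodic (h : IsMeanFree φ C) : Function.Periodic (pprim φ) 1 := fun t => by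
  rw [← sub_eq_zero, h.pprim_sub, h.periodic.intervalIntegral_add_eq t (-1 / 2)]
  rw [← h.mean, integral_lam_eq]; norm_num

/-- This permits a second primitive, as needed in the third component of the corrector. -/
lemma pprim_isMeanFree (h : IsMeanFree φ C) : ∃ D, IsMeanFree (pprim φ) D := by
  refine ⟨|pprim φ 0| + C, h.continuous_pprim.measurable, fun t => ?_, h.pprim_periodic, ?_⟩
  · obtain ⟨s, hs, hst⟩ := h.pprim_periodic.exists_mem_Ico₀ one_pos t
    rw [hst]
    have h1 := h.pprim_lipschitz s 0
    have h2 : C * |s - 0| ≤ C := by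
      rw [sub_zero, abs_of_nonneg hs.1]
      exact mul_le_of_le_one_right h.nonneg hs.2.le
    have h3 := abs_sub_abs_le_abs_sub (pprim φ s) (pprim φ 0)
    linarith
  · have hc : Continuous fun r => ∫ s in (0 : ℝ)..r, φ s := by
      refine (h.continuous_pprim.add
        (continuous_const (y := ∫ r, (∫ s in (0 : ℝ)..r, φ s) ∂lam))).congr fun r => ?_
      simp [pprim]
    have hi : Integrable (fun r => ∫ s in (0 : ℝ)..r, φ s) lam :=
      ((hc.continuousOn (s := Icc (-1 / 2) (1 / 2))).integrableOn_Icc).mono_set Ioo_subset_Icc_self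
    simp only [pprim]
    rw [integral_sub hi (integrable_const _)]; simp

end IsMeanFree

/-! ### Sobolev functions that are affine in `x₃` and periodic in `y₁`. -/

lemma ae_comp_coord_zero {P : ℝ → Prop} (h : ∀ᵐ t, P t) : ∀ᵐ p : Pt, P p.2.1 :=
  (Measure.quasiMeasurePreserving_fst.comp Measure.quasiMeasurePreserving_snd).ae h

/-- The truncation to `[-1, 1]`. -/
def clamp (x : ℝ) : ℝ := max (-1) (min 1 x)

lemma clamp_eq {x : ℝ} (hx : x ∈ Icc (-1 : ℝ) 1) : clamp x = x := by
  rw [clamp, min_eq_right hx.2, max_eq_right hx.1]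

lemma abs_clamp_le (x : ℝ) : |clamp x| ≤ 1 :=
  abs_le.2 ⟨le_max_left _ _, max_le (by norm_num) (min_le_left _ _)⟩

lemma abs_clamp_sub_le (x y : ℝ) : |clamp x - clamp y| ≤ |x - y| := by
  have h : LipschitzWith 1 clamp := (LipschitzWith.id.const_min 1).const_max (-1)
  simpa [Real.dist_eq] using h.dist_le_mul x y

/-- Without the truncation the product is in general not Lipschitz on the whole space. On the slab
`clamp` changes nothing, and globally it makes integration by parts for Lipschitz functions
available. -/
lemma IsMeanFree.lipschitz_prod {φ : ℝ → ℝ} {C : ℝ} (h : IsMeanFree φ C) (A B : ℝ) :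
    ∃ K, LipschitzWith K fun p : Pt => (A * clamp p.1 + B) * pprim φ p.2.1 := by
  obtain ⟨D, hD⟩ := h.pprim_isMeanFree
  refine ⟨_, LipschitzWith.of_dist_le' (K := (|A| + |B|) * C + |A| * D) fun p q => ?_⟩
  rw [Real.dist_eq]
  have e : (A * clamp p.1 + B) * pprim φ p.2.1 - (A * clamp q.1 + B) * pprim φ q.2.1
      = (A * clamp p.1 + B) * (pprim φ p.2.1 - pprim φ q.2.1)
        + A * (clamp p.1 - clamp q.1) * pprim φ q.2.1 := by ring
  have d1 : |p.1 - q.1| ≤ dist p q := by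
    rw [Prod.dist_eq, ← Real.dist_eq]; exact le_max_left _ _
  have d2 : |p.2.1 - q.2.1| ≤ dist p q := by
    rw [Prod.dist_eq, Prod.dist_eq, ← Real.dist_eq]
    exact (le_max_left _ _).trans (le_max_right _ _)
  have h1 : |A * clamp p.1 + B| ≤ |A| + |B| := by
    refine (abs_add_le _ _).trans (add_le_add ?_ le_rfl)
    rw [abs_mul]; exact mul_le_of_le_one_right (abs_nonneg A) (abs_clamp_le _)
  rw [e, add_mul ((|A| + |B|) * C)]
  refine (abs_add_le _ _).trans (add_le_add ?_ ?_)
  · rw [abs_mul, mul_assoc]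
    exact mul_le_mul h1 ((h.pprim_lipschitz _ _).trans (mul_le_mul_of_nonneg_left d2 h.nonneg))
      (abs_nonneg _) (by positivity)
  · rw [abs_mul, abs_mul, mul_assoc, mul_assoc, mul_comm D]
    refine mul_le_mul_of_nonneg_left ?_ (abs_nonneg A)
    exact mul_le_mul ((abs_clamp_sub_le _ _).trans d1) (hD.bdd _) (abs_nonneg _) dist_nonneg

lemma hasLineDerivAt_dir_zero {r ψ : ℝ → ℝ} {p : Pt} {d : ℝ} (h : HasDerivAt ψ d p.2.1) :
    lineDeriv ℝ (fun p : Pt => r p.1 * ψ p.2.1) p (dir 0) = r p.1 * d := by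
  have e : (fun t : ℝ => r (p + t • dir 0).1 * ψ (p + t • dir 0).2.1)
      = fun t => r p.1 * ψ (p.2.1 + t) := by ext t; simp [dir]
  rw [lineDeriv, e]
  refine HasDerivAt.deriv ?_
  have : HasDerivAt ψ d (p.2.1 + 0) := by rwa [add_zero]
  exact (this.comp_const_add p.2.1 0).const_mul _

lemma hasLineDerivAt_dir_two {r ψ : ℝ → ℝ} {p : Pt} {d : ℝ} (h : HasDerivAt r d p.1) :
    lineDeriv ℝ (fun p : Pt => r p.1 * ψ p.2.1) p (dir 2) = d * ψ p.2.1 := by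
  have e : (fun t : ℝ => r (p + t • dir 2).1 * ψ (p + t • dir 2).2.1)
      = fun t => r (p.1 + t) * ψ p.2.1 := by ext t; simp [dir]
  rw [lineDeriv, e]
  refine HasDerivAt.deriv ?_
  have : HasDerivAt r d (p.1 + 0) := by rwa [add_zero]
  exact (this.comp_const_add p.1 0).mul_const _

lemma hasLineDerivAt_dir_one {r ψ : ℝ → ℝ} {p : Pt} :
    lineDeriv ℝ (fun p : Pt => r p.1 * ψ p.2.1) p (dir 1) = 0 := by
  have e : (fun t : ℝ => r (p + t • dir 1).1 * ψ (p + t • dir 1).2.1)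
      = fun t => r p.1 * ψ p.2.1 := by ext t; simp [dir]
  rw [lineDeriv, e, deriv_const]

/-- The gradient of `(A x₃ + B) ψ(y₁)` for the mean-free primitive `ψ` of `φ`. -/
def prodGrad (φ : ℝ → ℝ) (A B : ℝ) : Fin 3 → Pt → ℝ :=
  ![fun p => (A * p.1 + B) * φ p.2.1, fun _ => 0, fun p => A * pprim φ p.2.1]

lemma isPeriodic_x3_y1 {ψ : ℝ → ℝ} (h : Function.Periodic ψ 1) (F : ℝ → ℝ → ℝ) :
    IsPeriodic fun p : Pt => F p.1 (ψ p.2.1) := fun k l => Eventually.of_forall fun p => by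
  have := h.int_mul k p.2.1
  rw [mul_one] at this
  simp only [this]

/-- The truncated product is Lipschitz, so it can be integrated by parts with line derivatives;
almost everywhere in the slab these are the entries of `prodGrad`, by Lebesgue differentiation of
the primitive. -/
lemma IsMeanFree.memH1 {φ : ℝ → ℝ} {C : ℝ} (h : IsMeanFree φ C) (A B : ℝ) :
    MemH1 (fun p => (A * p.1 + B) * pprim φ p.2.1) (prodGrad φ A B) := by
  obtain ⟨D, hD⟩ := h.pprim_isMeanFree
  have hmul : ∀ {ψ : ℝ → ℝ} {D : ℝ}, Measurable ψ → (∀ t, |ψ t| ≤ D) → ∀ A B : ℝ,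
      MemLp (fun p : Pt => (A * p.1 + B) * ψ p.2.1) 2 nu := by
    intro ψ D hψ hψD A B
    refine memLp_bdd_Slab (((measurable_fst.const_mul A).add_const B).mul
      (hψ.comp (measurable_coord 0))) (C := (|A| * (1 / 2) + |B|) * D) fun p hp => ?_
    rw [abs_mul]
    refine mul_le_mul ((abs_add_le _ _).trans (add_le_add ?_ le_rfl)) (hψD _) (abs_nonneg _)
      (by positivity)
    rw [abs_mul]
    exact mul_le_mul_of_nonneg_left hp (abs_nonneg A)
  refine MemH1.mk' (isPeriodic_x3_y1 h.pprim_periodic fun x y => (A * x + B) * y) (fun i => ?_)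
    (hmul hD.measurable hD.bdd A B) (fun i => ?_) fun i η hη hc hs => ?_
  · fin_cases i
    · exact isPeriodic_x3_y1 h.periodic fun x y => (A * x + B) * y
    · exact fun k l => Eventually.of_forall fun _ => rfl
    · exact isPeriodic_x3_y1 h.pprim_periodic fun x y => A * y
  · fin_cases i
    · exact hmul h.measurable h.bdd A B
    · exact MemLp.zero
    · have := hmul hD.measurable hD.bdd 0 A
      simpa [prodGrad] using this
  · obtain ⟨K, hK⟩ := h.lipschitz_prod A B
    obtain ⟨L, hL⟩ := ContDiff.lipschitzWith_of_hasCompactSupport hc hη (by simp)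
    have e := hK.integral_lineDeriv_mul_eq (μ := (volume : Measure Pt)) hL hc (dir i)
    have hηd : ∀ p, lineDeriv ℝ η p (-dir i) = - fderiv ℝ η p (dir i) := fun p => by
      rw [((hη.differentiable (by simp)) p).lineDeriv_eq_fderiv, map_neg]
    have hcl : ∀ {p : Pt}, p ∈ Slab → clamp p.1 = p.1 := fun hp =>
      clamp_eq ⟨by linarith [hp.1.1], by linarith [hp.1.2]⟩
    obtain ⟨d1, d2, d3⟩ := test_fderiv hη hc hs (dir i)
    have e1 : ∫ p in Slab, (A * p.1 + B) * pprim φ p.2.1 * fderiv ℝ η p (dir i)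
        = - ∫ p, lineDeriv ℝ η p (-dir i) * ((A * clamp p.1 + B) * pprim φ p.2.1) := by
      rw [← integral_neg]
      conv_rhs => rw [← setIntegral_eq_integral_of_forall_compl_eq_zero (s := Slab) (by
        intro p hp
        rw [hηd, image_eq_zero_of_notMem_tsupport (f := fun p => fderiv ℝ η p (dir i))
          fun h => hp (d3 h)]
        simp)]
      · refine setIntegral_congr_fun measurableSet_Slab fun p hp => ?_
        simp only [hηd, hcl hp]; ring
    rw [e1, ← e, ← setIntegral_eq_integral_of_forall_compl_eq_zero (s := Slab)]
    · refine congrArg Neg.neg (setIntegral_congr_ae measurableSet_Slab ?_)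
      filter_upwards [ae_comp_coord_zero h.ae_hasDerivAt_pprim] with p hp hps
      congr 1
      fin_cases i
      · exact (hasLineDerivAt_dir_zero (r := fun x => A * clamp x + B) hp).trans (by
          simp only [hcl hps]; rfl)
      · exact hasLineDerivAt_dir_one (r := fun x => A * clamp x + B)
      · refine hasLineDerivAt_dir_two (r := fun x => A * clamp x + B) ?_
        have h1 : HasDerivAt (fun x : ℝ => A * x + B) A p.1 := by
          simpa using ((hasDerivAt_id p.1).const_mul A).add_const B
        refine h1.congr_of_eventuallyEq ?_
        filter_upwards [isOpen_Ioo.mem_nhds hps.1] with x hx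
        rw [clamp_eq ⟨by linarith [hx.1], by linarith [hx.2]⟩]
    · intro p hp
      rw [image_eq_zero_of_notMem_tsupport fun h => hp (hs h), mul_zero]

/-! ### Integrals of products -/

lemma integral_x3_y1 (f g : ℝ → ℝ) :
    ∫ p : Pt, f p.1 * g p.2.1 ∂nu = (∫ x, f x ∂lam) * ∫ t, g t ∂lam := by
  rw [nu, integral_prod_mul f fun q : ℝ × ℝ => g q.1]
  congr 1
  have := integral_prod_mul (μ := lam) (ν := lam) g fun _ => (1 : ℝ)
  simpa using this

lemma integral_x : ∫ x, x ∂lam = 0 := by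
  rw [integral_lam_eq, integral_id]; norm_num

lemma integral_x_sq : ∫ x, x ^ 2 ∂lam = 1 / 12 := by
  rw [integral_lam_eq, integral_pow]; norm_num

lemma integral_x3_mul (g : ℝ → ℝ) : ∫ p : Pt, p.1 * g p.2.1 ∂nu = 0 := by
  rw [integral_x3_y1 (fun x => x) g, integral_x, zero_mul]

lemma integral_x3_sq_mul (g : ℝ → ℝ) :
    ∫ p : Pt, p.1 ^ 2 * g p.2.1 ∂nu = (1 / 12) * ∫ t, g t ∂lam := by
  rw [integral_x3_y1 (fun x => x ^ 2) g, integral_x_sq]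

/-! ### The corrector for a laminate -/

lemma harmonicMean_eq (μ : ℝ → ℝ) : harmonicMean μ = (∫ t, 1 / μ t ∂lam)⁻¹ := rfl

lemma arithmeticMean_eq (μ : ℝ → ℝ) : arithmeticMean μ = ∫ t, μ t ∂lam := rfl

/-- The derivative of the corrector of the laminate. -/
def dcorr (μ : ℝ → ℝ) (t : ℝ) : ℝ := harmonicMean μ / μ t - 1

section

variable {a b : ℝ} {μ : ℝ → ℝ}

lemma IsModulus.integrable (h : IsModulus a b μ) : Integrable μ lam :=
  Integrable.of_bound h.measurable.aestronglyMeasurable b (Eventually.of_forall fun t => by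
    rw [Real.norm_of_nonneg (h.mu_pos t).le]; exact h.upper t)

lemma IsModulus.inv_bounds (h : IsModulus a b μ) (t : ℝ) : b⁻¹ ≤ 1 / μ t ∧ 1 / μ t ≤ a⁻¹ := by
  rw [one_div]
  exact ⟨inv_anti₀ (h.mu_pos t) (h.upper t), inv_anti₀ h.pos (h.lower t)⟩

lemma IsModulus.integrable_inv (h : IsModulus a b μ) : Integrable (fun t => 1 / μ t) lam :=
  Integrable.of_bound (h.measurable.const_div 1).aestronglyMeasurable a⁻¹
    (Eventually.of_forall fun t => by
      rw [Real.norm_of_nonneg (one_div_nonneg.2 (h.mu_pos t).le)]; exact (h.inv_bounds t).2)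

lemma IsModulus.b_pos (h : IsModulus a b μ) : 0 < b := (h.mu_pos 0).trans_le (h.upper 0)

lemma IsModulus.integral_inv_pos (h : IsModulus a b μ) : 0 < ∫ t, 1 / μ t ∂lam := by
  refine (inv_pos.2 h.b_pos).trans_le ?_
  have := integral_mono (μ := lam) (integrable_const b⁻¹) h.integrable_inv fun t => (h.inv_bounds t).1
  simpa using this

lemma IsModulus.harmonicMean_pos (h : IsModulus a b μ) : 0 < harmonicMean μ :=
  inv_pos.2 h.integral_inv_pos

lemma IsModulus.arithmeticMean_pos (h : IsModulus a b μ) : 0 < arithmeticMean μ := by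
  refine h.pos.trans_le ?_
  have := integral_mono (μ := lam) (integrable_const a) h.integrable h.lower
  rw [arithmeticMean_eq]
  simpa using this

lemma IsModulus.isMeanFree_dcorr (h : IsModulus a b μ) :
    IsMeanFree (dcorr μ) (harmonicMean μ * a⁻¹ + 1) := by
  have hc := h.harmonicMean_pos
  refine ⟨(h.measurable.const_div _).sub_const 1, fun t => ?_, fun t => ?_, ?_⟩
  · refine (abs_sub _ _).trans (add_le_add ?_ (by simp))
    rw [abs_of_pos (div_pos hc (h.mu_pos t)), div_eq_mul_one_div]
    exact mul_le_mul_of_nonneg_left (h.inv_bounds t).2 hc.le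
  · simp only [dcorr, h.periodic t]
  · simp only [dcorr, div_eq_mul_one_div (harmonicMean μ)]
    rw [integral_sub (h.integrable_inv.const_mul _) (integrable_const _), integral_const_mul,
      harmonicMean_eq, inv_mul_cancel₀ h.integral_inv_pos.ne']
    simp

/-- The stress of the one-dimensional cell problem is constant; this singles out the harmonic mean.
-/
lemma IsModulus.mu_mul_dcorr (h : IsModulus a b μ) (t : ℝ) :
    μ t * (1 + dcorr μ t) = harmonicMean μ := by
  have := (h.mu_pos t).ne'
  simp only [dcorr]; field_simp; ring

end

/-! ### The averages `μ_γ`: attainment, bounds, continuity, limits and strict monotonicity. -/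

/-- The energy of the shear problem. -/
def shearEnergy (μ : ℝ → ℝ) (γ : ℝ) (g : Fin 3 → Pt → ℝ) : ℝ :=
  ∫ p, μ p.2.1 * ((Real.sqrt 12 * p.1 + g 0 p) ^ 2 + (γ⁻¹ * g 2 p) ^ 2) ∂nu

section

variable {a b : ℝ} {μ : ℝ → ℝ}

lemma memLp_sx3 : MemLp (fun p : Pt => Real.sqrt 12 * p.1) 2 nu := memLp_x3.const_mul _

lemma sqrt_twelve_sq : Real.sqrt 12 ^ 2 = 12 := Real.sq_sqrt (by norm_num)

lemma IsModulus.integrable_mul (hμ : IsModulus a b μ) {f g : Pt → ℝ} (hf : MemLp f 2 nu)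
    (hg : MemLp g 2 nu) : Integrable (fun p => μ p.2.1 * (f p * g p)) nu := by
  simpa only [mul_assoc] using MemLp.integrable_mul_nu (hμ.memLp_mul hf) hg

lemma IsModulus.integrable_energy (hμ : IsModulus a b μ) (γ : ℝ) {f g : Pt → ℝ}
    (hf : MemLp f 2 nu) (hg : MemLp g 2 nu) :
    Integrable (fun p => μ p.2.1 * (f p ^ 2 + (γ⁻¹ * g p) ^ 2)) nu := by
  refine ((hμ.integrable_mul hf hf).add
    (hμ.integrable_mul (hg.const_mul γ⁻¹) (hg.const_mul γ⁻¹))).congr (Eventually.of_forall fun p => ?_)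
  simp only [Pi.add_apply]; ring

lemma MemH1.memLp_shear {v : Pt → ℝ} {k : Fin 3 → Pt → ℝ} (h : MemH1 v k) :
    MemLp (fun p => Real.sqrt 12 * p.1 + k 0 p) 2 nu := memLp_sx3.add (h.memLp_grad_nu 0)

/-- Expand the square around the solution; the linear term is the Euler equation tested with `v -
w`. -/
lemma IsShearSol.energy_eq (hμ : IsModulus a b μ) {γ : ℝ} {w : Pt → ℝ} {g : Fin 3 → Pt → ℝ}
    (h : IsShearSol μ γ w g) {v : Pt → ℝ} {k : Fin 3 → Pt → ℝ} (hv : MemH1 v k) :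
    shearEnergy μ γ k = shearEnergy μ γ g
      + ∫ p, μ p.2.1 * ((k 0 p - g 0 p) ^ 2 + (γ⁻¹ * (k 2 p - g 2 p)) ^ 2) ∂nu := by
  have hd := hv.sub h.memH1
  have e := h.euler _ _ hd
  have d0 := hd.memLp_grad_nu 0
  have d2 := hd.memLp_grad_nu 2
  have i1 := hμ.integrable_energy γ h.memH1.memLp_shear (h.memH1.memLp_grad_nu 2)
  have i2 := hμ.integrable_energy γ d0 d2
  have i3 : Integrable (fun p => 2 * (μ p.2.1 * ((Real.sqrt 12 * p.1 + g 0 p) * (k 0 p - g 0 p)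
      + γ⁻¹ ^ 2 * g 2 p * (k 2 p - g 2 p)))) nu := by
    refine (((hμ.integrable_mul h.memH1.memLp_shear d0).add (hμ.integrable_mul
      ((h.memH1.memLp_grad_nu 2).const_mul (γ⁻¹ ^ 2)) d2)).const_mul 2).congr
      (Eventually.of_forall fun p => ?_)
    simp only [Pi.add_apply]; ring
  have e3 := integral_add (i1.add i3) i2
  have e4 := integral_add i1 i3
  rw [integral_const_mul, e, mul_zero, add_zero] at e4
  simp only [Pi.add_apply] at e3
  rw [e4] at e3
  rw [shearEnergy, shearEnergy, ← e3]
  congr 1; ext p; ring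

lemma IsShearSol.energy_le (hμ : IsModulus a b μ) {γ : ℝ} {w : Pt → ℝ} {g : Fin 3 → Pt → ℝ}
    (h : IsShearSol μ γ w g) {v : Pt → ℝ} {k : Fin 3 → Pt → ℝ} (hv : MemH1 v k) :
    shearEnergy μ γ g ≤ shearEnergy μ γ k := by
  rw [h.energy_eq hμ hv]
  exact le_add_of_nonneg_right (integral_nonneg fun p => mul_nonneg (hμ.mu_pos _).le (by positivity))

lemma mem_shearEnergies {γ e : ℝ} : e ∈ shearEnergies μ γ ↔ ∃ w g, MemH1 w g ∧
    ∫ p, w p ∂nu = 0 ∧ g 1 =ᵐ[nu] 0 ∧ e = shearEnergy μ γ g := by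
  simp only [shearEnergies, restrict_Box, mem_ofPred_eq, shearEnergy]
  rfl

lemma IsShearSol.isLeast (hμ : IsModulus a b μ) {γ : ℝ} {w : Pt → ℝ} {g : Fin 3 → Pt → ℝ}
    (h : IsShearSol μ γ w g) : IsLeast (shearEnergies μ γ) (shearEnergy μ γ g) := by
  refine ⟨mem_shearEnergies.2 ⟨w, g, h.memH1, h.mean, h.grad_one, rfl⟩, fun e he => ?_⟩
  obtain ⟨v, k, hv, -, -, rfl⟩ := mem_shearEnergies.1 he
  exact h.energy_le hμ hv

lemma IsShearSol.muGamma_eq (hμ : IsModulus a b μ) {γ : ℝ} {w : Pt → ℝ} {g : Fin 3 → Pt → ℝ}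
    (h : IsShearSol μ γ w g) : muGamma μ γ = shearEnergy μ γ g := (h.isLeast hμ).csInf_eq

lemma IsModulus.isLeast_muGamma (hμ : IsModulus a b μ) {γ : ℝ} (hγ : 0 < γ) :
    IsLeast (shearEnergies μ γ) (muGamma μ γ) := by
  obtain ⟨w, g, h⟩ := exists_isShearSol hμ hγ
  rw [h.muGamma_eq hμ]
  exact h.isLeast hμ

lemma IsModulus.muGamma_le (hμ : IsModulus a b μ) {γ : ℝ} (hγ : 0 < γ) {v : Pt → ℝ}
    {k : Fin 3 → Pt → ℝ} (hv : MemH1 v k) : muGamma μ γ ≤ shearEnergy μ γ k := by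
  obtain ⟨w, g, h⟩ := exists_isShearSol hμ hγ
  rw [h.muGamma_eq hμ]
  exact h.energy_le hμ hv

lemma integral_mu_x3_sq : ∫ p : Pt, μ p.2.1 * (Real.sqrt 12 * p.1) ^ 2 ∂nu = arithmeticMean μ := by
  have e : ∀ p : Pt, μ p.2.1 * (Real.sqrt 12 * p.1) ^ 2 = 12 * (p.1 ^ 2 * μ p.2.1) := fun p => by
    rw [mul_pow, sqrt_twelve_sq]; ring
  simp only [e]
  rw [integral_const_mul, integral_x3_sq_mul, arithmeticMean_eq]; ring

lemma IsModulus.muGamma_le_arithmeticMean (hμ : IsModulus a b μ) {γ : ℝ} (hγ : 0 < γ) :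
    muGamma μ γ ≤ arithmeticMean μ := by
  refine (hμ.muGamma_le hγ (memH1_const 0)).trans_eq ?_
  rw [← integral_mu_x3_sq, shearEnergy]
  congr 1; ext p; simp

/-- With `s = √12 x₃ + ∂_{y₁}v` and `c = ⟨μ⟩_h`, completing the square gives `μ s² ≥ 2c√12 x₃ s -
12c² x₃²/μ`. The term `x₃ ∂_{y₁}v` integrates to zero by periodicity, and the rest integrates to `2c
- c = c`. -/
lemma IsModulus.harmonicMean_le_energy (hμ : IsModulus a b μ) {γ : ℝ} {v : Pt → ℝ}
    {k : Fin 3 → Pt → ℝ} (hv : MemH1 v k) : harmonicMean μ ≤ shearEnergy μ γ k := by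
  set c := harmonicMean μ with hc
  have h0 : ∫ p : Pt, p.1 * k 0 p ∂nu = 0 :=
    hv.integral_mul_grad_eq_zero (by decide) memLp_x3 fun p s => rfl
  have i1 : Integrable (fun p : Pt => p.1 * k 0 p) nu :=
    MemLp.integrable_mul_nu memLp_x3 (hv.memLp_grad_nu 0)
  have i2 : Integrable (fun p : Pt => p.1 ^ 2 * 1) nu := by simpa using memLp_x3.integrable_sq
  have i3 : Integrable (fun p : Pt => p.1 ^ 2 * (1 / μ p.2.1)) nu := by
    refine memLp_x3.integrable_sq.mul_bdd (c := a⁻¹)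
      (hμ.measurable_y.const_div 1).aestronglyMeasurable (Eventually.of_forall fun p => ?_)
    rw [Real.norm_of_nonneg (one_div_nonneg.2 (hμ.mu_pos _).le)]; exact (hμ.inv_bounds _).2
  have e2 := integral_x3_sq_mul (fun _ => 1)
  have e3 := integral_x3_sq_mul (fun t => 1 / μ t)
  have hci : c * ∫ t, 1 / μ t ∂lam = 1 := by
    rw [hc, harmonicMean_eq, inv_mul_cancel₀ hμ.integral_inv_pos.ne']
  have e : ∫ p : Pt, (24 * c * (p.1 ^ 2 * 1) + 2 * c * Real.sqrt 12 * (p.1 * k 0 p)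
      - 12 * c ^ 2 * (p.1 ^ 2 * (1 / μ p.2.1))) ∂nu = c := by
    rw [integral_sub (f := fun p : Pt => 24 * c * (p.1 ^ 2 * 1) + 2 * c * Real.sqrt 12 * (p.1 * k 0 p))
        ((i2.const_mul _).add (i1.const_mul _)) (i3.const_mul _),
      integral_add (i2.const_mul _) (i1.const_mul _), integral_const_mul, integral_const_mul,
      integral_const_mul, e2, e3, h0]
    have : ∫ _, (1 : ℝ) ∂lam = 1 := by simp
    rw [this]
    linear_combination (-c) * hci
  rw [← e]
  refine integral_mono (((i2.const_mul _).add (i1.const_mul _)).sub (i3.const_mul _))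
    (hμ.integrable_energy γ hv.memLp_shear (hv.memLp_grad_nu 2)) fun p => ?_
  have hm := hμ.mu_pos p.2.1
  have key : 0 ≤ μ p.2.1 * ((Real.sqrt 12 * p.1 + k 0 p) - c * Real.sqrt 12 * p.1 / μ p.2.1) ^ 2 :=
    mul_nonneg hm.le (sq_nonneg _)
  have e4 : μ p.2.1 * ((Real.sqrt 12 * p.1 + k 0 p) - c * Real.sqrt 12 * p.1 / μ p.2.1) ^ 2
      = μ p.2.1 * (Real.sqrt 12 * p.1 + k 0 p) ^ 2 - (24 * c * (p.1 ^ 2 * 1)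
      + 2 * c * Real.sqrt 12 * (p.1 * k 0 p) - 12 * c ^ 2 * (p.1 ^ 2 * (1 / μ p.2.1))) := by
    have h12 := sqrt_twelve_sq
    field_simp
    linear_combination (p.1 ^ 2 * c * (c - 2 * μ p.2.1)) * h12
  have h5 : 0 ≤ μ p.2.1 * (γ⁻¹ * k 2 p) ^ 2 := mul_nonneg hm.le (sq_nonneg _)
  simp only
  rw [mul_add]
  linarith

lemma IsModulus.harmonicMean_le_muGamma (hμ : IsModulus a b μ) {γ : ℝ} (hγ : 0 < γ) :
    harmonicMean μ ≤ muGamma μ γ := by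
  obtain ⟨w, g, h⟩ := exists_isShearSol hμ hγ
  rw [h.muGamma_eq hμ]
  exact hμ.harmonicMean_le_energy h.memH1

lemma IsModulus.muGamma_pos (hμ : IsModulus a b μ) {γ : ℝ} (hγ : 0 < γ) : 0 < muGamma μ γ :=
  hμ.harmonicMean_pos.trans_le (hμ.harmonicMean_le_muGamma hγ)

/-- The energy of any fixed competitor decreases in `γ`; use the minimizer for the smaller
parameter. -/
lemma IsModulus.antitoneOn_muGamma (hμ : IsModulus a b μ) : AntitoneOn (muGamma μ) (Ioi 0) := by
  intro γ hγ γ' hγ' hle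
  obtain ⟨w, g, h⟩ := exists_isShearSol hμ hγ
  rw [h.muGamma_eq hμ]
  refine (hμ.muGamma_le hγ' h.memH1).trans (integral_mono
    (hμ.integrable_energy γ' h.memH1.memLp_shear (h.memH1.memLp_grad_nu 2))
    (hμ.integrable_energy γ h.memH1.memLp_shear (h.memH1.memLp_grad_nu 2)) fun p => ?_)
  refine mul_le_mul_of_nonneg_left (add_le_add le_rfl ?_) (hμ.mu_pos _).le
  rw [mul_pow, mul_pow]
  exact mul_le_mul_of_nonneg_right (pow_le_pow_left₀ (inv_nonneg.2 (le_of_lt hγ'))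
    (inv_anti₀ hγ hle) 2) (sq_nonneg _)

/-- Passing from `γ'` to `γ` multiplies the energy of the minimizer for `γ'` by at most `(γ'/γ)²`.
Together with monotonicity this gives continuity. -/
lemma IsModulus.muGamma_le_mul (hμ : IsModulus a b μ) {γ γ' : ℝ} (hγ : 0 < γ) (hle : γ ≤ γ') :
    muGamma μ γ ≤ (γ' / γ) ^ 2 * muGamma μ γ' := by
  have hγ' := hγ.trans_le hle
  obtain ⟨w, g, h⟩ := exists_isShearSol hμ hγ'
  rw [h.muGamma_eq hμ, shearEnergy, ← integral_const_mul]
  refine (hμ.muGamma_le hγ h.memH1).trans (integral_mono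
    (hμ.integrable_energy γ h.memH1.memLp_shear (h.memH1.memLp_grad_nu 2))
    ((hμ.integrable_energy γ' h.memH1.memLp_shear (h.memH1.memLp_grad_nu 2)).const_mul _) fun p => ?_)
  have h1 : 1 ≤ (γ' / γ) ^ 2 := one_le_pow₀ ((one_le_div hγ).2 hle)
  have h2 : (γ' / γ) ^ 2 * (γ'⁻¹ * g 2 p) ^ 2 = (γ⁻¹ * g 2 p) ^ 2 := by
    field_simp
  have e : (γ' / γ) ^ 2 * (μ p.2.1 * ((Real.sqrt 12 * p.1 + g 0 p) ^ 2 + (γ'⁻¹ * g 2 p) ^ 2))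
      = μ p.2.1 * ((γ' / γ) ^ 2 * (Real.sqrt 12 * p.1 + g 0 p) ^ 2 + (γ⁻¹ * g 2 p) ^ 2) := by
    rw [← h2]; ring
  simp only [e]
  exact mul_le_mul_of_nonneg_left (add_le_add (le_mul_of_one_le_left (sq_nonneg _) h1) le_rfl)
    (hμ.mu_pos _).le

lemma IsModulus.continuousOn_muGamma (hμ : IsModulus a b μ) : ContinuousOn (muGamma μ) (Ioi 0) := by
  intro γ₀ hγ₀
  have hp := hμ.muGamma_pos hγ₀
  have hne : γ₀ ≠ 0 := (show 0 < γ₀ from hγ₀).ne'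
  have hr : Tendsto (fun γ : ℝ => (γ₀ / γ) ^ 2) (𝓝[Ioi 0] γ₀) (𝓝 1) := by
    have : ContinuousAt (fun γ : ℝ => (γ₀ / γ) ^ 2) γ₀ :=
      (continuousAt_const.div continuousAt_id hne).pow 2
    have h1 := this.tendsto
    simp only [div_self hne, one_pow] at h1
    exact h1.mono_left nhdsWithin_le_nhds
  -- The minimum and maximum with one cover both positions of `γ` relative to `γ₀` in a single pair
  -- of bounds.
  have t1 : Tendsto (fun γ : ℝ => min 1 ((γ₀ / γ) ^ 2) * muGamma μ γ₀) (𝓝[Ioi 0] γ₀)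
      (𝓝 (muGamma μ γ₀)) := by
    simpa using ((tendsto_const_nhds (x := (1 : ℝ))).min hr).mul_const (muGamma μ γ₀)
  have t2 : Tendsto (fun γ : ℝ => max 1 ((γ₀ / γ) ^ 2) * muGamma μ γ₀) (𝓝[Ioi 0] γ₀)
      (𝓝 (muGamma μ γ₀)) := by
    simpa using ((tendsto_const_nhds (x := (1 : ℝ))).max hr).mul_const (muGamma μ γ₀)
  refine tendsto_of_tendsto_of_tendsto_of_le_of_le' t1 t2 ?_ ?_ <;>
    filter_upwards [self_mem_nhdsWithin] with γ hγ
  · rcases le_total γ γ₀ with hle | hle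
    · exact (mul_le_of_le_one_left hp.le (min_le_left _ _)).trans
        (hμ.antitoneOn_muGamma hγ hγ₀ hle)
    · have h1 := hμ.muGamma_le_mul hγ₀ hle
      have h2 : 0 ≤ (γ₀ / γ) ^ 2 := sq_nonneg _
      have hg : 0 < γ := hγ
      have hg0 : 0 < γ₀ := hγ₀
      refine (mul_le_mul_of_nonneg_right (min_le_right _ _) hp.le).trans
        ((mul_le_mul_of_nonneg_left h1 h2).trans_eq ?_)
      field_simp
  · rcases le_total γ γ₀ with hle | hle
    · exact (hμ.muGamma_le_mul hγ hle).trans (mul_le_mul_of_nonneg_right (le_max_right _ _) hp.le)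
    · exact (hμ.antitoneOn_muGamma hγ₀ hγ hle).trans
        (le_mul_of_one_le_left hp.le (le_max_left _ _))

/-- The competitor is `t √12 x₃ ψ(y₁)`. The identity `μ(1 + ψ') = ⟨μ⟩_h` makes `μψ'` and `μψ'²`
affine in `μ` and `ψ'`, so both have explicit integrals. The factor `t = 1` serves the limit `γ →
∞`; an optimized `t` serves strict monotonicity. -/
lemma IsModulus.energy_corr (hμ : IsModulus a b μ) (γ t : ℝ) :
    shearEnergy μ γ (fun i p => t * prodGrad (dcorr μ) (Real.sqrt 12) 0 i p)
      = arithmeticMean μ + 2 * t * (harmonicMean μ - arithmeticMean μ)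
        + t ^ 2 * ((arithmeticMean μ - harmonicMean μ)
          + γ⁻¹ ^ 2 * (12 * ∫ s, μ s * pprim (dcorr μ) s ^ 2 ∂lam)) := by
  set c := harmonicMean μ with hc
  set ψ := pprim (dcorr μ) with hψ
  have hD := hμ.isMeanFree_dcorr
  obtain ⟨D, hP⟩ := hD.pprim_isMeanFree
  have hmd := hμ.mu_mul_dcorr
  have hdi : Integrable (dcorr μ) lam :=
    Integrable.of_bound hD.measurable.aestronglyMeasurable _ (Eventually.of_forall hD.bdd)
  have hψi : Integrable (fun s => μ s * ψ s ^ 2) lam := by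
    refine Integrable.of_bound (hμ.measurable.mul (hP.measurable.pow_const 2)).aestronglyMeasurable
      (b * D ^ 2) (Eventually.of_forall fun s => ?_)
    rw [norm_mul, Real.norm_of_nonneg (hμ.mu_pos s).le, Real.norm_of_nonneg (sq_nonneg _), ← sq_abs]
    exact mul_le_mul (hμ.upper s) (pow_le_pow_left₀ (abs_nonneg _) (hP.bdd s) 2) (by positivity)
      hμ.b_pos.le
  set f : ℝ → ℝ := fun s => μ s + 2 * t * (c - μ s) + t ^ 2 * (c * dcorr μ s - c + μ s) with hf
  have i1 : Integrable (fun s => 2 * t * (c - μ s)) lam :=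
    ((integrable_const c).sub hμ.integrable).const_mul _
  have i2 : Integrable (fun s => c * dcorr μ s - c) lam :=
    (hdi.const_mul c).sub (integrable_const c)
  have i3 : Integrable (fun s => t ^ 2 * (c * dcorr μ s - c + μ s)) lam :=
    (i2.add hμ.integrable).const_mul _
  have hfI : Integrable f lam := (hμ.integrable.add i1).add i3
  have hfe : ∫ s, f s ∂lam = arithmeticMean μ + 2 * t * (c - arithmeticMean μ)
      + t ^ 2 * (arithmeticMean μ - c) := by
    rw [hf, integral_add (f := fun s => μ s + 2 * t * (c - μ s)) (hμ.integrable.add i1) i3,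
      integral_add hμ.integrable i1, integral_const_mul,
      integral_const_mul, integral_sub (integrable_const c) hμ.integrable,
      integral_add (f := fun s => c * dcorr μ s - c) i2 hμ.integrable,
      integral_sub (hdi.const_mul c) (integrable_const c), integral_const_mul, hD.mean,
      ← arithmeticMean_eq]
    have h1 : ∫ _, c ∂lam = c := by simp
    rw [h1]
    ring
  have hpt : ∀ p : Pt, μ p.2.1 * ((Real.sqrt 12 * p.1 + t * prodGrad (dcorr μ) (Real.sqrt 12) 0 0 p) ^ 2
      + (γ⁻¹ * (t * prodGrad (dcorr μ) (Real.sqrt 12) 0 2 p)) ^ 2)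
      = 12 * (p.1 ^ 2 * f p.2.1) + 12 * γ⁻¹ ^ 2 * t ^ 2 * (1 * (μ p.2.1 * ψ p.2.1 ^ 2)) := by
    intro p
    have h1 := hmd p.2.1
    have h12 := sqrt_twelve_sq
    simp only [prodGrad, Matrix.cons_val, hf, add_zero, ← hψ]
    have e1 : μ p.2.1 * dcorr μ p.2.1 = c - μ p.2.1 := by linarith
    have e2 : μ p.2.1 * dcorr μ p.2.1 ^ 2 = c * dcorr μ p.2.1 - c + μ p.2.1 := by
      rw [pow_two, ← mul_assoc, e1]; linarith
    rw [← e2, ← e1]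
    linear_combination (μ p.2.1 * p.1 ^ 2 * (1 + t * dcorr μ p.2.1) ^ 2
      + μ p.2.1 * (γ⁻¹ * t * ψ p.2.1) ^ 2) * h12
  have j1 : Integrable (fun p : Pt => 12 * (p.1 ^ 2 * f p.2.1)) nu := by
    have hb : ∀ s, |f s| ≤ b + |2 * t| * (|c| + b) + t ^ 2 * (|c| * (c * a⁻¹ + 1) + |c| + b) := by
      intro s
      have hm : |μ s| ≤ b := by rw [abs_of_pos (hμ.mu_pos s)]; exact hμ.upper s
      refine (abs_add_three _ _ _).trans (add_le_add (add_le_add hm ?_) ?_)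
      · rw [abs_mul]
        exact mul_le_mul_of_nonneg_left ((abs_sub _ _).trans (add_le_add le_rfl hm)) (abs_nonneg _)
      · rw [abs_mul, abs_of_nonneg (sq_nonneg t)]
        refine mul_le_mul_of_nonneg_left ((abs_add_le _ _).trans (add_le_add
          ((abs_sub _ _).trans (add_le_add ?_ le_rfl)) hm)) (sq_nonneg t)
        rw [abs_mul]
        exact mul_le_mul_of_nonneg_left (hD.bdd s) (abs_nonneg c)
    refine (memLp_x3.integrable_sq.mul_bdd ?_ (Eventually.of_forall fun p => hb p.2.1)).const_mul 12
    have hfm : Measurable f := (hμ.measurable.add ((hμ.measurable.const_sub c).const_mul _)).add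
      ((((hD.measurable.const_mul c).sub_const c).add hμ.measurable).const_mul _)
    exact (hfm.comp (measurable_coord 0)).aestronglyMeasurable
  have j2 : Integrable (fun p : Pt => 12 * γ⁻¹ ^ 2 * t ^ 2 * (1 * (μ p.2.1 * ψ p.2.1 ^ 2))) nu := by
    refine Integrable.const_mul ?_ _
    simp only [one_mul]
    exact (measurePreserving_coord 0).integrable_comp_of_integrable hψi
  rw [shearEnergy]
  simp only [hpt]
  rw [integral_add j1 j2, integral_const_mul, integral_const_mul, integral_x3_sq_mul, hfe,
    integral_x3_y1 (fun _ => 1) fun s => μ s * ψ s ^ 2]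
  simp
  ring

lemma IsModulus.muGamma_le_corr (hμ : IsModulus a b μ) {γ : ℝ} (hγ : 0 < γ) (t : ℝ) :
    muGamma μ γ ≤ arithmeticMean μ + 2 * t * (harmonicMean μ - arithmeticMean μ)
        + t ^ 2 * ((arithmeticMean μ - harmonicMean μ)
          + γ⁻¹ ^ 2 * (12 * ∫ s, μ s * pprim (dcorr μ) s ^ 2 ∂lam)) := by
  rw [← hμ.energy_corr]
  exact hμ.muGamma_le hγ ((hμ.isMeanFree_dcorr.memH1 (Real.sqrt 12) 0).const_mul t)

lemma IsModulus.tendsto_atTop_muGamma (hμ : IsModulus a b μ) :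
    Tendsto (muGamma μ) atTop (𝓝 (harmonicMean μ)) := by
  set M := 12 * ∫ s, μ s * pprim (dcorr μ) s ^ 2 ∂lam with hM
  have t1 : Tendsto (fun γ : ℝ => harmonicMean μ + γ⁻¹ ^ 2 * M) atTop (𝓝 (harmonicMean μ)) := by
    have := ((tendsto_inv_atTop_zero (𝕜 := ℝ)).pow 2).mul_const M
    simpa using this.const_add (harmonicMean μ)
  refine tendsto_of_tendsto_of_tendsto_of_le_of_le' tendsto_const_nhds t1 ?_ ?_ <;>
    filter_upwards [eventually_gt_atTop 0] with γ hγ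
  · exact hμ.harmonicMean_le_muGamma hγ
  · have := hμ.muGamma_le_corr hγ 1
    rw [← hM] at this
    linarith

lemma IsModulus.memLp_mu_x3 (hμ : IsModulus a b μ) : MemLp (fun p : Pt => μ p.2.1 * p.1) 2 nu :=
  hμ.memLp_mul memLp_x3

lemma IsModulus.wavg_mu_x3 : wavg 2 (fun p : Pt => μ p.2.1 * p.1) =ᵐ[nu] 0 :=
  Eventually.of_forall fun p => by
    simp only [wavg, kop, repl_two, coord_two, Pi.zero_apply]
    rw [integral_const_mul, integral_const_mul, integral_x]; simp

/-- The energy dominates the arithmetic mean up to a mixed term. -/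
lemma IsModulus.energy_ge (hμ : IsModulus a b μ) {γ : ℝ} {v : Pt → ℝ} {k : Fin 3 → Pt → ℝ}
    (hv : MemH1 v k) :
    arithmeticMean μ + 2 * Real.sqrt 12 * ∫ p, μ p.2.1 * p.1 * k 0 p ∂nu ≤ shearEnergy μ γ k := by
  have i1 := hμ.integrable_mul memLp_sx3 memLp_sx3
  have i2 := MemLp.integrable_mul_nu hμ.memLp_mu_x3 (hv.memLp_grad_nu 0)
  have i1' : Integrable (fun p : Pt => μ p.2.1 * (Real.sqrt 12 * p.1) ^ 2) nu :=
    i1.congr (Eventually.of_forall fun p => by ring)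
  rw [← integral_mu_x3_sq, ← integral_const_mul, ← integral_add i1' (i2.const_mul _)]
  refine integral_mono (i1'.add (i2.const_mul _))
    (hμ.integrable_energy γ hv.memLp_shear (hv.memLp_grad_nu 2)) fun p => ?_
  have h1 : 0 ≤ μ p.2.1 * (k 0 p ^ 2 + (γ⁻¹ * k 2 p) ^ 2) :=
    mul_nonneg (hμ.mu_pos _).le (by positivity)
  have e : μ p.2.1 * ((Real.sqrt 12 * p.1 + k 0 p) ^ 2 + (γ⁻¹ * k 2 p) ^ 2)
      = μ p.2.1 * (Real.sqrt 12 * p.1) ^ 2 + 2 * Real.sqrt 12 * (μ p.2.1 * p.1 * k 0 p)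
        + μ p.2.1 * (k 0 p ^ 2 + (γ⁻¹ * k 2 p) ^ 2) := by ring
  simp only [e]
  linarith

/-- Both squares in the energy carry a weight of at least `a`. The point is that `∂₃v` is of order
`γ`, while `∂_{y₁}v` stays bounded. -/
lemma IsModulus.nrm_le_of_energy (hμ : IsModulus a b μ) {γ : ℝ} (hγ : 0 < γ) {v : Pt → ℝ}
    {k : Fin 3 → Pt → ℝ} (hv : MemH1 v k) (hE : shearEnergy μ γ k ≤ arithmeticMean μ) :
    nrm (k 0) ≤ Real.sqrt (arithmeticMean μ / a) + nrm (fun p => Real.sqrt 12 * p.1) ∧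
      nrm (k 2) ≤ γ * Real.sqrt (arithmeticMean μ / a) := by
  have ha := hμ.pos
  have key : ∀ f : Pt → ℝ, MemLp f 2 nu → (∀ p, f p ^ 2 ≤ (Real.sqrt 12 * p.1 + k 0 p) ^ 2
      + (γ⁻¹ * k 2 p) ^ 2) → nrm f ≤ Real.sqrt (arithmeticMean μ / a) := by
    intro f hf hle
    refine Real.le_sqrt_of_sq_le ?_
    rw [nrm_sq, le_div_iff₀ ha, mul_comm, ← integral_const_mul]
    refine le_trans ?_ hE
    refine integral_mono (hf.integrable_sq.const_mul a)
      (hμ.integrable_energy γ hv.memLp_shear (hv.memLp_grad_nu 2)) fun p => ?_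
    exact mul_le_mul (hμ.lower _) (hle p) (sq_nonneg _) (hμ.mu_pos _).le
  constructor
  · have h1 := key _ hv.memLp_shear fun p => le_add_of_nonneg_right (sq_nonneg _)
    have h2 := nrm_sub_le hv.memLp_shear memLp_sx3
    simp only [add_sub_cancel_left] at h2
    exact h2.trans (add_le_add h1 le_rfl)
  · have h1 := key (fun p => γ⁻¹ * k 2 p) ((hv.memLp_grad_nu 2).const_mul _) fun p =>
      le_add_of_nonneg_left (sq_nonneg _)
    rw [nrm_const_mul, abs_of_pos (inv_pos.2 hγ), inv_mul_eq_div, div_le_iff₀ hγ] at h1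
    linarith

/-- By `IsModulus.energy_ge` it suffices that the mixed term `∫ μ x₃ ∂_{y₁}w` tends to zero. The
coefficient `μ x₃` has zero average in `x₃`, so this term is bounded by a small multiple of the
bounded `‖∂_{y₁}w‖` plus a constant times `‖∂₃w‖ = O(γ)`. -/
lemma IsModulus.tendsto_zero_muGamma (hμ : IsModulus a b μ) :
    Tendsto (muGamma μ) (𝓝[>] 0) (𝓝 (arithmeticMean μ)) := by
  set R := Real.sqrt (arithmeticMean μ / a)
  set N := R + nrm (fun p => Real.sqrt 12 * p.1) with hN
  have hR : 0 ≤ R := Real.sqrt_nonneg _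
  have hN0 : 0 ≤ N := add_nonneg hR (nrm_nonneg _)
  have h12 : 0 < Real.sqrt 12 := by positivity
  rw [Metric.tendsto_nhds]
  intro δ hδ
  -- The mixed term is multiplied by `2√12` and `‖∂_{y₁}w‖ ≤ N`, so this accuracy costs at most
  -- `δ/2`; the other half is left for the term of order `γ`.
  obtain ⟨C, hC⟩ := exists_bound_integral_mul_grad hμ.memLp_mu_x3 IsModulus.wavg_mu_x3
    (ε := δ / (4 * Real.sqrt 12 * (N + 1))) (by positivity)
  have t1 : Tendsto (fun γ : ℝ => 2 * Real.sqrt 12 * (|C| * (γ * R))) (𝓝[>] 0) (𝓝 0) := by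
    have : Continuous fun γ : ℝ => 2 * Real.sqrt 12 * (|C| * (γ * R)) := by fun_prop
    have h := this.tendsto 0
    simp only [zero_mul, mul_zero] at h
    exact h.mono_left nhdsWithin_le_nhds
  filter_upwards [self_mem_nhdsWithin, t1.eventually (gt_mem_nhds (half_pos hδ))] with γ hγ hsmall
  have hγ0 : 0 < γ := hγ
  obtain ⟨w, g, h⟩ := exists_isShearSol hμ hγ0
  have hup := hμ.muGamma_le_arithmeticMean hγ0
  have heq := h.muGamma_eq hμ
  obtain ⟨n0, n2⟩ := hμ.nrm_le_of_energy hγ0 h.memH1 (heq ▸ hup)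
  have hlow := hμ.energy_ge (γ := γ) h.memH1
  have hb := (neg_abs_le _).trans' (neg_le_neg (hC h.memH1.isBoxGrad))
  have b1 : δ / (4 * Real.sqrt 12 * (N + 1)) * nrm (g 0) ≤ δ / (4 * Real.sqrt 12) := by
    calc _ ≤ δ / (4 * Real.sqrt 12 * (N + 1)) * (N + 1) :=
          mul_le_mul_of_nonneg_left (n0.trans (by linarith)) (by positivity)
      _ = δ / (4 * Real.sqrt 12) := by field_simp
  have b2 : C * nrm (g 2) ≤ |C| * (γ * R) :=
    mul_le_mul (le_abs_self C) n2 (nrm_nonneg _) (abs_nonneg C)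
  have b3 : 2 * Real.sqrt 12 * (δ / (4 * Real.sqrt 12)) = δ / 2 := by field_simp; norm_num
  rw [← heq] at hlow
  have b4 : 2 * Real.sqrt 12 * -(δ / (4 * Real.sqrt 12) + |C| * (γ * R))
      ≤ 2 * Real.sqrt 12 * ∫ p, μ p.2.1 * p.1 * g 0 p ∂nu :=
    mul_le_mul_of_nonneg_left (by linarith) (by positivity)
  rw [Real.dist_eq, abs_lt]
  constructor
  · nlinarith
  · linarith

/-- If `μ_γ ≤ μ_γ'` for some `γ < γ'`, the minimizer for `γ` has `∂₃w = 0`, as otherwise its energy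
would drop strictly at `γ'`. Then the mixed term vanishes and `μ_γ ≥ μ̄`, which a multiple of the
laminate corrector contradicts. -/
lemma IsModulus.strictAntiOn_muGamma (hμ : IsModulus a b μ)
    (hne : ¬ ∃ c : ℝ, ∀ᵐ t ∂lam, μ t = c) : StrictAntiOn (muGamma μ) (Ioi 0) := by
  -- The difference of the means is `∫ μ (dcorr μ)²`, so equality would make `μ` constant.
  have hlt : harmonicMean μ < arithmeticMean μ := by
    refine lt_of_le_of_ne ((hμ.harmonicMean_le_muGamma one_pos).trans
      (hμ.muGamma_le_arithmeticMean one_pos)) fun heq => hne ⟨harmonicMean μ, ?_⟩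
    have hD := hμ.isMeanFree_dcorr
    have hpt : ∀ s, μ s * dcorr μ s ^ 2 = harmonicMean μ * dcorr μ s - harmonicMean μ + μ s := fun s => by
      have := hμ.mu_mul_dcorr s
      linear_combination (dcorr μ s - 1) * this
    have hdi : Integrable (dcorr μ) lam :=
      Integrable.of_bound hD.measurable.aestronglyMeasurable _ (Eventually.of_forall hD.bdd)
    have i2 : Integrable (fun s => harmonicMean μ * dcorr μ s - harmonicMean μ) lam :=
      (hdi.const_mul _).sub (integrable_const _)
    have h0 : ∫ s, μ s * dcorr μ s ^ 2 ∂lam = 0 := by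
      simp only [hpt]
      rw [integral_add i2 hμ.integrable, integral_sub (hdi.const_mul _) (integrable_const _),
        integral_const_mul, hD.mean, heq, arithmeticMean_eq]
      simp
    rw [integral_eq_zero_iff_of_nonneg (fun s => mul_nonneg (hμ.mu_pos s).le (sq_nonneg _))
      ((i2.add hμ.integrable).congr (Eventually.of_forall fun s => (hpt s).symm))] at h0
    filter_upwards [h0] with s hs
    have hs' : dcorr μ s = 0 := by simpa [(hμ.mu_pos s).ne'] using hs
    have := hμ.mu_mul_dcorr s
    rw [hs'] at this
    linarith
  intro γ hγ γ' hγ' hlt'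
  have hγ0 : 0 < γ := hγ
  have hγ0' : 0 < γ' := hγ'
  by_contra hcon
  push Not at hcon
  obtain ⟨w, g, h⟩ := exists_isShearSol hμ hγ0
  have g2 := h.memH1.memLp_grad_nu 2
  have heq := h.muGamma_eq hμ
  set d := γ⁻¹ ^ 2 - γ'⁻¹ ^ 2 with hd
  have hdpos : 0 < d := sub_pos.2 (pow_lt_pow_left₀ (inv_strictAnti₀ hγ0 hlt')
    (inv_nonneg.2 hγ0'.le) two_ne_zero)
  have e1 : shearEnergy μ γ g = shearEnergy μ γ' g + d * ∫ p, μ p.2.1 * (g 2 p * g 2 p) ∂nu := by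
    rw [shearEnergy, shearEnergy, ← integral_const_mul, ← integral_add
      (hμ.integrable_energy γ' h.memH1.memLp_shear g2) ((hμ.integrable_mul g2 g2).const_mul d)]
    congr 1; ext p; rw [hd]; ring
  have hnn : ∀ p, 0 ≤ μ p.2.1 * (g 2 p * g 2 p) := fun p =>
    mul_nonneg (hμ.mu_pos _).le (mul_self_nonneg _)
  have h0 : ∫ p, μ p.2.1 * (g 2 p * g 2 p) ∂nu = 0 := by
    refine le_antisymm ?_ (integral_nonneg hnn)
    have := hμ.muGamma_le hγ0' h.memH1
    by_contra hpos
    have := mul_pos hdpos (not_le.1 hpos)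
    linarith
  rw [integral_eq_zero_iff_of_nonneg hnn (hμ.integrable_mul g2 g2)] at h0
  have hz : nrm (g 2) = 0 := by
    have : g 2 =ᵐ[nu] 0 := h0.mono fun p hp => by simpa [(hμ.mu_pos p.2.1).ne'] using hp
    rw [nrm_congr this]; simp [nrm]
  -- With `∂₃w = 0` the constant in `exists_bound_integral_mul_grad` plays no role, and `ε` is
  -- arbitrary.
  have hmix : ∫ p, μ p.2.1 * p.1 * g 0 p ∂nu = 0 := by
    rw [← abs_eq_zero]
    refine le_antisymm (le_of_forall_pos_le_add fun ε hε => ?_) (abs_nonneg _)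
    have hn := nrm_nonneg (g 0)
    obtain ⟨C, hC⟩ := exists_bound_integral_mul_grad hμ.memLp_mu_x3 IsModulus.wavg_mu_x3
      (ε := ε / (nrm (g 0) + 1)) (by positivity)
    refine (hC h.memH1.isBoxGrad).trans ?_
    rw [hz, mul_zero, add_zero, zero_add, div_mul_eq_mul_div, div_le_iff₀ (by positivity)]
    nlinarith
  have hge := hμ.energy_ge (γ := γ) h.memH1
  rw [hmix, mul_zero, add_zero, ← heq] at hge
  set M := 12 * ∫ s, μ s * pprim (dcorr μ) s ^ 2 ∂lam with hM
  have hM0 : 0 ≤ M := mul_nonneg (by norm_num)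
    (integral_nonneg fun s => mul_nonneg (hμ.mu_pos s).le (sq_nonneg _))
  set δ := arithmeticMean μ - harmonicMean μ with hδ
  have hδ0 : 0 < δ := sub_pos.2 hlt
  have hL : 0 < δ + γ⁻¹ ^ 2 * M := by positivity
  -- The bound is the quadratic `μ̄ - 2tδ + t²L` with `L = δ + γ⁻²M`; this `t` is its minimizer and
  -- gives `μ̄ - δ²/L`.
  have hc := hμ.muGamma_le_corr hγ0 (δ / (δ + γ⁻¹ ^ 2 * M))
  rw [← hM, ← hδ] at hc
  have e2 : (δ / (δ + γ⁻¹ ^ 2 * M)) ^ 2 * (δ + γ⁻¹ ^ 2 * M) = δ / (δ + γ⁻¹ ^ 2 * M) * δ := by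
    generalize δ + γ⁻¹ ^ 2 * M = L at hL
    field_simp
  rw [e2] at hc
  have h3 : 0 < δ / (δ + γ⁻¹ ^ 2 * M) * δ := by positivity
  have e3 : harmonicMean μ - arithmeticMean μ = -δ := by rw [hδ]; ring
  rw [e3] at hc
  linarith

end

/-! ### Square integrable matrix fields -/

/-- The scalar product of the symmetric parts. -/
def dotS (A B : Mat3) : ℝ := frob (symPart A) (symPart B)

lemma dotS_eq (A B : Mat3) : dotS A B = A 0 0 * B 0 0 + A 1 1 * B 1 1 + A 2 2 * B 2 2
    + (A 0 1 + A 1 0) * (B 0 1 + B 1 0) / 2 + (A 0 2 + A 2 0) * (B 0 2 + B 2 0) / 2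
    + (A 1 2 + A 2 1) * (B 1 2 + B 2 1) / 2 := by
  simp [dotS, frob, symPart, Fin.sum_univ_three]; ring

lemma dotS_comm (A B : Mat3) : dotS A B = dotS B A := by
  simp only [dotS, frob, mul_comm]

lemma dotS_add_right (A B C : Mat3) : dotS A (B + C) = dotS A B + dotS A C := by
  simp only [dotS_eq, Matrix.add_apply]; ring

lemma dotS_symPart (A B : Mat3) : dotS (symPart A) B = dotS A B := by
  simp only [dotS_eq]; simp [symPart]; ring

lemma dotS_self_nonneg (A : Mat3) : 0 ≤ dotS A A := by
  unfold dotS frob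
  exact Finset.sum_nonneg fun _ _ => Finset.sum_nonneg fun _ _ => mul_self_nonneg _

lemma dotS_self_eq_zero {A : Mat3} (h : dotS A A = 0) (B : Mat3) : dotS B A = 0 := by
  unfold dotS frob at h ⊢
  have h1 := (Finset.sum_eq_zero_iff_of_nonneg fun i _ =>
    Finset.sum_nonneg fun j _ => mul_self_nonneg (symPart A i j)).1 h
  refine Finset.sum_eq_zero fun i hi => Finset.sum_eq_zero fun j hj => ?_
  have h2 := (Finset.sum_eq_zero_iff_of_nonneg fun j _ =>
    mul_self_nonneg (symPart A i j)).1 (h1 i hi) j hj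
  rw [mul_self_eq_zero.1 h2, mul_zero]

/-- Matrix fields with square integrable entries. -/
def IsL2 (F : Pt → Mat3) : Prop := ∀ i j, MemLp (fun p => F p i j) 2 nu

lemma IsL2.congr {F G : Pt → Mat3} (hF : IsL2 F) (h : ∀ᵐ p ∂nu, F p = G p) : IsL2 G :=
  fun i j => (hF i j).ae_eq (h.mono fun p hp => by simp only [hp])

lemma IsL2.add {F G : Pt → Mat3} (hF : IsL2 F) (hG : IsL2 G) : IsL2 (F + G) :=
  fun i j => (hF i j).add (hG i j)

lemma IsL2.sub {F G : Pt → Mat3} (hF : IsL2 F) (hG : IsL2 G) : IsL2 (F - G) :=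
  fun i j => (hF i j).sub (hG i j)

lemma IsL2.symPart {F : Pt → Mat3} (hF : IsL2 F) : IsL2 fun p => symPart (F p) :=
  fun i j => ((hF i j).add (hF j i)).const_mul _

lemma isL2_const (A : Mat3) : IsL2 fun _ => A := fun _ _ => memLp_const _

lemma isL2_bendingField (A : Mat2) : IsL2 (bendingField A) := by
  intro i j
  have h : ∀ a : ℝ, MemLp (fun p : Pt => p.1 * a) 2 nu := fun a => memLp_x3.mul_const a
  have h0 : MemLp (fun _ : Pt => (0 : ℝ)) 2 nu := MemLp.zero
  fin_cases i <;> fin_cases j <;> simp [bendingField, iota, h, h0]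

lemma isL2_scaledGrad (γ : ℝ) {φ : Fin 3 → Pt → ℝ} {g : Fin 3 → Fin 3 → Pt → ℝ}
    (h : ∀ i, MemH1 (φ i) (g i)) : IsL2 (scaledGrad γ g) := by
  intro i j
  fin_cases j
  · exact (h i).memLp_grad_nu 0
  · exact (h i).memLp_grad_nu 1
  · exact ((h i).memLp_grad_nu 2).const_mul _

/-- The scalar product of matrix fields for the shear modulus `μ`. -/
def bil (μ : ℝ → ℝ) (F G : Pt → Mat3) : ℝ := ∫ p, 2 * (μ p.2.1 * dotS (F p) (G p)) ∂nu

section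

variable {a b : ℝ} {μ : ℝ → ℝ}

lemma bil_comm (F G : Pt → Mat3) : bil μ F G = bil μ G F := by
  simp only [bil, dotS_comm]

lemma bil_congr {F G G' : Pt → Mat3} (h : ∀ᵐ p ∂nu, G p = G' p) : bil μ F G = bil μ F G' :=
  integral_congr_ae (h.mono fun p hp => by simp only [hp])

lemma bil_symPart (F G : Pt → Mat3) : bil μ (fun p => symPart (F p)) G = bil μ F G := by
  simp only [bil, dotS_symPart]

lemma IsModulus.integrable_dotS (hμ : IsModulus a b μ) {F G : Pt → Mat3} (hF : IsL2 F)
    (hG : IsL2 G) : Integrable (fun p => 2 * (μ p.2.1 * dotS (F p) (G p))) nu := by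
  simp only [dotS, frob, Finset.mul_sum]
  exact integrable_finsetSum _ fun i _ => integrable_finsetSum _ fun j _ =>
    (hμ.integrable_mul (hF.symPart i j) (hG.symPart i j)).const_mul 2

lemma IsModulus.bil_add_right (hμ : IsModulus a b μ) {F G G' : Pt → Mat3} (hF : IsL2 F)
    (hG : IsL2 G) (hG' : IsL2 G') : bil μ F (G + G') = bil μ F G + bil μ F G' := by
  rw [bil, bil, bil, ← integral_add (hμ.integrable_dotS hF hG) (hμ.integrable_dotS hF hG')]
  congr 1; ext p
  rw [Pi.add_apply, dotS_add_right]; ring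

lemma IsModulus.bil_sub_right (hμ : IsModulus a b μ) {F G G' : Pt → Mat3} (hF : IsL2 F)
    (hG : IsL2 G) (hG' : IsL2 G') : bil μ F (G - G') = bil μ F G - bil μ F G' := by
  have := hμ.bil_add_right hF (hG.sub hG') hG'
  rw [sub_add_cancel] at this
  linarith

lemma IsModulus.bil_sub_left (hμ : IsModulus a b μ) {F F' G : Pt → Mat3} (hF : IsL2 F)
    (hF' : IsL2 F') (hG : IsL2 G) : bil μ (F - F') G = bil μ F G - bil μ F' G := by
  rw [bil_comm, hμ.bil_sub_right hG hF hF', bil_comm F, bil_comm F']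

lemma IsModulus.bil_self_nonneg (hμ : IsModulus a b μ) (F : Pt → Mat3) : 0 ≤ bil μ F F :=
  integral_nonneg fun _ => mul_nonneg two_pos.le (mul_nonneg (hμ.mu_pos _).le (dotS_self_nonneg _))

lemma IsModulus.bil_eq_zero_of_self (hμ : IsModulus a b μ) {F : Pt → Mat3} (hF : IsL2 F)
    (h : bil μ F F = 0) (G : Pt → Mat3) : bil μ G F = 0 := by
  rw [bil, integral_eq_zero_iff_of_nonneg (fun p : Pt => mul_nonneg two_pos.le
    (mul_nonneg (hμ.mu_pos p.2.1).le (dotS_self_nonneg (F p)))) (hμ.integrable_dotS hF hF)] at h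
  refine (integral_congr_ae (h.mono fun p hp => ?_)).trans (integral_zero _ _)
  have h1 : dotS (F p) (F p) = 0 := by simpa [(hμ.mu_pos p.2.1).ne'] using hp
  simp [dotS_self_eq_zero h1]

/-! ### Relaxed bending fields -/

/-- The gradients of the corrector for the bending field of `A`, where `g` is the gradient of the
solution of the shear problem. -/
def corrGrad (μ : ℝ → ℝ) (γ : ℝ) (g : Fin 3 → Pt → ℝ) (A : Mat2) : Fin 3 → Fin 3 → Pt → ℝ :=
  ![fun i p => A 0 0 * prodGrad (dcorr μ) 1 0 i p,
    fun i p => 2 * A 0 1 / Real.sqrt 12 * g i p,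
    fun i p => -(A 0 0 * γ⁻¹) * prodGrad (pprim (dcorr μ)) 0 1 i p]

/-- The bending field of `A` plus its corrector. -/
def relaxed (μ : ℝ → ℝ) (γ : ℝ) (g : Fin 3 → Pt → ℝ) (A : Mat2) : Pt → Mat3 :=
  bendingField A + fun p => symPart (scaledGrad γ (corrGrad μ γ g A) p)

lemma IsModulus.exists_corr (hμ : IsModulus a b μ) (γ : ℝ) {w : Pt → ℝ} {g : Fin 3 → Pt → ℝ}
    (h : MemH1 w g) (A : Mat2) : ∃ φ : Fin 3 → Pt → ℝ, ∀ i, MemH1 (φ i) (corrGrad μ γ g A i) := by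
  obtain ⟨D, hP⟩ := hμ.isMeanFree_dcorr.pprim_isMeanFree
  refine ⟨![fun p => A 0 0 * ((1 * p.1 + 0) * pprim (dcorr μ) p.2.1),
    fun p => 2 * A 0 1 / Real.sqrt 12 * w p,
    fun p => -(A 0 0 * γ⁻¹) * ((0 * p.1 + 1) * pprim (pprim (dcorr μ)) p.2.1)], fun i => ?_⟩
  fin_cases i
  · exact (hμ.isMeanFree_dcorr.memH1 1 0).const_mul (A 0 0)
  · exact h.const_mul (2 * A 0 1 / Real.sqrt 12)
  · exact (hP.memH1 0 1).const_mul (-(A 0 0 * γ⁻¹))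

lemma IsModulus.isL2_relaxed (hμ : IsModulus a b μ) (γ : ℝ) {w : Pt → ℝ} {g : Fin 3 → Pt → ℝ}
    (h : MemH1 w g) (A : Mat2) : IsL2 (relaxed μ γ g A) := by
  obtain ⟨φ, hφ⟩ := hμ.exists_corr γ h A
  exact (isL2_bendingField A).add (isL2_scaledGrad γ hφ).symPart

/-- The (1,3) entries of `X` drop out: `γ⁻¹∂₃` of the first corrector component cancels `∂_{y₁}` of
the third. The factor `2 A 0 1 / √12` in the second component matches the normalization `√12 x₃` of
the shear problem. -/
lemma dotS_relaxed {γ : ℝ} {g : Fin 3 → Pt → ℝ} {A : Mat2} (hA : A.IsSymm) (X : Mat3) {p : Pt}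
    (h1 : g 1 p = 0) : dotS (relaxed μ γ g A p) X = A 0 0 * (p.1 * (1 + dcorr μ p.2.1) * X 0 0)
      + A 1 1 * (p.1 * X 1 1) + A 0 1 / Real.sqrt 12 * ((Real.sqrt 12 * p.1 + g 0 p) *
        (X 0 1 + X 1 0) + γ⁻¹ * g 2 p * (X 1 2 + X 2 1)) := by
  have hs : A 1 0 = A 0 1 := hA.apply 0 1
  have h12 : Real.sqrt 12 ≠ 0 := by positivity
  rw [dotS_eq]
  simp [relaxed, bendingField, iota, symPart, scaledGrad, corrGrad, prodGrad, h1, hs]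
  field_simp
  ring

/-- The functional `G ↦ bil μ (relaxed G) X` has these three coefficients. -/
def coef (μ : ℝ → ℝ) (γ : ℝ) (g : Fin 3 → Pt → ℝ) (X : Pt → Mat3) : Fin 3 → ℝ :=
  ![2 * harmonicMean μ * ∫ p, p.1 * X p 0 0 ∂nu, 2 * ∫ p, μ p.2.1 * (p.1 * X p 1 1) ∂nu,
    2 / Real.sqrt 12 * ∫ p, μ p.2.1 * ((Real.sqrt 12 * p.1 + g 0 p) * (X p 0 1 + X p 1 0)
      + γ⁻¹ * g 2 p * (X p 1 2 + X p 2 1)) ∂nu]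

/-- The weight `μ` disappears from the first coefficient because `μ(1 + dcorr μ)` is the harmonic
mean. -/
lemma IsModulus.bil_relaxed (hμ : IsModulus a b μ) {γ : ℝ} {w : Pt → ℝ} {g : Fin 3 → Pt → ℝ}
    (h : IsShearSol μ γ w g) {A : Mat2} (hA : A.IsSymm) {X : Pt → Mat3} (hX : IsL2 X) :
    bil μ (relaxed μ γ g A) X
      = A 0 0 * coef μ γ g X 0 + A 1 1 * coef μ γ g X 1 + A 0 1 * coef μ γ g X 2 := by
  have i0 : Integrable (fun p => p.1 * X p 0 0) nu := MemLp.integrable_mul_nu memLp_x3 (hX 0 0)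
  have i1 := hμ.integrable_mul memLp_x3 (hX 1 1)
  have i2 : Integrable (fun p => μ p.2.1 * ((Real.sqrt 12 * p.1 + g 0 p) * (X p 0 1 + X p 1 0)
      + γ⁻¹ * g 2 p * (X p 1 2 + X p 2 1))) nu := by
    refine ((hμ.integrable_mul h.memH1.memLp_shear ((hX 0 1).add (hX 1 0))).add
      (hμ.integrable_mul ((h.memH1.memLp_grad_nu 2).const_mul γ⁻¹)
        ((hX 1 2).add (hX 2 1)))).congr (Eventually.of_forall fun p => ?_)
    simp only [Pi.add_apply]; ring
  have e : bil μ (relaxed μ γ g A) X = ∫ p, (A 0 0 * (2 * harmonicMean μ) * (p.1 * X p 0 0)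
      + A 1 1 * 2 * (μ p.2.1 * (p.1 * X p 1 1))
      + A 0 1 * (2 / Real.sqrt 12) * (μ p.2.1 * ((Real.sqrt 12 * p.1 + g 0 p) * (X p 0 1 + X p 1 0)
      + γ⁻¹ * g 2 p * (X p 1 2 + X p 2 1)))) ∂nu := by
    refine integral_congr_ae (h.grad_one.mono fun p hp => ?_)
    simp only [dotS_relaxed hA (X p) hp, ← hμ.mu_mul_dcorr p.2.1]
    ring
  rw [e, integral_add (f := fun p : Pt => A 0 0 * (2 * harmonicMean μ) * (p.1 * X p 0 0)
      + A 1 1 * 2 * (μ p.2.1 * (p.1 * X p 1 1))) ((i0.const_mul _).add (i1.const_mul _))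
      (i2.const_mul _), integral_add (i0.const_mul _) (i1.const_mul _), integral_const_mul,
    integral_const_mul, integral_const_mul]
  simp only [coef, Matrix.cons_val]
  ring

/-- Testing the Euler equation with `ψ(y₁)` yields `∫ μ s = ⟨μ⟩_h ∫ s` for `s = √12 x₃ + ∂_{y₁}w`,
and `s` has mean zero. This makes the shear stress orthogonal to constant matrices. -/
lemma IsShearSol.integral_stress (hμ : IsModulus a b μ) {γ : ℝ} {w : Pt → ℝ} {g : Fin 3 → Pt → ℝ}
    (h : IsShearSol μ γ w g) : ∫ p, μ p.2.1 * (Real.sqrt 12 * p.1 + g 0 p) ∂nu = 0 := by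
  have e := h.euler _ _ (hμ.isMeanFree_dcorr.memH1 0 1)
  have hL := h.memH1.memLp_shear
  have i1 := MemLp.integrable_nu hL
  have i2 := MemLp.integrable_nu (hμ.memLp_mul hL)
  have h0 : ∫ p, 1 * g 0 p ∂nu = 0 :=
    h.memH1.integral_mul_grad_eq_zero (by decide) (memLp_const 1) fun p s => rfl
  have hx : ∫ p : Pt, p.1 * 1 ∂nu = 0 := integral_x3_mul fun _ => 1
  simp only [one_mul, mul_one] at h0 hx
  have h1 : ∫ p : Pt, (Real.sqrt 12 * p.1 + g 0 p) ∂nu = 0 := by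
    rw [integral_add ((MemLp.integrable_nu memLp_x3).const_mul _)
      (MemLp.integrable_nu (h.memH1.memLp_grad_nu 0)), integral_const_mul, h0, hx]
    simp
  have e2 : ∀ p : Pt, μ p.2.1 * ((Real.sqrt 12 * p.1 + g 0 p) * prodGrad (dcorr μ) 0 1 0 p
      + γ⁻¹ ^ 2 * g 2 p * prodGrad (dcorr μ) 0 1 2 p)
      = harmonicMean μ * (Real.sqrt 12 * p.1 + g 0 p) - μ p.2.1 * (Real.sqrt 12 * p.1 + g 0 p) := by
    intro p
    rw [← hμ.mu_mul_dcorr p.2.1]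
    simp [prodGrad]; ring
  simp only [e2] at e
  rw [integral_sub (i1.const_mul _) i2, integral_const_mul, h1] at e
  linarith

/-- The stress of a relaxed bending field is orthogonal to all relaxation fields. -/
lemma IsModulus.bil_relaxed_rel (hμ : IsModulus a b μ) {γ : ℝ} {w : Pt → ℝ} {g : Fin 3 → Pt → ℝ}
    (h : IsShearSol μ γ w g) {A : Mat2} (hA : A.IsSymm) {X : Pt → Mat3} (hX : X ∈ Hrel γ) :
    bil μ (relaxed μ γ g A) X = 0 := by
  obtain ⟨M, φ, k, hM, hφ, hXe⟩ := hX
  have hs : M 1 0 = M 0 1 := hM.apply 0 1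
  have hL2 : IsL2 fun p => iota M + symPart (scaledGrad γ k p) :=
    (isL2_const (iota M)).add (isL2_scaledGrad γ hφ).symPart
  rw [bil_congr (ae_nu_of_ae_Slab hXe), hμ.bil_relaxed h hA hL2]
  -- The weight `x₃` has mean zero and does not depend on `y₁`.
  have c0 : coef μ γ g (fun p => iota M + symPart (scaledGrad γ k p)) 0 = 0 := by
    have e : ∀ p : Pt, p.1 * (iota M + symPart (scaledGrad γ k p)) 0 0
        = p.1 * M 0 0 + p.1 * k 0 0 p := fun p => by
      simp [iota, symPart, scaledGrad]; ring
    simp only [coef, Matrix.cons_val, e]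
    rw [integral_add ((MemLp.integrable_nu memLp_x3).mul_const _)
      (MemLp.integrable_mul_nu memLp_x3 ((hφ 0).memLp_grad_nu 0)), integral_x3_mul fun _ => M 0 0,
      (hφ 0).integral_mul_grad_eq_zero (by decide) memLp_x3 fun p s => rfl]
    simp
  -- The weight `μ(y₁) x₃` has mean zero and does not depend on `y₂`.
  have c1 : coef μ γ g (fun p => iota M + symPart (scaledGrad γ k p)) 1 = 0 := by
    have e : ∀ p : Pt, μ p.2.1 * (p.1 * (iota M + symPart (scaledGrad γ k p)) 1 1)
        = p.1 * (μ p.2.1 * M 1 1) + μ p.2.1 * p.1 * k 1 1 p := fun p => by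
      simp [iota, symPart, scaledGrad]; ring
    have i1 : Integrable (fun p : Pt => p.1 * (μ p.2.1 * M 1 1)) nu :=
      ((MemLp.integrable_nu hμ.memLp_mu_x3).mul_const (M 1 1)).congr
        (Eventually.of_forall fun p => by ring)
    simp only [coef, Matrix.cons_val, e]
    rw [integral_add i1 (MemLp.integrable_mul_nu hμ.memLp_mu_x3 ((hφ 1).memLp_grad_nu 1)),
      integral_x3_mul fun t => μ t * M 1 1,
      (hφ 1).integral_mul_grad_eq_zero (by decide) hμ.memLp_mu_x3 fun p s => rfl]
    simp
  -- Four contributions vanish separately: the constant by `integral_stress`, the derivatives in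
  -- `y₂` of the first and third components by `orth_zero` and `orth_two`, and the gradient of the
  -- second component by the Euler equation.
  have c2 : coef μ γ g (fun p => iota M + symPart (scaledGrad γ k p)) 2 = 0 := by
    have e : ∀ p : Pt, μ p.2.1 * ((Real.sqrt 12 * p.1 + g 0 p) *
        ((iota M + symPart (scaledGrad γ k p)) 0 1 + (iota M + symPart (scaledGrad γ k p)) 1 0)
        + γ⁻¹ * g 2 p * ((iota M + symPart (scaledGrad γ k p)) 1 2
          + (iota M + symPart (scaledGrad γ k p)) 2 1))
        = (μ p.2.1 * (Real.sqrt 12 * p.1 + g 0 p) * (2 * M 0 1)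
          + μ p.2.1 * (Real.sqrt 12 * p.1 + g 0 p) * k 0 1 p)
          + (μ p.2.1 * ((Real.sqrt 12 * p.1 + g 0 p) * k 1 0 p + γ⁻¹ ^ 2 * g 2 p * k 1 2 p)
          + γ⁻¹ * (μ p.2.1 * g 2 p * k 2 1 p)) := fun p => by
      simp [iota, symPart, scaledGrad, hs]; ring
    have hL := hμ.memLp_mul h.memH1.memLp_shear
    have hg := h.memH1.memLp_grad_nu 2
    have i1 := (MemLp.integrable_nu hL).mul_const (2 * M 0 1)
    have i2 := MemLp.integrable_mul_nu hL ((hφ 0).memLp_grad_nu 1)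
    have i3 : Integrable (fun p => μ p.2.1 * ((Real.sqrt 12 * p.1 + g 0 p) * k 1 0 p
        + γ⁻¹ ^ 2 * g 2 p * k 1 2 p)) nu := by
      refine ((hμ.integrable_mul h.memH1.memLp_shear ((hφ 1).memLp_grad_nu 0)).add
        (hμ.integrable_mul (hg.const_mul (γ⁻¹ ^ 2)) ((hφ 1).memLp_grad_nu 2))).congr
        (Eventually.of_forall fun p => ?_)
      simp only [Pi.add_apply]; ring
    have i4 := (MemLp.integrable_mul_nu (hμ.memLp_mul hg) ((hφ 2).memLp_grad_nu 1)).const_mul γ⁻¹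
    simp only [coef, Matrix.cons_val, e]
    have j1 : Integrable (fun p => μ p.2.1 * (Real.sqrt 12 * p.1 + g 0 p) * (2 * M 0 1)
        + μ p.2.1 * (Real.sqrt 12 * p.1 + g 0 p) * k 0 1 p) nu := i1.add i2
    have j2 : Integrable (fun p => μ p.2.1 * ((Real.sqrt 12 * p.1 + g 0 p) * k 1 0 p
        + γ⁻¹ ^ 2 * g 2 p * k 1 2 p) + γ⁻¹ * (μ p.2.1 * g 2 p * k 2 1 p)) nu := i3.add i4
    rw [integral_add j1 j2, integral_add i1 i2, integral_add i3 i4,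
      integral_mul_const, integral_const_mul, h.integral_stress hμ, h.orth_zero _ _ (hφ 0),
      h.euler _ _ (hφ 1), h.orth_two _ _ (hφ 2)]
    simp
  rw [c0, c1, c2]; simp

/-- The homogenized scalar product. -/
def effForm (μ : ℝ → ℝ) (γ : ℝ) (A G : Mat2) : ℝ :=
  A 0 0 * G 0 0 * (harmonicMean μ / 6) + A 1 1 * G 1 1 * (arithmeticMean μ / 6)
    + A 0 1 * G 0 1 * (muGamma μ γ / 3)

/-- The diagonal entries use `∫ x₃² = 1/12`. In the shear entry, pairing the stress with `√12 x₃`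
equals the minimal energy because the pairing with the gradient of `w` itself is zero. -/
lemma IsModulus.bil_relaxed_bending (hμ : IsModulus a b μ) {γ : ℝ} {w : Pt → ℝ}
    {g : Fin 3 → Pt → ℝ} (h : IsShearSol μ γ w g) {A G : Mat2} (hA : A.IsSymm) (hG : G.IsSymm) :
    bil μ (relaxed μ γ g A) (bendingField G) = effForm μ γ A G := by
  have hs : G 1 0 = G 0 1 := hG.apply 0 1
  have h12 : Real.sqrt 12 ≠ 0 := by positivity
  have c0 : coef μ γ g (bendingField G) 0 = G 0 0 * (harmonicMean μ / 6) := by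
    have e : ∀ p : Pt, p.1 * bendingField G p 0 0 = p.1 ^ 2 * G 0 0 := fun p => by
      simp [bendingField, iota]; ring
    simp only [coef, Matrix.cons_val, e]
    rw [integral_x3_sq_mul fun _ => G 0 0]
    simp; ring
  have c1 : coef μ γ g (bendingField G) 1 = G 1 1 * (arithmeticMean μ / 6) := by
    have e : ∀ p : Pt, μ p.2.1 * (p.1 * bendingField G p 1 1) = G 1 1 * (p.1 ^ 2 * μ p.2.1) :=
      fun p => by simp [bendingField, iota]; ring
    simp only [coef, Matrix.cons_val, e]
    rw [integral_const_mul, integral_x3_sq_mul, arithmeticMean_eq]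
    ring
  have c2 : coef μ γ g (bendingField G) 2 = G 0 1 * (muGamma μ γ / 3) := by
    have e : ∀ p : Pt, μ p.2.1 * ((Real.sqrt 12 * p.1 + g 0 p) *
        (bendingField G p 0 1 + bendingField G p 1 0)
        + γ⁻¹ * g 2 p * (bendingField G p 1 2 + bendingField G p 2 1))
        = 2 * G 0 1 / Real.sqrt 12 *
          (μ p.2.1 * ((Real.sqrt 12 * p.1 + g 0 p) ^ 2 + (γ⁻¹ * g 2 p) ^ 2)
          - μ p.2.1 * ((Real.sqrt 12 * p.1 + g 0 p) * g 0 p + γ⁻¹ ^ 2 * g 2 p * g 2 p)) := by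
      intro p
      simp [bendingField, iota, hs]
      field_simp
      ring
    have hL := h.memH1.memLp_shear
    have i1 := hμ.integrable_energy γ hL (h.memH1.memLp_grad_nu 2)
    have i2 : Integrable (fun p => μ p.2.1 * ((Real.sqrt 12 * p.1 + g 0 p) * g 0 p
        + γ⁻¹ ^ 2 * g 2 p * g 2 p)) nu := by
      refine ((hμ.integrable_mul hL (h.memH1.memLp_grad_nu 0)).add (hμ.integrable_mul
        ((h.memH1.memLp_grad_nu 2).const_mul (γ⁻¹ ^ 2)) (h.memH1.memLp_grad_nu 2))).congr
        (Eventually.of_forall fun p => ?_)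
      simp only [Pi.add_apply]; ring
    simp only [coef, Matrix.cons_val, e]
    rw [integral_const_mul, integral_sub i1 i2, h.euler _ _ h.memH1, sub_zero, h.muGamma_eq hμ,
      shearEnergy]
    have hq := sqrt_twelve_sq
    field_simp
    rw [hq]; ring
  rw [hμ.bil_relaxed h hA (isL2_bendingField G), c0, c1, c2, effForm]
  ring

end

/-! ### The relaxation space -/

section

variable {a b γ : ℝ} {μ : ℝ → ℝ}

lemma Hrel_congr {F F' : Pt → Mat3} (hF : F ∈ Hrel γ)
    (h : ∀ᵐ p ∂(volume.restrict Slab), F' p = F p) : F' ∈ Hrel γ := by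
  obtain ⟨M, φ, k, hM, hφ, he⟩ := hF
  exact ⟨M, φ, k, hM, hφ, by filter_upwards [h, he] with p h1 h2; rw [h1, h2]⟩

lemma sub_mem_Hrel {F F' : Pt → Mat3} (hF : F ∈ Hrel γ) (hF' : F' ∈ Hrel γ) : F - F' ∈ Hrel γ := by
  obtain ⟨M, φ, k, hM, hφ, he⟩ := hF
  obtain ⟨M', φ', k', hM', hφ', he'⟩ := hF'
  refine ⟨M - M', _, _, hM.sub hM', fun i => (hφ i).sub (hφ' i), ?_⟩
  filter_upwards [he, he'] with p h1 h2
  rw [Pi.sub_apply, h1, h2]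
  ext i j
  fin_cases i <;> fin_cases j <;> simp [iota, symPart, scaledGrad] <;> ring

lemma isL2_of_mem_Hrel {F : Pt → Mat3} (hF : F ∈ Hrel γ) : IsL2 F := by
  obtain ⟨M, φ, k, hM, hφ, he⟩ := hF
  have hL2 : IsL2 fun p => iota M + symPart (scaledGrad γ k p) :=
    (isL2_const (iota M)).add (isL2_scaledGrad γ hφ).symPart
  exact hL2.congr ((ae_nu_of_ae_Slab he).mono fun p hp => hp.symm)

lemma isL2_of_mem_Hgamma {F : Pt → Mat3} (hF : F ∈ Hgamma γ) : IsL2 F := by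
  obtain ⟨G, χ, hG, hχ, he⟩ := hF
  exact ((isL2_bendingField G).add (isL2_of_mem_Hrel hχ)).congr
    ((ae_nu_of_ae_Slab he).mono fun p hp => hp.symm)

lemma isSymm_zero : (0 : Mat2).IsSymm := Matrix.transpose_zero

lemma iota_zero : iota 0 = 0 := by
  ext i j; fin_cases i <;> fin_cases j <;> simp [iota]

lemma IsModulus.corr_mem_Hrel (hμ : IsModulus a b μ) {w : Pt → ℝ} {g : Fin 3 → Pt → ℝ}
    (h : MemH1 w g) (A : Mat2) :
    (fun p => symPart (scaledGrad γ (corrGrad μ γ g A) p)) ∈ Hrel γ := by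
  obtain ⟨φ, hφ⟩ := hμ.exists_corr γ h A
  exact ⟨0, φ, _, isSymm_zero, hφ, Eventually.of_forall fun p => by rw [iota_zero, zero_add]⟩

lemma IsModulus.relaxed_mem_Hgamma (hμ : IsModulus a b μ) {w : Pt → ℝ} {g : Fin 3 → Pt → ℝ}
    (h : MemH1 w g) {A : Mat2} (hA : A.IsSymm) : relaxed μ γ g A ∈ Hgamma γ :=
  ⟨A, _, hA, hμ.corr_mem_Hrel h A, Eventually.of_forall fun _ => rfl⟩

lemma IsModulus.exists_sub_relaxed_mem (hμ : IsModulus a b μ) {w : Pt → ℝ} {g : Fin 3 → Pt → ℝ}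
    (h : MemH1 w g) {F : Pt → Mat3} (hF : F ∈ Hgamma γ) :
    ∃ G : Mat2, G.IsSymm ∧ F - relaxed μ γ g G ∈ Hrel γ := by
  obtain ⟨G, χ, hG, hχ, he⟩ := hF
  refine ⟨G, hG, Hrel_congr (sub_mem_Hrel hχ (hμ.corr_mem_Hrel h G)) (he.mono fun p hp => ?_)⟩
  rw [Pi.sub_apply, hp]
  simp only [relaxed, Pi.add_apply, Pi.sub_apply, add_sub_add_left_eq_sub]

/-- The corrector of `G` lies in the relaxation space, to which the relaxed field of `A` is
orthogonal. -/
lemma IsModulus.bil_relaxed_relaxed (hμ : IsModulus a b μ) {w : Pt → ℝ} {g : Fin 3 → Pt → ℝ}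
    (h : IsShearSol μ γ w g) {A G : Mat2} (hA : A.IsSymm) (hG : G.IsSymm) :
    bil μ (relaxed μ γ g A) (relaxed μ γ g G) = effForm μ γ A G := by
  have hc := hμ.corr_mem_Hrel (γ := γ) h.memH1 G
  conv_lhs => rw [relaxed.eq_1 μ γ g G]
  rw [hμ.bil_add_right (hμ.isL2_relaxed γ h.memH1 A) (isL2_bendingField G) (isL2_of_mem_Hrel hc),
    hμ.bil_relaxed_bending h hA hG, hμ.bil_relaxed_rel h hA hc, add_zero]

/-! ### Laminates -/

/-- `Q` is the quadratic form of a laminate of isotropic materials with vanishing Poisson ratio. -/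
def IsLaminate (μ : ℝ → ℝ) (Q : Pt → Mat3 → ℝ) : Prop :=
  ∀ᵐ p ∂nu, ∀ G : Mat3, Q p G = 2 * μ p.2.1 * frob (symPart G) (symPart G)

variable {Q : Pt → Mat3 → ℝ}

lemma IsLaminate.innerQ_eq (hQ : IsLaminate μ Q) (F F' : Pt → Mat3) :
    innerQ Q F F' = bil μ F F' := by
  rw [innerQ, restrict_Box, bil]
  refine integral_congr_ae (hQ.mono fun p hp => ?_)
  have e : ∀ X, Q p X = 2 * μ p.2.1 * dotS X X := hp
  simp only [e, dotS_eq, Matrix.add_apply]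
  ring

lemma IsLaminate.energy_eq (hQ : IsLaminate μ Q) (F : Pt → Mat3) :
    ∫ p in Box, Q p (F p) = bil μ F F := by
  rw [restrict_Box, bil]
  refine integral_congr_ae (hQ.mono fun p hp => ?_)
  simp only [hp, dotS]
  ring

lemma iota_smul_add (x : ℝ) (G M : Mat2) : iota (x • G + M) = iota (x • G) + iota M := by
  ext i j; fin_cases i <;> fin_cases j <;> simp [iota]

/-- Every competitor is the relaxed field of `G` plus an element of `Hrel γ`, so by Pythagoras the
relaxed field, which is itself a competitor with `M = 0`, has least energy. -/
lemma IsLaminate.Qhom_eq (hQ : IsLaminate μ Q) (hμ : IsModulus a b μ) (hγ : 0 < γ) {G : Mat2}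
    (hG : G.IsSymm) : Qhom γ Q G = effForm μ γ G G := by
  obtain ⟨w, g, h⟩ := exists_isShearSol hμ hγ
  have hR := hμ.isL2_relaxed γ h.memH1 G
  refine IsLeast.csInf_eq ⟨?_, ?_⟩
  · obtain ⟨φ, hφ⟩ := hμ.exists_corr γ h.memH1 G
    refine ⟨0, φ, _, isSymm_zero, hφ, ?_⟩
    rw [← hμ.bil_relaxed_relaxed h hG hG, ← hQ.energy_eq]
    simp only [add_zero]
    rfl
  · rintro e ⟨M, φ, k, hM, hφ, rfl⟩
    rw [hQ.energy_eq fun p => iota (p.1 • G + M) + symPart (scaledGrad γ k p)]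
    set X : Pt → Mat3 := fun p => iota (p.1 • G + M) + symPart (scaledGrad γ k p) with hX
    set Y : Pt → Mat3 := X - relaxed μ γ g G with hY
    have hYm : Y ∈ Hrel γ := by
      refine Hrel_congr (sub_mem_Hrel (F := fun p => iota M + symPart (scaledGrad γ k p))
        ⟨M, φ, k, hM, hφ, Eventually.of_forall fun _ => rfl⟩ (hμ.corr_mem_Hrel h.memH1 G))
        (Eventually.of_forall fun p => ?_)
      simp only [hY, hX, relaxed, bendingField, iota_smul_add, Pi.sub_apply, Pi.add_apply]
      abel
    have hYL := isL2_of_mem_Hrel hYm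
    have e1 : X = relaxed μ γ g G + Y := by rw [hY, add_sub_cancel]
    have h0 := hμ.bil_relaxed_rel h hG hYm
    rw [e1, hμ.bil_add_right (hR.add hYL) hR hYL, bil_comm (relaxed μ γ g G + Y),
      bil_comm (relaxed μ γ g G + Y), hμ.bil_add_right hR hR hYL, hμ.bil_add_right hYL hR hYL,
      bil_comm Y, h0, hμ.bil_relaxed_relaxed h hG hG]
    linarith [hμ.bil_self_nonneg Y]

/-- Up to fields of norm zero, the orthogonal complement consists of the relaxed fields, and the
projection of `ι(x₃A)` is the relaxed field of `A`. Equality of projections is therefore equality of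
the pairings with all relaxed fields. -/
lemma isEffectivePrestrain_iff_effForm (hQ : IsLaminate μ Q) (hμ : IsModulus a b μ)
    {w : Pt → ℝ} {g : Fin 3 → Pt → ℝ} (h : IsShearSol μ γ w g) {B : Pt → Mat3} (hB : IsL2 B)
    (A : Mat2) : IsEffectivePrestrain γ Q B A ↔
      A.IsSymm ∧ ∀ G : Mat2, G.IsSymm → effForm μ γ G A = bil μ (relaxed μ γ g G) B := by
  have hR := fun G => hμ.isL2_relaxed γ h.memH1 G
  have hBs := hB.symPart
  have hRm : ∀ {G : Mat2}, G.IsSymm → relaxed μ γ g G ∈ HrelPerp γ Q := fun hG =>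
    ⟨hμ.relaxed_mem_Hgamma h.memH1 hG, fun χ hχ => by
      rw [hQ.innerQ_eq, hμ.bil_relaxed_rel h hG hχ]⟩
  refine and_congr_right fun hA => ⟨?_, fun hG => ⟨relaxed μ γ g A, ⟨hRm hA, fun χ hχ => ?_⟩,
    hRm hA, fun F hF => ?_⟩⟩
  · rintro ⟨P, ⟨hP, h1⟩, -, h2⟩ G hG
    have hPL := isL2_of_mem_Hgamma hP.1
    have e1 := h1 _ (hRm hG)
    have e2 := h2 _ (hRm hG)
    rw [hQ.innerQ_eq, hμ.bil_sub_left (isL2_bendingField A) hPL (hR G), bil_comm,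
      hμ.bil_relaxed_bending h hG hA] at e1
    rw [hQ.innerQ_eq, hμ.bil_sub_left hBs hPL (hR G), bil_symPart, bil_comm B] at e2
    linarith
  · have hχL := isL2_of_mem_Hgamma hχ.1
    have hc := hμ.corr_mem_Hrel (γ := γ) h.memH1 A
    have h0 := hχ.2 _ hc
    rw [hQ.innerQ_eq] at h0 ⊢
    rw [bil_comm, hμ.bil_sub_right hχL (isL2_bendingField A) (hR A), relaxed,
      hμ.bil_add_right hχL (isL2_bendingField A) (isL2_of_mem_Hrel hc), h0]
    ring
  · have hFL := isL2_of_mem_Hgamma hF.1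
    obtain ⟨G, hGs, hX⟩ := hμ.exists_sub_relaxed_mem h.memH1 hF.1
    have hXL := isL2_of_mem_Hrel hX
    -- The difference lies in `Hrel γ` and is orthogonal to `Hrel γ`, so its pairing with any field
    -- vanishes.
    have h0 : bil μ (F - relaxed μ γ g G) (F - relaxed μ γ g G) = 0 := by
      have := hF.2 _ hX
      rw [hQ.innerQ_eq] at this
      rw [hμ.bil_sub_left hFL (hR G) hXL, this, hμ.bil_relaxed_rel h hGs hX, sub_zero]
    have h1 := hμ.bil_eq_zero_of_self hXL h0 ((fun p => symPart (B p)) - relaxed μ γ g A)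
    rw [hμ.bil_sub_right (hBs.sub (hR A)) hFL (hR G), sub_eq_zero] at h1
    rw [hQ.innerQ_eq, h1, hμ.bil_sub_left hBs (hR A) (hR G), bil_symPart, bil_comm B,
      hμ.bil_relaxed_relaxed h hA hGs, ← hG G hGs]
    simp only [effForm]
    ring

/-- `effForm` is diagonal with positive coefficients `⟨μ⟩_h/6`, `μ̄/6`, `μ_γ/3`; testing with three
basis matrices solves for the entries of `A`. Existence and uniqueness are both contained in this
formula. -/
lemma isEffectivePrestrain_iff (hQ : IsLaminate μ Q) (hμ : IsModulus a b μ) (hγ : 0 < γ)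
    {w : Pt → ℝ} {g : Fin 3 → Pt → ℝ} (h : IsShearSol μ γ w g) {B : Pt → Mat3} (hB : IsL2 B)
    (A : Mat2) : IsEffectivePrestrain γ Q B A ↔
      A = !![6 / harmonicMean μ * coef μ γ g B 0, 3 / muGamma μ γ * coef μ γ g B 2;
        3 / muGamma μ γ * coef μ γ g B 2, 6 / arithmeticMean μ * coef μ γ g B 1] := by
  have p0 := hμ.harmonicMean_pos.ne'
  have p1 := hμ.arithmeticMean_pos.ne'
  have p2 := (hμ.muGamma_pos hγ).ne'
  have hs : ∀ x y z : ℝ, (!![x, y; y, z] : Mat2).IsSymm := fun x y z => by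
    ext i j; fin_cases i <;> fin_cases j <;> rfl
  rw [isEffectivePrestrain_iff_effForm hQ hμ h hB]
  constructor
  · rintro ⟨hA, hG⟩
    have e0 := hG _ (hs 1 0 0)
    have e1 := hG _ (hs 0 0 1)
    have e2 := hG _ (hs 0 1 0)
    rw [hμ.bil_relaxed h (hs _ _ _) hB] at e0 e1 e2
    simp [effForm] at e0 e1 e2
    have hA10 : A 1 0 = A 0 1 := hA.apply 0 1
    ext i j
    fin_cases i <;> fin_cases j <;> simp [← e0, ← e1, ← e2, hA10] <;> field_simp
  · rintro rfl
    refine ⟨hs _ _ _, fun G hG => ?_⟩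
    rw [hμ.bil_relaxed h hG hB]
    simp [effForm]
    field_simp

end

/-! ### Reduction to a measurable modulus -/

lemma ae_lam_of_ae_nu {P : ℝ → Prop} (hP : MeasurableSet {t | P t})
    (h : ∀ᵐ p : Pt ∂nu, P p.2.1) : ∀ᵐ t ∂lam, P t := by
  have hm := measurePreserving_coord 0
  rw [← hm.map_eq, ae_map_iff hm.measurable.aemeasurable hP]
  exact h

lemma ae_nu_of_ae_lam {P : ℝ → Prop} (h : ∀ᵐ t ∂lam, P t) : ∀ᵐ p : Pt ∂nu, P p.2.1 :=
  (measurePreserving_coord 0).quasiMeasurePreserving.ae h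

lemma aestronglyMeasurable_of_comp_coord_zero {f : ℝ → ℝ}
    (h : AEStronglyMeasurable (fun p : Pt => f p.2.1) nu) : AEStronglyMeasurable f lam := by
  have hne : lam ≠ 0 := IsProbabilityMeasure.ne_zero lam
  exact (AEStronglyMeasurable.of_comp_snd (f := fun q : ℝ × ℝ => f q.1) h hne).of_comp_fst hne

lemma aestronglyMeasurable_of_Slab {f : Pt → ℝ} (hf : Measurable fun p : Slab => f p) :
    AEStronglyMeasurable f nu := by
  have h := (aemeasurable_restrict_of_measurable_subtype (μ := volume) measurableSet_Slab
    hf).aestronglyMeasurable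
  rw [← restrict_Box]
  exact h.mono_measure (Measure.restrict_mono Box_subset_Slab le_rfl)

/-- At `E = e₁ ⊗ e₁` the form equals `2μ`, so measurability and the bounds `α ≤ 2μ ≤ β` pass from
`Q` to `μ`. -/
lemma exists_isModulus {α β : ℝ} (hα : 0 < α) (hαβ : α ≤ β) {Q : Pt → Mat3 → ℝ}
    (hQ : IsAdmissibleForm α β Q) {μ : ℝ → ℝ} (hL : IsLaminate μ Q) :
    ∃ m : ℝ → ℝ, IsModulus (α / 2) (β / 2) m ∧ ∀ᵐ t ∂lam, μ t = m t := by
  set E : Mat3 := iota !![1, 0; 0, 0] with hE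
  have hEE : frob (symPart E) (symPart E) = 1 := by
    change dotS E E = 1
    rw [dotS_eq]; simp [hE, iota]
  have hQE : ∀ᵐ p ∂nu, Q p E = 2 * μ p.2.1 := hL.mono fun p hp => by rw [hp, hEE, mul_one]
  have hQm : AEStronglyMeasurable (fun p => Q p E) nu :=
    aestronglyMeasurable_of_Slab (hQ.borel.comp (measurable_id.prodMk measurable_const) :
      Measurable fun p : Slab => Q p (Matrix.of fun i j => E i j))
  have hμm : AEStronglyMeasurable μ lam := by
    refine aestronglyMeasurable_of_comp_coord_zero ((hQm.const_mul (1 / 2)).congr ?_)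
    filter_upwards [hQE] with p hp
    rw [hp]; ring
  set m := hμm.mk μ with hm
  have hmm : Measurable m := hμm.stronglyMeasurable_mk.measurable
  have hb : ∀ᵐ t ∂lam, α / 2 ≤ m t ∧ m t ≤ β / 2 := by
    refine ae_lam_of_ae_nu ((measurableSet_le measurable_const hmm).inter
      (measurableSet_le hmm measurable_const)) ?_
    filter_upwards [hQE, ae_nu_of_ae_Slab hQ.classQ, ae_nu_of_ae_lam hμm.ae_eq_mk] with p h1 h2 h3
    have h4 := h2.2 E
    rw [hEE, h1, h3] at h4
    constructor <;> linarith [h4.1, h4.2]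
  -- Truncation and periodic extension make the bounds and the periodicity hold everywhere, and
  -- change nothing almost everywhere on the period cell.
  refine ⟨fun t => max (α / 2) (min (β / 2) (m (red t))), ⟨half_pos hα,
    measurable_const.max (measurable_const.min (hmm.comp measurable_red)),
    fun t => le_max_left _ _, fun t => max_le (by linarith) (min_le_left _ _), fun t => ?_⟩, ?_⟩
  · have := red_add_int t 1
    rw [Int.cast_one] at this
    simp only [this]
  · filter_upwards [hb, hμm.ae_eq_mk, ae_restrict_mem measurableSet_Ioo] with t h1 h2 h3
    rw [red_eq ⟨h3.1.le, h3.2⟩, min_eq_right h1.2, max_eq_right h1.1, h2]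

section

variable {μ m : ℝ → ℝ}

lemma harmonicMean_congr (h : ∀ᵐ t ∂lam, μ t = m t) : harmonicMean μ = harmonicMean m := by
  rw [harmonicMean_eq, harmonicMean_eq, integral_congr_ae (g := fun t => 1 / m t)
    (h.mono fun t ht => by simp only [ht])]

lemma arithmeticMean_congr (h : ∀ᵐ t ∂lam, μ t = m t) : arithmeticMean μ = arithmeticMean m :=
  integral_congr_ae h

lemma shearEnergies_congr (h : ∀ᵐ t ∂lam, μ t = m t) (γ : ℝ) :
    shearEnergies μ γ = shearEnergies m γ := by
  have e : ∀ g, shearEnergy μ γ g = shearEnergy m γ g := fun g =>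
    integral_congr_ae ((ae_nu_of_ae_lam h).mono fun p hp => by simp only [hp])
  ext x
  rw [mem_shearEnergies, mem_shearEnergies]
  simp only [e]

lemma muGamma_congr (h : ∀ᵐ t ∂lam, μ t = m t) : muGamma μ = muGamma m :=
  funext fun γ => by rw [muGamma, muGamma, shearEnergies_congr h]

lemma IsLaminate.congr {Q : Pt → Mat3 → ℝ} (hQ : IsLaminate μ Q) (h : ∀ᵐ t ∂lam, μ t = m t) :
    IsLaminate m Q := by
  filter_upwards [hQ, ae_nu_of_ae_lam h] with p h1 h2
  rwa [h2] at h1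

end

lemma IsAdmissiblePrestrain.isL2 {B : Pt → Mat3} (hB : IsAdmissiblePrestrain B) : IsL2 B := by
  intro i j
  have hm := aestronglyMeasurable_of_Slab (f := fun p => B p i j) (hB.borel i j)
  have hi := hB.square_integrable
  rw [IntegrableOn, restrict_Box] at hi
  rw [memLp_two_iff_integrable_sq hm]
  refine hi.mono' (hm.pow 2) (Eventually.of_forall fun p => ?_)
  rw [Real.norm_of_nonneg (sq_nonneg _), pow_two]
  exact (Finset.single_le_sum (f := fun j => B p i j * B p i j)
    (fun j _ => mul_self_nonneg _) (Finset.mem_univ j)).trans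
    (Finset.single_le_sum (f := fun i => ∑ j, B p i j * B p i j)
      (fun i _ => Finset.sum_nonneg fun j _ => mul_self_nonneg _) (Finset.mem_univ i))

/-! ### Coefficients -/

lemma coeffG_zero (A : Mat2) : coeffG 0 A = A 0 0 := by simp [coeffG, frob, basisG]

lemma coeffG_one (A : Mat2) : coeffG 1 A = A 1 1 := by simp [coeffG, frob, basisG]

lemma coeffG_two {A : Mat2} (hA : A.IsSymm) : coeffG 2 A = Real.sqrt 2 * A 0 1 := by
  have hs : A 1 0 = A 0 1 := hA.apply 0 1
  have h2 : Real.sqrt 2 ^ 2 = 2 := Real.sq_sqrt (by norm_num)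
  simp [coeffG, frob, basisG, hs]
  field_simp
  rw [h2]; ring

/-- The third coefficient is `√2 G₁₂`, which turns `μ_γ/3` into `μ_γ/6`. -/
lemma effForm_self (μ : ℝ → ℝ) (γ : ℝ) {G : Mat2} (hG : G.IsSymm) : effForm μ γ G G =
    ((coeffG 0 G) ^ 2 * (harmonicMean μ / 6) + coeffG 0 G * coeffG 1 G * 0
      + (coeffG 1 G) ^ 2 * (arithmeticMean μ / 6)) + (coeffG 2 G) ^ 2 * (muGamma μ γ / 6) := by
  have h2 : Real.sqrt 2 ^ 2 = 2 := Real.sq_sqrt (by norm_num)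
  rw [coeffG_zero, coeffG_one, coeffG_two hG, effForm, mul_pow, h2]
  ring

/-- The effective prestrain of a spherical prestrain. -/
lemma coeffG_of_isEffectivePrestrain {a b γ : ℝ} {μ : ℝ → ℝ} {Q : Pt → Mat3 → ℝ}
    (hQ : IsLaminate μ Q) (hμ : IsModulus a b μ) (hγ : 0 < γ) {B : Pt → Mat3} (hB : IsL2 B)
    {ρ : ℝ → ℝ → ℝ} (hρ : ∀ᵐ p ∂nu, B p = ρ p.1 p.2.1 • (1 : Mat3)) {A : Mat2}
    (hA : IsEffectivePrestrain γ Q B A) :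
    coeffG 0 A = 12 * ∫ p, ρ p.1 p.2.1 * p.1 ∂nu ∧
      coeffG 1 A = 12 / arithmeticMean μ * ∫ p, μ p.2.1 * ρ p.1 p.2.1 * p.1 ∂nu ∧
      coeffG 2 A = 0 := by
  obtain ⟨w, g, h⟩ := exists_isShearSol hμ hγ
  have hAe := (isEffectivePrestrain_iff hQ hμ hγ h hB A).1 hA
  have p0 := hμ.harmonicMean_pos.ne'
  have c0 : coef μ γ g B 0 = 2 * harmonicMean μ * ∫ p, ρ p.1 p.2.1 * p.1 ∂nu := by
    simp only [coef, Matrix.cons_val]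
    congr 1
    refine integral_congr_ae (hρ.mono fun p hp => ?_)
    simp [hp, mul_comm]
  have c1 : coef μ γ g B 1 = 2 * ∫ p, μ p.2.1 * ρ p.1 p.2.1 * p.1 ∂nu := by
    simp only [coef, Matrix.cons_val]
    congr 1
    refine integral_congr_ae (hρ.mono fun p hp => ?_)
    simp [hp, mul_comm, mul_left_comm]
  have c2 : coef μ γ g B 2 = 0 := by
    simp only [coef, Matrix.cons_val]
    rw [integral_congr_ae (g := fun _ => 0) (hρ.mono fun p hp => ?_), integral_zero, mul_zero]
    simp [hp]
  rw [coeffG_zero, coeffG_one, coeffG_two hA.1, hAe, c0, c1, c2]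
  refine ⟨?_, ?_, ?_⟩ <;> simp
  · field_simp; ring
  · ring

end PlateLaminate

end

/-! ### The theorem. -/

theorem mainTheorem8 (α β : ℝ) (hα : 0 < α) (hαβ : α ≤ β)
    (Q : Pt → Mat3 → ℝ) (B : Pt → Mat3)
    (hQ : IsAdmissibleForm α β Q) (hB : IsAdmissiblePrestrain B)
    (μ : ℝ → ℝ)
    (hQμ : ∀ᵐ p ∂(volume.restrict Slab), ∀ G : Mat3,
      Q p G = 2 * μ p.2.1 * frob (symPart G) (symPart G))
    (hμ : ∀ᵐ t ∂(volume.restrict (Ioo (-1 / 2 : ℝ) (1 / 2))), μ (-t) = μ t) :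
    -- the minimum that defines `μ_γ` is attained, and the effective prestrain is well defined
    (∀ γ : ℝ, 0 < γ → IsLeast (shearEnergies μ γ) (muGamma μ γ)) ∧
    (∀ γ : ℝ, 0 < γ → ∃! A : Mat2, IsEffectivePrestrain γ Q B A) ∧
    -- (a)
    (∀ γ : ℝ, 0 < γ → harmonicMean μ ≤ muGamma μ γ ∧ muGamma μ γ ≤ arithmeticMean μ) ∧
    ContinuousOn (muGamma μ) (Ioi 0) ∧
    AntitoneOn (muGamma μ) (Ioi 0) ∧
    Tendsto (muGamma μ) (𝓝[>] 0) (𝓝 (arithmeticMean μ)) ∧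
    Tendsto (muGamma μ) atTop (𝓝 (harmonicMean μ)) ∧
    ((¬ ∃ c : ℝ, ∀ᵐ t ∂(volume.restrict (Ioo (-1 / 2 : ℝ) (1 / 2))), μ t = c) →
      StrictAntiOn (muGamma μ) (Ioi 0)) ∧
    -- (b)
    (∀ γ : ℝ, 0 < γ → IsOrthotropicWith (Qhom γ Q)
      (harmonicMean μ / 6) (arithmeticMean μ / 6) 0 (muGamma μ γ / 6)) ∧
    -- (c)
    (∀ ρ : ℝ → ℝ → ℝ,
      (∀ᵐ p ∂(volume.restrict Slab), B p = ρ p.1 p.2.1 • (1 : Mat3)) →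
      ∀ γ : ℝ, 0 < γ → ∀ A : Mat2, IsEffectivePrestrain γ Q B A →
        coeffG 0 A = 12 * ∫ p in Box, ρ p.1 p.2.1 * p.1 ∧
        coeffG 1 A = 12 / arithmeticMean μ * ∫ p in Box, μ p.2.1 * ρ p.1 p.2.1 * p.1 ∧
        coeffG 2 A = 0) := by
  have hL : IsLaminate μ Q := ae_nu_of_ae_Slab hQμ
  -- All averages and energies depend on `μ` only up to null sets of the period cell, so `μ` is
  -- replaced by a bounded, measurable, periodic representative `m`.
  obtain ⟨m, hm, hμm⟩ := exists_isModulus hα hαβ hQ hL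
  have hLm := hL.congr hμm
  have hBL := hB.isL2
  rw [muGamma_congr hμm, harmonicMean_congr hμm, arithmeticMean_congr hμm]
  refine ⟨fun γ hγ => ?_, fun γ hγ => ?_, fun γ hγ => ⟨hm.harmonicMean_le_muGamma hγ,
    hm.muGamma_le_arithmeticMean hγ⟩, hm.continuousOn_muGamma, hm.antitoneOn_muGamma,
    hm.tendsto_zero_muGamma, hm.tendsto_atTop_muGamma, fun hne => ?_, fun γ hγ G hG => ?_,
    fun ρ hρ γ hγ A hA => ?_⟩
  · rw [shearEnergies_congr hμm]
    exact hm.isLeast_muGamma hγ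
  · obtain ⟨w, g, h⟩ := exists_isShearSol hm hγ
    exact ⟨_, (isEffectivePrestrain_iff hLm hm hγ h hBL _).2 rfl,
      fun A hA => (isEffectivePrestrain_iff hLm hm hγ h hBL A).1 hA⟩
  · refine hm.strictAntiOn_muGamma fun ⟨c, hc⟩ => hne ⟨c, ?_⟩
    filter_upwards [hc, hμm] with t h1 h2
    rw [h2, h1]
  · rw [hLm.Qhom_eq hm hγ hG, effForm_self m γ hG]
  · obtain ⟨h0, h1, h2⟩ := coeffG_of_isEffectivePrestrain hLm hm hγ hBL (ae_nu_of_ae_Slab hρ) hA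
    refine ⟨by rw [h0, restrict_Box], ?_, h2⟩
    rw [h1, restrict_Box]
    congr 1
    exact integral_congr_ae ((ae_nu_of_ae_lam hμm).mono fun p hp => by simp only [hp])
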